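/- **Conventions.** Manifolds are smooth, finite-dimensional, Hausdorff and without boundary. A singular semi-Riemannian manifold $(M,g)$ is a manifold with a smooth symmetric bilinear form $g=\langle\cdot,\cdot\rangle$ on $TM$, which may be degenerate and may change signature. Its Koszul form is $$\mathcal K(X,Y,Z)=\tfrac12\{X\langle Y,Z\rangle+Y\langle Z,X\rangle-Z\langle X,Y\rangle-\langle X,[Y,Z]\rangle+\langle Y,[Z,X]\rangle+\langle Z,[X,Y]\rangle\},$$ and $\nabla^\flat_XY$ is the one-form $Z\mapsto\mathcal K(X,Y,Z)$. Let $T_p^\bullet M=\{g_p(v,\cdot): v\in T_pM\}\subseteq T_p^*M$, with the inner product $\langle\langle g_p(v,\cdot),g_p(w,\cdot)\rangle\rangle_\bullet=g_p(v,w)$, and let $\mathcal A^\bullet(M)$ be the set of smooth one-forms $\omega$ with $\omega_p\in T^\bullet_pM$ for all $p\in M$. For vector fields $X,Y$ and a one-form $\omega$ put $$(\nabla_X\omega)(Y)=X(\omega(Y))-\langle\langle\nabla^\flat_XY,\omega\rangle\rangle_\bullet ;$$ this is defined on the regions of constant signature (the open dense set of points near which the signature of $g$ is constant) and is extended to the other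 points by its limit from these regions. $(M,g)$ is semi-regular if $\nabla^\flat_XY\in\mathcal A^\bullet(M)$ and $\nabla_Z(\nabla^\flat_XY)\in\mathcal A^\bullet(M)$ for all smooth vector fields $X,Y,Z$; its Riemann curvature is then $$R(X,Y,Z,T)=(\nabla_X\nabla^\flat_YZ)(T)-(\nabla_Y\nabla^\flat_XZ)(T)-(\nabla^\flat_{[X,Y]}Z)(T).$$ **Theorem.** Let $(B,g_B)$ be a non-degenerate semi-Riemannian manifold, let $(F_j,g_{F_j})$, $1\le j\le l$, be semi-regular semi-Riemannian manifolds, and let $f_j\in C^\infty(B)$, which may have zeros. Let $R$ be the Riemann curvature of the multiply warped product $$\Big(B\times F_1\times\cdots\times F_l,\ \pi_B^*g_B+\sum_{j=1}^l(f_j\circ\pi_B)^2\,\pi_{F_j}^*g_{F_j}\Big),$$ which is a semi-regular semi-Riemannian manifold, and let $R_B$, $R_{F_j}$ be the curvatures of $B$ and $F_j$. Let $g_B^*$ be the inner product on $T^*B$ induced by $g_B$ and $H^{f}(X,T)=X(T(f))-g_B^*(\nabla^\flat_XT,df)$ the Hessian of $f$ on $B$. Then for all $X,Y,Z,T\in\Gamma(TB)$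 and $U_j,V_j,W_j,Q_j\in\Gamma(TF_j)$, identified with their lifts to the product: 1. $R(X,Y,Z,T)=R_B(X,Y,Z,T)$. 2. $R(X,Y,Z,Q_j)=R(X,Y,W_j,Q_j)=0$. 3. $R(X,V_j,W_j,T)=-f_jH^{f_j}(X,T)\,g_{F_j}(V_j,W_j)$. 4. $R(X,Y,W_j,Q_k)=R(X,V_j,W_k,T)=R(X,V_j,W_k,Q_j)=R(X,W_k,V_j,Q_j)=0$ for $j\ne k$. 5. $R(U_j,V_j,Z,Q_j)=0$. 6. $R(X,W_k,V_j,Q_\alpha)=0$ for pairwise different $k,j,\alpha$. 7. $R(U_j,V_j,W_j,Q_j)=f_j^2R_{F_j}(U_j,V_j,W_j,Q_j)+f_j^2\,g_B^*(df_j,df_j)\,[g_{F_j}(U_j,W_j)g_{F_j}(V_j,Q_j)-g_{F_j}(V_j,W_j)g_{F_j}(U_j,Q_j)]$. 8. $R(U_k,V_j,W_j,Q_j)=R(U_k,V_k,W_j,Q_j)=0$ for $j\ne k$. 9. $R(U_k,V_j,W_k,Q_j)=f_kf_j\,g_B^*(df_k,df_j)\,g_{F_k}(U_k,W_k)\,g_{F_j}(V_j,Q_j)$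 for $j\ne k$. 10. $R(U_j,V_j,W_k,Q_\alpha)=R(U_j,V_k,W_j,Q_\alpha)=0$ for pairwise different $j,k,\alpha$. 11. $R(U_j,V_k,W_\alpha,Q_\beta)=0$ for pairwise different $j,k,\alpha,\beta$. -/

import Mathlib

open Set Filter Topology Manifold ContDiff

noncomputable section

namespace SingularGeometry

/-! ### Finite products of smooth manifolds -/

/-- A finite product of `C^n` manifolds, with the product charts, is a `C^n` manifold. -/
instance piIsManifold {ι : Type*} [Fintype ι] {E : ι → Type*} [∀ i, NormedAddCommGroup (E i)]
    [∀ i, NormedSpace ℝ (E i)] {H : ι → Type*} [∀ i, TopologicalSpace (H i)]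
    (I : ∀ i, ModelWithCorners ℝ (E i) (H i)) {n : ℕ∞ω} (F : ι → Type*)
    [∀ i, TopologicalSpace (F i)] [∀ i, ChartedSpace (H i) (F i)] [∀ i, IsManifold (I i) n (F i)] :
    IsManifold (ModelWithCorners.pi I) n (∀ i, F i) := by
  refine isManifold_of_contDiffOn _ _ _ ?_
  rintro _ _ ⟨e, he, rfl⟩ ⟨e', he', rfl⟩
  rw [contDiffOn_pi]
  intro i
  have h : ContDiffOn ℝ n (I i ∘ ((e i).symm ≫ₕ e' i) ∘ (I i).symm)
      ((I i).symm ⁻¹' ((e i).symm ≫ₕ e' i).source ∩ range (I i)) :=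
    ((contDiffGroupoid n (I i)).compatible (he i (mem_univ i)) (he' i (mem_univ i))).1
  have hp : ContDiff ℝ n (fun x : ∀ i, E i => x i) :=
    (ContinuousLinearMap.proj (R := ℝ) (φ := E) i).contDiff
  refine ContDiffOn.comp (g := I i ∘ ((e i).symm ≫ₕ e' i) ∘ (I i).symm) h hp.contDiffOn ?_
  rintro x ⟨hx, y, rfl⟩
  exact ⟨⟨hx.1 i (mem_univ i), hx.2 i (mem_univ i)⟩, y i, rfl⟩

/-! ### Vector fields, functions and forms -/

section Basic

variable {E : Type*} [NormedAddCommGroup E] [NormedSpace ℝ E] {H : Type*} [TopologicalSpace H]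
  (I : ModelWithCorners ℝ E H) (M : Type*) [TopologicalSpace M] [ChartedSpace H M]

/-- (Not necessarily smooth) vector fields on `M`. -/
abbrev VecField : Type _ := ∀ p : M, TangentSpace I p

/-- Fields of bilinear forms on the tangent spaces of `M`. -/
abbrev BilinField : Type _ := ∀ p : M, TangentSpace I p →L[ℝ] TangentSpace I p →L[ℝ] ℝ

/-- One-forms, given by their values on vector fields; only the values on smooth vector fields are
ever used. -/
abbrev Form : Type _ := VecField I M → M → ℝ

variable {I M}

/-- `X ∈ Γ(TM)`. -/
def IsSmoothField [IsManifold I ∞ M] (X : VecField I M) : Prop :=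
  ContMDiff I I.tangent ∞ (fun p => (⟨p, X p⟩ : TangentBundle I M))

/-- `h ∈ C^∞(M)`. -/
def IsSmoothFun (h : M → ℝ) : Prop := ContMDiff I 𝓘(ℝ, ℝ) ∞ h

/-- The derivative `X(h)` of a function `h` along a vector field `X`. -/
def dirDeriv (X : VecField I M) (h : M → ℝ) : M → ℝ :=
  fun p => mfderiv I 𝓘(ℝ, ℝ) h p (X p)

/-- The differential `dh`, as the one-form `Z ↦ Z(h)`. -/
def differential (h : M → ℝ) : Form I M := fun Z => dirDeriv Z h

/-- The function `⟨X, Y⟩ = g(X, Y)`. -/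
def pairing (g : BilinField I M) (X Y : VecField I M) : M → ℝ := fun p => g p (X p) (Y p)

/-! ### Singular semi-Riemannian geometry -/

/-- `g` is the metric of a singular semi-Riemannian manifold: a smooth symmetric bilinear form on
the tangent bundle, which may be degenerate and may change its signature. -/
structure IsSingularMetric [IsManifold I ∞ M] (g : BilinField I M) : Prop where
  symm : ∀ (p : M) (v w : TangentSpace I p), g p v w = g p w v
  smooth : ∀ X Y : VecField I M, IsSmoothField X → IsSmoothField Y →
    IsSmoothFun (I := I) (pairing g X Y)

/-- `g` is non-degenerate at every point. -/
def IsNondegenerate (g : BilinField I M) : Prop :=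
  ∀ (p : M) (v : TangentSpace I p), (∀ w : TangentSpace I p, g p v w = 0) → v = 0

/-- The Koszul form `𝒦(X, Y, Z)`. -/
def koszul (g : BilinField I M) (X Y Z : VecField I M) : M → ℝ := fun p =>
  (1 / 2 : ℝ) *
    (dirDeriv X (pairing g Y Z) p + dirDeriv Y (pairing g Z X) p - dirDeriv Z (pairing g X Y) p
      - g p (X p) (VectorField.mlieBracket I Y Z p)
      + g p (Y p) (VectorField.mlieBracket I Z X p)
      + g p (Z p) (VectorField.mlieBracket I X Y p))

/-- The lower covariant derivative `∇^♭_X Y`, the one-form `Z ↦ 𝒦(X, Y, Z)`. -/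
def lowerDeriv (g : BilinField I M) (X Y : VecField I M) : Form I M := fun Z => koszul g X Y Z

/-- `α_p = v^♭ = g_p(v, ·)`. -/
def RepresentsAt [IsManifold I ∞ M] (g : BilinField I M) (α : Form I M) (p : M)
    (v : TangentSpace I p) : Prop :=
  ∀ Z : VecField I M, IsSmoothField Z → α Z p = g p v (Z p)

/-- `α ∈ 𝒜^•(M)`: `α` is a smooth one-form and, at every point `p`, the covector `α_p` lies in
`T_p^•M = {v^♭ : v ∈ T_pM}`. (In particular `α_p` depends linearly on the value at `p` of the
argument only, so that `α` is indeed a one-form.) -/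
def IsAnnihForm [IsManifold I ∞ M] (g : BilinField I M) (α : Form I M) : Prop :=
  (∀ Z : VecField I M, IsSmoothField Z → IsSmoothFun (I := I) (α Z)) ∧
    ∀ p : M, ∃ v : TangentSpace I p, RepresentsAt g α p v

open Classical in
/-- The inner product `⟨⟨α, τ⟩⟩_•` on `T_p^•M`: its value at `p` is `g_p(v, w)` whenever
`α_p = v^♭` and `τ_p = w^♭` (this does not depend on the choice of `v` and `w`). For one-forms `α`,
`τ` on a manifold with non-degenerate metric it is the usual inner product `g^*(α, τ)`. -/
def annihInner [IsManifold I ∞ M] (g : BilinField I M) (α τ : Form I M) : M → ℝ := fun p =>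
  if h : (∃ v : TangentSpace I p, RepresentsAt g α p v) ∧
      ∃ w : TangentSpace I p, RepresentsAt g τ p w
  then g p h.1.choose h.2.choose else 0

/-- The union of the regions of constant signature: the points near which the rank of `g` is
constant. (By continuity of `g`, its signature is locally constant wherever its rank is.) This is
an open and dense subset of `M`. -/
def constSignatureRegion (g : BilinField I M) : Set M :=
  {p | ∀ᶠ q in 𝓝 p, Module.finrank ℝ (LinearMap.range (g q).toLinearMap)
    = Module.finrank ℝ (LinearMap.range (g p).toLinearMap)}

open Classical in
/-- The covariant derivative `(∇_X α)(Y) = X(α(Y)) - ⟨⟨∇^♭_X Y, α⟩⟩_•`. It is defined by this formula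
on the regions of constant signature and extended to the remaining points by its limit from these
regions. -/
def covDeriv [IsManifold I ∞ M] (g : BilinField I M) (X : VecField I M) (α : Form I M) :
    Form I M := fun Y p =>
  if p ∈ constSignatureRegion g then
    dirDeriv X (α Y) p - annihInner g (lowerDeriv g X Y) α p
  else limUnder (𝓝[constSignatureRegion g] p)
    (fun q => dirDeriv X (α Y) q - annihInner g (lowerDeriv g X Y) α q)

/-- Semi-regular semi-Riemannian manifolds: `∇^♭_X Y ∈ 𝒜^•(M)` and `∇_Z (∇^♭_X Y) ∈ 𝒜^•(M)` for
all smooth vector fields `X`, `Y`, `Z`. -/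
structure IsSemiRegular [IsManifold I ∞ M] (g : BilinField I M) : Prop
    extends IsSingularMetric g where
  radical_stationary : ∀ X Y : VecField I M, IsSmoothField X → IsSmoothField Y →
    IsAnnihForm g (lowerDeriv g X Y)
  semi_regular : ∀ X Y Z : VecField I M, IsSmoothField X → IsSmoothField Y → IsSmoothField Z →
    IsAnnihForm g (covDeriv g Z (lowerDeriv g X Y))

/-- The Riemann curvature
`R(X, Y, Z, T) = (∇_X ∇^♭_Y Z)(T) - (∇_Y ∇^♭_X Z)(T) - (∇^♭_[X,Y] Z)(T)`. -/
def curvature [IsManifold I ∞ M] (g : BilinField I M) (X Y Z T : VecField I M) : M → ℝ := fun p =>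
  covDeriv g X (lowerDeriv g Y Z) T p - covDeriv g Y (lowerDeriv g X Z) T p
    - lowerDeriv g (VectorField.mlieBracket I X Y) Z T p

/-- The Hessian `H^h(X, T) = (∇_X dh)(T) = X(T(h)) - ⟨⟨∇^♭_X T, dh⟩⟩_•` of a function `h`. -/
def hessian [IsManifold I ∞ M] (g : BilinField I M) (h : M → ℝ) (X T : VecField I M) : M → ℝ :=
  covDeriv g X (differential h) T

end Basic

/-! ### Multiply warped products -/

section Warped

variable {EB : Type*} [NormedAddCommGroup EB] [NormedSpace ℝ EB] {HB : Type*} [TopologicalSpace HB]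
  {IB : ModelWithCorners ℝ EB HB} {B : Type*} [TopologicalSpace B] [ChartedSpace HB B]
  {l : ℕ} {EF : Fin l → Type*} [∀ j, NormedAddCommGroup (EF j)] [∀ j, NormedSpace ℝ (EF j)]
  {HF : Fin l → Type*} [∀ j, TopologicalSpace (HF j)]
  {IF : ∀ j, ModelWithCorners ℝ (EF j) (HF j)}
  {F : Fin l → Type*} [∀ j, TopologicalSpace (F j)] [∀ j, ChartedSpace (HF j) (F j)]

/-- The pullback `φ^* g` of a field of bilinear forms under a map `φ`. -/
def pullbackForm {E E' : Type*} [NormedAddCommGroup E] [NormedSpace ℝ E]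
    [NormedAddCommGroup E'] [NormedSpace ℝ E'] {H H' : Type*} [TopologicalSpace H]
    [TopologicalSpace H'] {I : ModelWithCorners ℝ E H} {I' : ModelWithCorners ℝ E' H'}
    {M N : Type*} [TopologicalSpace M] [ChartedSpace H M] [TopologicalSpace N] [ChartedSpace H' N]
    (φ : M → N) (g : BilinField I' N) : BilinField I M := fun p =>
  (mfderiv I I' φ p).precomp ℝ ∘L g (φ p) ∘L mfderiv I I' φ p

/-- The metric `π_B^* g_B + ∑ j, (f_j ∘ π_B)^2 π_{F_j}^* g_{F_j}` of the multiply warped product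
`B × F_1 × ⋯ × F_l`. -/
def warpedMetric (gB : BilinField IB B) (gF : ∀ j, BilinField (IF j) (F j)) (f : Fin l → B → ℝ) :
    BilinField (IB.prod (ModelWithCorners.pi IF)) (B × ∀ j, F j) := fun p =>
  pullbackForm (fun q : B × ∀ j, F j => q.1) gB p
    + ∑ j, (f j p.1) ^ 2 • pullbackForm (fun q : B × ∀ j, F j => q.2 j) (gF j) p

/-- The lift to `B × F_1 × ⋯ × F_l` of a vector field on `B`. -/
def liftB (X : VecField IB B) :
    VecField (IB.prod (ModelWithCorners.pi IF)) (B × ∀ j, F j) :=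
  fun p => ((X p.1, 0) : EB × ∀ j, EF j)

/-- The lift to `B × F_1 × ⋯ × F_l` of a vector field on `F_j`. -/
def liftF (j : Fin l) (V : VecField (IF j) (F j)) :
    VecField (IB.prod (ModelWithCorners.pi IF)) (B × ∀ j, F j) :=
  fun p => ((0, Pi.single j (V (p.2 j))) : EB × ∀ j, EF j)

end Warped

end SingularGeometry

end

open SingularGeometry

noncomputable section

namespace SingularGeometry

section Calculus

variable {E : Type*} [NormedAddCommGroup E] [NormedSpace ℝ E] {H : Type*} [TopologicalSpace H]
  {I : ModelWithCorners ℝ E H} {M : Type*} [TopologicalSpace M] [ChartedSpace H M]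

/-! ### Smooth functions and directional derivatives -/

section Functions

/-! Call a vector field on the product split if it is a sum X + U of lifts, with X from the base and
U = (U_j) from the fibers. Brackets of split fields are taken factor by factor. Write g_j and K_j
for the metric and the Koszul form of F_j. On split fields the Koszul form of X + U, Y + V, Z + W is
K_B(X,Y,Z) plus the sum over j of f_j X(f_j) g_j(V_j,W_j) + f_j Y(f_j) g_j(U_j,W_j) - f_j Z(f_j)
g_j(U_j,V_j) + f_j² K_j(U_j,V_j,W_j) (`koszul_warpedMetric`). Each term with W_j carries a factor
f_j, and f_j a = f_j² (a / f_j) also at a zero of f_j, with the convention a / 0 = 0. So the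
covector is represented by an explicit tangent vector (`warpedRep`) even where the metric
degenerates.

The inner product of two such covectors contains f_j² (X(f_j)/f_j)(Z(f_j)/f_j), which should be
X(f_j) Z(f_j). This is justified on the regions of constant signature. The rank of the warped metric
is dim B + ∑ rank(f_j² g_j), and every summand is lower semicontinuous; where the sum is locally
constant, so is each summand. Hence at a zero of f_j in such a region either f_j vanishes nearby, so
df_j = 0, or g_j = 0 at the fiber point (`mvfderiv_eq_zero_or_eq_zero`); the disputed terms vanish
in both cases (`annihInner_warpedMetric`).

In X(α(T)) - ⟨⟨∇^♭_X T, α⟩⟩ the products X(f_j)Y(f_j) g_j(W_j,Q_j) and X(f_j)Z(f_j) g_j(V_j,Q_j)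
cancel. What is left, `warpedCovDeriv`, is smooth on the whole product, and its terms with Q_j again
carry a factor f_j, so it is also represented by a tangent vector. The regions of constant signature
are dense, because the rank is bounded and lower semicontinuous; so this expression is the covariant
derivative everywhere (`covDeriv_eq_of_continuousAt`).

Semi-regularity need only be checked on split fields, since they generate all fields locally and the
failure of each slot to be tensorial is itself a form in T^• (`isSemiRegular_of_generators`).
Antisymmetrizing `warpedCovDeriv` gives a single curvature formula (`curvature_warpedMetric`): R_B,
the f_j² R_{F_j}, Hessian terms, and a double sum weighted by g_B^*(df_k, df_j). All the identities
are specializations of it to lifts. -/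

theorem IsSmoothFun.contMDiff {h : M → ℝ} (hh : IsSmoothFun (I := I) h) :
    ContMDiff I 𝓘(ℝ, ℝ) ∞ h := hh

theorem IsSmoothFun.mdifferentiableAt {h : M → ℝ} (hh : IsSmoothFun (I := I) h) (p : M) :
    MDifferentiableAt I 𝓘(ℝ, ℝ) h p :=
  (hh.contMDiff p).mdifferentiableAt (by simp)

theorem IsSmoothFun.continuous {h : M → ℝ} (hh : IsSmoothFun (I := I) h) : Continuous h :=
  hh.contMDiff.continuous

theorem IsSmoothFun.const (c : ℝ) : IsSmoothFun (I := I) (fun _ : M => c) := contMDiff_const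

theorem IsSmoothFun.add {h k : M → ℝ} (hh : IsSmoothFun (I := I) h) (hk : IsSmoothFun (I := I) k) :
    IsSmoothFun (I := I) (fun p => h p + k p) := ContMDiff.add hh hk

theorem IsSmoothFun.sub {h k : M → ℝ} (hh : IsSmoothFun (I := I) h) (hk : IsSmoothFun (I := I) k) :
    IsSmoothFun (I := I) (fun p => h p - k p) := ContMDiff.sub hh hk

theorem IsSmoothFun.neg {h : M → ℝ} (hh : IsSmoothFun (I := I) h) :
    IsSmoothFun (I := I) (fun p => -h p) := ContMDiff.neg hh

theorem IsSmoothFun.mul {h k : M → ℝ} (hh : IsSmoothFun (I := I) h) (hk : IsSmoothFun (I := I) k) :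
    IsSmoothFun (I := I) (fun p => h p * k p) := ContMDiff.mul hh hk

theorem IsSmoothFun.pow {h : M → ℝ} (hh : IsSmoothFun (I := I) h) (n : ℕ) :
    IsSmoothFun (I := I) (fun p => h p ^ n) := ContMDiff.pow hh n

theorem IsSmoothFun.sum {ι : Type*} {s : Finset ι} {h : ι → M → ℝ}
    (hh : ∀ i ∈ s, IsSmoothFun (I := I) (h i)) :
    IsSmoothFun (I := I) (fun p => ∑ i ∈ s, h i p) := contMDiff_finsetSum hh

variable {X Y : VecField I M} {h k : M → ℝ} {p : M}

theorem dirDeriv_congr (hX : X p = Y p) (hh : h =ᶠ[𝓝 p] k) :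
    dirDeriv X h p = dirDeriv Y k p := by
  simp only [dirDeriv, hX, hh.mfderiv_eq]
  rfl

theorem dirDeriv_const (c : ℝ) : dirDeriv X (fun _ => c) p = 0 := by
  simp only [dirDeriv, mfderiv_const]; rfl

theorem dirDeriv_add (hh : MDifferentiableAt I 𝓘(ℝ, ℝ) h p)
    (hk : MDifferentiableAt I 𝓘(ℝ, ℝ) k p) :
    dirDeriv X (fun q => h q + k q) p = dirDeriv X h p + dirDeriv X k p := by
  have := congrArg (fun L => L (X p)) (mvfderiv_add hh hk)
  exact this

theorem dirDeriv_mul (hh : MDifferentiableAt I 𝓘(ℝ, ℝ) h p)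
    (hk : MDifferentiableAt I 𝓘(ℝ, ℝ) k p) :
    dirDeriv X (fun q => h q * k q) p = h p * dirDeriv X k p + dirDeriv X h p * k p := by
  have := congrArg (fun L => L (X p)) (mvfderiv_mul hh hk)
  refine Eq.trans this ?_
  change h p * dirDeriv X k p + k p * dirDeriv X h p = _
  ring

theorem dirDeriv_sub (hh : MDifferentiableAt I 𝓘(ℝ, ℝ) h p)
    (hk : MDifferentiableAt I 𝓘(ℝ, ℝ) k p) :
    dirDeriv X (fun q => h q - k q) p = dirDeriv X h p - dirDeriv X k p := by
  have := congrArg (fun L => L (X p)) (mvfderiv_sub hh hk)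
  exact this

theorem dirDeriv_sum {ι : Type*} (s : Finset ι) {h : ι → M → ℝ}
    (hh : ∀ i, IsSmoothFun (I := I) (h i)) :
    dirDeriv X (fun q => ∑ i ∈ s, h i q) p = ∑ i ∈ s, dirDeriv X (h i) p := by
  classical
  induction s using Finset.induction_on with
  | empty => simpa using dirDeriv_const (X := X) (p := p) 0
  | insert a s ha ih =>
    simp only [Finset.sum_insert ha]
    rw [dirDeriv_add ((hh a).mdifferentiableAt p)
      ((IsSmoothFun.sum fun i _ => hh i).mdifferentiableAt p), ih]

theorem dirDeriv_field_add : dirDeriv (X + Y) h p = dirDeriv X h p + dirDeriv Y h p :=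
  map_add (mfderiv I 𝓘(ℝ, ℝ) h p) (X p) (Y p)

theorem dirDeriv_field_smul (φ : M → ℝ) : dirDeriv (φ • X) h p = φ p * dirDeriv X h p :=
  map_smul (mfderiv I 𝓘(ℝ, ℝ) h p) (φ p) (X p)

end Functions

/-! ### Smooth vector fields and their brackets -/

section Fields

variable [IsManifold I ∞ M] {X Y Z : VecField I M} {h : M → ℝ}

theorem IsSmoothField.contMDiff (hX : IsSmoothField X) :
    ContMDiff I I.tangent ∞ (fun p => (⟨p, X p⟩ : TangentBundle I M)) := hX

theorem IsSmoothField.mdifferentiableAt (hX : IsSmoothField X) (p : M) :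
    MDifferentiableAt I I.tangent (fun p => (⟨p, X p⟩ : TangentBundle I M)) p :=
  (hX.contMDiff p).mdifferentiableAt (by simp)

theorem IsSmoothField.add (hX : IsSmoothField X) (hY : IsSmoothField Y) : IsSmoothField (X + Y) :=
  ContMDiff.add_section hX hY

theorem IsSmoothField.smul {φ : M → ℝ} (hφ : IsSmoothFun (I := I) φ) (hX : IsSmoothField X) :
    IsSmoothField (φ • X) := ContMDiff.smul_section hφ hX

theorem IsSmoothField.zero : IsSmoothField (0 : VecField I M) :=
  Bundle.contMDiff_zeroSection ℝ (TangentSpace I : M → Type _)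

theorem IsSmoothField.sum {ι : Type*} {s : Finset ι} {X : ι → VecField I M}
    (hX : ∀ i ∈ s, IsSmoothField (X i)) : IsSmoothField (fun p => ∑ i ∈ s, X i p) :=
  ContMDiff.sum_section hX

theorem IsSmoothField.dirDeriv (hX : IsSmoothField X) (hh : IsSmoothFun (I := I) h) :
    IsSmoothFun (I := I) (dirDeriv X h) := by
  have h1 : ContMDiff I.tangent 𝓘(ℝ, ℝ).tangent ∞ (tangentMap I 𝓘(ℝ, ℝ) h) :=
    hh.contMDiff.contMDiff_tangentMap (by simp)
  exact (contMDiff_snd_tangentBundle_modelSpace ℝ 𝓘(ℝ, ℝ)).comp (h1.comp hX.contMDiff)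

variable [CompleteSpace E]

theorem IsSmoothField.mlieBracket (hX : IsSmoothField X) (hY : IsSmoothField Y) :
    IsSmoothField (VectorField.mlieBracket I X Y) := by
  have : IsManifold I (((⊤ : ℕ∞) : ℕ∞ω) + 1) M := ‹IsManifold I ∞ M›
  have : IsManifold I (minSmoothness ℝ 2) M := .of_le (n := ∞) (by simp [ENat.LEInfty.out])
  have : IsManifold I (minSmoothness ℝ 3) M := .of_le (n := ∞) (by simp [ENat.LEInfty.out])
  exact ContDiff.mlieBracket_vectorField (m := ⊤) (n := ⊤) hX hY (by simp)

theorem mlieBracket_smul_right_apply {φ : M → ℝ} (hφ : IsSmoothFun (I := I) φ)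
    (hY : IsSmoothField Y) (p : M) :
    VectorField.mlieBracket I X (φ • Y) p
      = dirDeriv X φ p • Y p + φ p • VectorField.mlieBracket I X Y p := by
  exact VectorField.mlieBracket_smul_right (hφ.mdifferentiableAt p) (hY.mdifferentiableAt p)

theorem mlieBracket_smul_left_apply {φ : M → ℝ} (hφ : IsSmoothFun (I := I) φ)
    (hX : IsSmoothField X) (p : M) :
    VectorField.mlieBracket I (φ • X) Y p
      = -(dirDeriv Y φ p • X p) + φ p • VectorField.mlieBracket I X Y p := by
  rw [VectorField.mlieBracket_swap_apply, mlieBracket_smul_right_apply hφ hX,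
    VectorField.mlieBracket_swap_apply (V := Y) (W := X), neg_add, smul_neg, neg_neg]

theorem mlieBracket_add_left_apply (hX : IsSmoothField X) (hY : IsSmoothField Y) (p : M) :
    VectorField.mlieBracket I (X + Y) Z p
      = VectorField.mlieBracket I X Z p + VectorField.mlieBracket I Y Z p := by
  exact VectorField.mlieBracket_add_left (hX.mdifferentiableAt p) (hY.mdifferentiableAt p)

theorem mlieBracket_add_right_apply (hX : IsSmoothField X) (hY : IsSmoothField Y) (p : M) :
    VectorField.mlieBracket I Z (X + Y) p
      = VectorField.mlieBracket I Z X p + VectorField.mlieBracket I Z Y p := by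
  exact VectorField.mlieBracket_add_right (hX.mdifferentiableAt p) (hY.mdifferentiableAt p)

theorem mlieBracket_jacobi (hX : IsSmoothField X) (hY : IsSmoothField Y) (hZ : IsSmoothField Z)
    (p : M) :
    VectorField.mlieBracket I X (VectorField.mlieBracket I Y Z) p =
      VectorField.mlieBracket I (VectorField.mlieBracket I X Y) Z p
        + VectorField.mlieBracket I Y (VectorField.mlieBracket I X Z) p := by
  have : IsManifold I (minSmoothness ℝ 3) M := .of_le (n := ∞) (by simp [ENat.LEInfty.out])
  have hle : minSmoothness ℝ 2 ≤ ∞ := by simp [ENat.LEInfty.out]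
  exact VectorField.leibniz_identity_mlieBracket_apply ((hX.contMDiff p).of_le hle)
    ((hY.contMDiff p).of_le hle) ((hZ.contMDiff p).of_le hle)

end Fields

end Calculus

section Frames

variable {E : Type*} [NormedAddCommGroup E] [NormedSpace ℝ E] {H : Type*} [TopologicalSpace H]
  {I : ModelWithCorners ℝ E H} {M : Type*} [TopologicalSpace M] [ChartedSpace H M]

/-! ### Local frames of globally defined smooth vector fields -/

theorem dirDeriv_eq_mvfderiv (X : VecField I M) (h : M → ℝ) (p : M) :
    dirDeriv X h p = mvfderiv I h p (X p) := rfl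

variable [IsManifold I ∞ M]

variable (I M) in
/-- Near every point, the tangent vectors are the combinations of finitely many globally defined
smooth vector fields, with the differentials of globally defined smooth functions as
coefficients. -/
def HasLocalFrames : Prop :=
  ∀ p : M, ∃ (ι : Type) (_ : Fintype ι) (e : ι → VecField I M) (x : ι → M → ℝ),
    (∀ a, IsSmoothField (e a)) ∧ (∀ a, IsSmoothFun (I := I) (x a)) ∧
      ∀ᶠ q in 𝓝 p, ∀ v : TangentSpace I q, ∑ a, mvfderiv I (x a) q v • e a q = v

/-- Chart coordinates and coordinate fields, made global by a bump function equal to 1 near `p`. The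
duality relation is more than `HasLocalFrames` asks for; it serves to invert the Gram matrix of a
non-degenerate metric. -/
theorem exists_dual_frame [FiniteDimensional ℝ E] [T2Space M] (p : M) :
    ∃ (n : ℕ) (e : Fin n → VecField I M) (x : Fin n → M → ℝ),
      (∀ a, IsSmoothField (e a)) ∧ (∀ a, IsSmoothFun (I := I) (x a)) ∧
      ∀ᶠ q in 𝓝 p, (∀ v : TangentSpace I q, ∑ a, mvfderiv I (x a) q v • e a q = v) ∧
        ∀ a b, mvfderiv I (x a) q (e b q) = if a = b then 1 else 0 := by
  let n := Module.finrank ℝ E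
  let b : Module.Basis (Fin n) ℝ E := Module.finBasis ℝ E
  obtain ⟨χ⟩ : Nonempty (SmoothBumpFunction I p) := inferInstance
  let t := trivializationAt E (TangentSpace I) p
  have hbase : t.baseSet = (chartAt H p).source := rfl
  let c : Fin n → (E →L[ℝ] ℝ) := fun a => (b.coord a).toContinuousLinearMap
  refine ⟨n, fun a => (χ : M → ℝ) • t.localFrame b a, fun a q => χ q • c a (extChartAt I p q),
    fun a => ?_, fun a => ?_, ?_⟩
  · refine ContMDiffOn.smul_section_of_tsupport (u := (chartAt H p).source)
      χ.contMDiff.contMDiffOn (chartAt H p).open_source χ.tsupport_subset_chartAt_source ?_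
    rw [← hbase]
    exact t.contMDiffOn_localFrame_baseSet ∞ b a
  · refine χ.contMDiff_smul ?_
    exact (c a).contDiff.contMDiff.comp_contMDiffOn contMDiffOn_extChartAt
  · have hχ := χ.eventuallyEq_one.eventuallyEq_nhds
    have hs : ∀ᶠ q in 𝓝 p, q ∈ (chartAt H p).source := chart_source_mem_nhds H p
    filter_upwards [hχ, hs] with q hq hqs
    have hder : ∀ (a : Fin n) (v : TangentSpace I q),
        mvfderiv I (fun q => χ q • c a (extChartAt I p q)) q v
          = b.coord a (t.continuousLinearMapAt ℝ q v) := by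
      intro a v
      have h1 : (fun q => χ q • c a (extChartAt I p q)) =ᶠ[𝓝 q] (c a) ∘ extChartAt I p := by
        filter_upwards [hq] with r hr
        simp [hr]
      have h2 : HasMFDerivAt I 𝓘(ℝ, ℝ) ((c a) ∘ extChartAt I p) q
          ((c a).comp (mfderiv I 𝓘(ℝ, E) (extChartAt I p) q)) :=
        HasMFDerivAt.comp q (c a).hasMFDerivAt
          (mdifferentiableAt_extChartAt hqs).hasMFDerivAt
      have h3 := (h2.congr_of_eventuallyEq h1).mfderiv
      rw [TangentBundle.continuousLinearMapAt_trivializationAt hqs]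
      exact congrArg (fun L => L v) h3
    have he : ∀ a, ((χ : M → ℝ) • t.localFrame b a) q = t.symmL ℝ q (b a) := by
      intro a
      have : (χ : M → ℝ) q = 1 := hq.self_of_nhds
      rw [Pi.smul_apply', this, one_smul, t.localFrame_apply_of_mem_baseSet b hqs]
      refine (b.map_apply _ _).trans ?_
      exact (t.linearEquivAt_symm_apply (R := ℝ) q hqs (b a)).trans (t.symmL_apply hqs (b a)).symm
    refine ⟨fun v => ?_, fun a a' => ?_⟩
    · have h4 : ∀ a, mvfderiv I (fun q => χ q • c a (extChartAt I p q)) q v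
          • ((χ : M → ℝ) • t.localFrame b a) q
          = t.symmL ℝ q (b.repr (t.continuousLinearMapAt ℝ q v) a • b a) := fun a => by
        rw [hder, he, map_smul, Module.Basis.coord_apply]
      rw [Finset.sum_congr rfl fun a _ => h4 a, ← map_sum, b.sum_repr]
      exact t.symmL_continuousLinearMapAt hqs v
    · rw [hder, he, t.continuousLinearMapAt_symmL hqs]
      simp [Finsupp.single_apply, eq_comm]

theorem hasLocalFrames [FiniteDimensional ℝ E] [T2Space M] : HasLocalFrames I M := by
  intro p
  obtain ⟨n, e, x, he, hx, h⟩ := exists_dual_frame (I := I) p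
  exact ⟨Fin n, inferInstance, e, x, he, hx, h.mono fun q hq => hq.1⟩

theorem HasLocalFrames.exists_field (hM : HasLocalFrames I M) (p : M) (v : TangentSpace I p) :
    ∃ X : VecField I M, IsSmoothField X ∧ X p = v := by
  obtain ⟨ι, _, e, x, he, hx, h⟩ := hM p
  refine ⟨fun q => ∑ a, ((fun _ : M => mvfderiv I (x a) p v) • e a) q,
    IsSmoothField.sum fun a _ => (he a).smul (.const _), ?_⟩
  exact h.self_of_nhds v

theorem HasLocalFrames.eq_of_mvfderiv (hM : HasLocalFrames I M) {p : M} {v w : TangentSpace I p}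
    (h : ∀ x : M → ℝ, IsSmoothFun (I := I) x → mvfderiv I x p v = mvfderiv I x p w) : v = w := by
  obtain ⟨ι, _, e, x, he, hx, hs⟩ := hM p
  rw [← hs.self_of_nhds v, ← hs.self_of_nhds w]
  simp only [h _ (hx _)]

/-- The Lie bracket acts on functions as the commutator of derivations. -/
theorem HasLocalFrames.dirDeriv_mlieBracket [CompleteSpace E] (hM : HasLocalFrames I M)
    {X Y : VecField I M} (hX : IsSmoothField X) (hY : IsSmoothField Y) {h : M → ℝ}
    (hh : IsSmoothFun (I := I) h) (p : M) :
    dirDeriv (VectorField.mlieBracket I X Y) h p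
      = dirDeriv X (dirDeriv Y h) p - dirDeriv Y (dirDeriv X h) p := by
  -- The argument below reads off the coefficient of a field that is nonzero at `p`, so a zero
  -- tangent space is treated apart.
  by_cases hz : ∀ v : TangentSpace I p, v = 0
  · simp only [dirDeriv_eq_mvfderiv, hz (X p), hz (Y p), hz (VectorField.mlieBracket I X Y p),
      map_zero, sub_zero]
  push Not at hz
  obtain ⟨w, hw⟩ := hz
  obtain ⟨W, hW, rfl⟩ := hM.exists_field p w
  have e1 : ∀ {A : VecField I M}, VectorField.mlieBracket I A (h • W)
      = dirDeriv A h • W + h • VectorField.mlieBracket I A W := fun {A} =>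
    funext fun q => mlieBracket_smul_right_apply hh hW q
  -- The Jacobi identity for X, Y, hW, reduced by h times the one for X, Y, W, leaves ([X,Y](h) -
  -- X(Y(h)) + Y(X(h))) W = 0 at `p`.
  have J := mlieBracket_jacobi hX hY (hW.smul hh) p
  have J0 := mlieBracket_jacobi hX hY hW p
  rw [e1, e1, e1,
    mlieBracket_add_right_apply (hW.smul (hY.dirDeriv hh)) ((hY.mlieBracket hW).smul hh),
    mlieBracket_add_right_apply (hW.smul (hX.dirDeriv hh)) ((hX.mlieBracket hW).smul hh),
    mlieBracket_smul_right_apply (hY.dirDeriv hh) hW,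
    mlieBracket_smul_right_apply (hX.dirDeriv hh) hW,
    mlieBracket_smul_right_apply hh (hY.mlieBracket hW),
    mlieBracket_smul_right_apply hh (hX.mlieBracket hW), J0] at J
  simp only [Pi.add_apply, Pi.smul_apply'] at J
  have J1 : (dirDeriv (VectorField.mlieBracket I X Y) h p
      - (dirDeriv X (dirDeriv Y h) p - dirDeriv Y (dirDeriv X h) p)) • W p = 0 := by
    rw [← sub_eq_zero] at J
    rw [← neg_eq_zero, ← J]
    module
  exact sub_eq_zero.1 ((smul_eq_zero.1 J1).resolve_right hw)

/-- Brackets of related vector fields are related. -/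
theorem HasLocalFrames.mfderiv_mlieBracket {E' : Type*} [NormedAddCommGroup E'] [NormedSpace ℝ E']
    {H' : Type*} [TopologicalSpace H'] {I' : ModelWithCorners ℝ E' H'} {N : Type*}
    [TopologicalSpace N] [ChartedSpace H' N] [IsManifold I' ∞ N] [CompleteSpace E]
    [CompleteSpace E'] (hM : HasLocalFrames I M) (hN : HasLocalFrames I' N) {φ : M → N}
    (hφ : ContMDiff I I' ∞ φ) {X Y : VecField I M} {X' Y' : VecField I' N}
    (hX : IsSmoothField X) (hY : IsSmoothField Y) (hX' : IsSmoothField X') (hY' : IsSmoothField Y')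
    (hXX' : ∀ q, mfderiv I I' φ q (X q) = X' (φ q)) (hYY' : ∀ q, mfderiv I I' φ q (Y q) = Y' (φ q))
    (p : M) :
    mfderiv I I' φ p (VectorField.mlieBracket I X Y p) = VectorField.mlieBracket I' X' Y' (φ p) := by
  have hcomp : ∀ {A : VecField I M} {h : N → ℝ}, IsSmoothFun (I := I') h → ∀ q,
      dirDeriv A (h ∘ φ) q = mvfderiv I' h (φ q) (mfderiv I I' φ q (A q)) := by
    intro A h hh q
    have h1 := mfderiv_comp q (hh.mdifferentiableAt (φ q))
      ((hφ q).mdifferentiableAt (by simp))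
    exact congrArg (fun L => L (A q)) h1
  have hsm : ∀ {h : N → ℝ}, IsSmoothFun (I := I') h → IsSmoothFun (I := I) (h ∘ φ) :=
    fun hh => hh.contMDiff.comp hφ
  -- Vectors of N are compared on functions h. Composition with φ intertwines X' with X and Y' with
  -- Y, so the commutator formula on M becomes the one on N.
  refine hN.eq_of_mvfderiv fun h hh => ?_
  have hXh : dirDeriv X (h ∘ φ) = dirDeriv X' h ∘ φ := funext fun q => by
    rw [hcomp hh, hXX']; rfl
  have hYh : dirDeriv Y (h ∘ φ) = dirDeriv Y' h ∘ φ := funext fun q => by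
    rw [hcomp hh, hYY']; rfl
  rw [← hcomp hh, hM.dirDeriv_mlieBracket hX hY (hsm hh), hXh, hYh, hcomp (hY'.dirDeriv hh),
    hcomp (hX'.dirDeriv hh), hXX', hYY', ← dirDeriv_eq_mvfderiv, ← dirDeriv_eq_mvfderiv,
    ← dirDeriv_eq_mvfderiv, hN.dirDeriv_mlieBracket hX' hY' hh]

end Frames

section Koszul

variable {E : Type*} [NormedAddCommGroup E] [NormedSpace ℝ E] {H : Type*} [TopologicalSpace H]
  {I : ModelWithCorners ℝ E H} {M : Type*} [TopologicalSpace M] [ChartedSpace H M]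
  {g : BilinField I M} {X X' Y Y' Z Z' : VecField I M} {φ : M → ℝ} {p : M}

/-! ### Algebra of the Koszul form -/

theorem pairing_add_left : pairing g (X + X') Y = fun q => pairing g X Y q + pairing g X' Y q := by
  funext q; simp [pairing]

theorem pairing_add_right : pairing g X (Y + Y') = fun q => pairing g X Y q + pairing g X Y' q := by
  funext q; simp [pairing]

theorem pairing_smul_left : pairing g (φ • X) Y = fun q => φ q * pairing g X Y q := by
  funext q; simp [pairing]

theorem pairing_smul_right : pairing g X (φ • Y) = fun q => φ q * pairing g X Y q := by
  funext q; simp [pairing]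

theorem koszul_congr (hX : X =ᶠ[𝓝 p] X') (hY : Y =ᶠ[𝓝 p] Y') (hZ : Z =ᶠ[𝓝 p] Z') :
    koszul g X Y Z p = koszul g X' Y' Z' p := by
  have hp : ∀ {A A' C C' : VecField I M}, A =ᶠ[𝓝 p] A' → C =ᶠ[𝓝 p] C' →
      pairing g A C =ᶠ[𝓝 p] pairing g A' C' := by
    intro A A' C C' hA hC
    filter_upwards [hA, hC] with q h1 h2
    simp [pairing, h1, h2]
  simp only [koszul]
  rw [dirDeriv_congr hX.self_of_nhds (hp hY hZ), dirDeriv_congr hY.self_of_nhds (hp hZ hX),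
    dirDeriv_congr hZ.self_of_nhds (hp hX hY), hX.self_of_nhds, hY.self_of_nhds, hZ.self_of_nhds,
    hX.mlieBracket_vectorField_eq hY, hY.mlieBracket_vectorField_eq hZ,
    hZ.mlieBracket_vectorField_eq hX]

variable [IsManifold I ∞ M]

namespace IsSingularMetric

theorem pairing_comm (hg : IsSingularMetric g) : pairing g X Y = pairing g Y X :=
  funext fun q => hg.symm q _ _

/-- Compatibility of the Koszul form with the metric. -/
theorem koszul_add_koszul_swap_right (hg : IsSingularMetric g) (p : M) :
    koszul g X Y Z p + koszul g X Z Y p = dirDeriv X (pairing g Y Z) p := by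
  simp only [koszul]
  rw [hg.pairing_comm (X := Z) (Y := Y), hg.pairing_comm (X := Z) (Y := X),
    hg.pairing_comm (X := Y) (Y := X), VectorField.mlieBracket_swap_apply (V := Z) (W := Y),
    VectorField.mlieBracket_swap_apply (V := Z) (W := X),
    VectorField.mlieBracket_swap_apply (V := Y) (W := X)]
  simp only [map_neg]
  ring

/-- Symmetry of the Koszul form in its first two arguments, up to a bracket. -/
theorem koszul_sub_koszul_swap_left (hg : IsSingularMetric g) (p : M) :
    koszul g X Y Z p - koszul g Y X Z p = g p (VectorField.mlieBracket I X Y p) (Z p) := by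
  simp only [koszul]
  rw [hg.pairing_comm (X := Z) (Y := Y), hg.pairing_comm (X := Z) (Y := X),
    hg.pairing_comm (X := Y) (Y := X), VectorField.mlieBracket_swap_apply (V := Z) (W := Y),
    VectorField.mlieBracket_swap_apply (V := Z) (W := X),
    VectorField.mlieBracket_swap_apply (V := Y) (W := X), hg.symm p (Z p)]
  simp only [map_neg]
  rw [hg.symm p (Z p)]
  ring

theorem mdifferentiableAt_pairing (hg : IsSingularMetric g) (hX : IsSmoothField X)
    (hY : IsSmoothField Y) (p : M) : MDifferentiableAt I 𝓘(ℝ, ℝ) (pairing g X Y) p :=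
  (hg.smooth X Y hX hY).mdifferentiableAt p

variable [CompleteSpace E]

theorem isSmoothFun_koszul (hg : IsSingularMetric g) (hX : IsSmoothField X) (hY : IsSmoothField Y)
    (hZ : IsSmoothField Z) : IsSmoothFun (I := I) (koszul g X Y Z) := by
  have hb := fun {A C D : VecField I M} (hA : IsSmoothField A) (hC : IsSmoothField C)
    (hD : IsSmoothField D) => hg.smooth A _ hA (hC.mlieBracket hD)
  have hd := fun {A C D : VecField I M} (hA : IsSmoothField A) (hC : IsSmoothField C)
    (hD : IsSmoothField D) => hA.dirDeriv (hg.smooth C D hC hD)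
  exact (IsSmoothFun.const _).mul ((((((hd hX hY hZ).add (hd hY hZ hX)).sub (hd hZ hX hY)).sub
    (hb hX hY hZ)).add (hb hY hZ hX)).add (hb hZ hX hY))

theorem koszul_add_left (hg : IsSingularMetric g) (hX : IsSmoothField X) (hX' : IsSmoothField X')
    (hY : IsSmoothField Y) (hZ : IsSmoothField Z) (p : M) :
    koszul g (X + X') Y Z p = koszul g X Y Z p + koszul g X' Y Z p := by
  simp only [koszul]
  rw [pairing_add_left, pairing_add_right, dirDeriv_field_add,
    dirDeriv_add (hg.mdifferentiableAt_pairing hZ hX p) (hg.mdifferentiableAt_pairing hZ hX' p),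
    dirDeriv_add (hg.mdifferentiableAt_pairing hX hY p) (hg.mdifferentiableAt_pairing hX' hY p),
    mlieBracket_add_left_apply hX hX', mlieBracket_add_right_apply hX hX']
  simp only [Pi.add_apply, map_add, add_apply]
  ring

theorem koszul_smul_left (hg : IsSingularMetric g) (hφ : IsSmoothFun (I := I) φ)
    (hX : IsSmoothField X) (hY : IsSmoothField Y) (hZ : IsSmoothField Z) (p : M) :
    koszul g (φ • X) Y Z p = φ p * koszul g X Y Z p := by
  simp only [koszul]
  rw [pairing_smul_left, pairing_smul_right, dirDeriv_field_smul,
    dirDeriv_mul (hφ.mdifferentiableAt p) (hg.mdifferentiableAt_pairing hZ hX p),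
    dirDeriv_mul (hφ.mdifferentiableAt p) (hg.mdifferentiableAt_pairing hX hY p),
    mlieBracket_smul_left_apply hφ hX, mlieBracket_smul_right_apply hφ hX]
  simp only [Pi.smul_apply', map_smul, map_add, map_neg, smul_apply, smul_eq_mul]
  rw [show pairing g Z X p = g p (Z p) (X p) from rfl,
    show pairing g X Y p = g p (X p) (Y p) from rfl, hg.symm p (X p) (Y p)]
  ring

theorem koszul_add_right (hg : IsSingularMetric g) (hX : IsSmoothField X) (hY : IsSmoothField Y)
    (hZ : IsSmoothField Z) (hZ' : IsSmoothField Z') (p : M) :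
    koszul g X Y (Z + Z') p = koszul g X Y Z p + koszul g X Y Z' p := by
  simp only [koszul]
  rw [pairing_add_left, pairing_add_right, dirDeriv_field_add,
    dirDeriv_add (hg.mdifferentiableAt_pairing hZ hX p) (hg.mdifferentiableAt_pairing hZ' hX p),
    dirDeriv_add (hg.mdifferentiableAt_pairing hY hZ p) (hg.mdifferentiableAt_pairing hY hZ' p),
    mlieBracket_add_left_apply hZ hZ', mlieBracket_add_right_apply hZ hZ']
  simp only [Pi.add_apply, map_add, add_apply]
  ring

theorem koszul_smul_right (hg : IsSingularMetric g) (hφ : IsSmoothFun (I := I) φ)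
    (hX : IsSmoothField X) (hY : IsSmoothField Y) (hZ : IsSmoothField Z) (p : M) :
    koszul g X Y (φ • Z) p = φ p * koszul g X Y Z p := by
  simp only [koszul]
  rw [pairing_smul_left, pairing_smul_right, dirDeriv_field_smul,
    dirDeriv_mul (hφ.mdifferentiableAt p) (hg.mdifferentiableAt_pairing hZ hX p),
    dirDeriv_mul (hφ.mdifferentiableAt p) (hg.mdifferentiableAt_pairing hY hZ p),
    mlieBracket_smul_left_apply hφ hZ, mlieBracket_smul_right_apply hφ hZ]
  simp only [Pi.smul_apply', map_smul, map_add, map_neg, smul_apply, smul_eq_mul]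
  rw [show pairing g Z X p = g p (Z p) (X p) from rfl,
    show pairing g Y Z p = g p (Y p) (Z p) from rfl, hg.symm p (Z p) (X p)]
  ring

/-- Metric compatibility trades the middle slot for the last one, where linearity is already known.
-/
theorem koszul_add_mid (hg : IsSingularMetric g) (hX : IsSmoothField X) (hY : IsSmoothField Y)
    (hY' : IsSmoothField Y') (hZ : IsSmoothField Z) (p : M) :
    koszul g X (Y + Y') Z p = koszul g X Y Z p + koszul g X Y' Z p := by
  have h0 := hg.koszul_add_koszul_swap_right (X := X) (Y := Y + Y') (Z := Z) p
  have h1 := hg.koszul_add_koszul_swap_right (X := X) (Y := Y) (Z := Z) p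
  have h2 := hg.koszul_add_koszul_swap_right (X := X) (Y := Y') (Z := Z) p
  rw [pairing_add_left, dirDeriv_add (hg.mdifferentiableAt_pairing hY hZ p)
    (hg.mdifferentiableAt_pairing hY' hZ p), hg.koszul_add_right hX hZ hY hY'] at h0
  linarith

/-- The extra term is the Leibniz term of X⟨φY, Z⟩ in the compatibility relation; the last slot
contributes none. -/
theorem koszul_smul_mid (hg : IsSingularMetric g) (hφ : IsSmoothFun (I := I) φ)
    (hX : IsSmoothField X) (hY : IsSmoothField Y) (hZ : IsSmoothField Z) (p : M) :
    koszul g X (φ • Y) Z p = φ p * koszul g X Y Z p + dirDeriv X φ p * pairing g Y Z p := by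
  have h0 := hg.koszul_add_koszul_swap_right (X := X) (Y := φ • Y) (Z := Z) p
  have h1 := hg.koszul_add_koszul_swap_right (X := X) (Y := Y) (Z := Z) p
  rw [pairing_smul_left, dirDeriv_mul (hφ.mdifferentiableAt p)
    (hg.mdifferentiableAt_pairing hY hZ p), hg.koszul_smul_right hφ hX hZ hY] at h0
  linear_combination h0 - φ p * h1

end IsSingularMetric

end Koszul

/-! ### The inner product of annihilator forms -/

section AnnihInner

variable {E : Type*} [NormedAddCommGroup E] [NormedSpace ℝ E] {H : Type*} [TopologicalSpace H]
  {I : ModelWithCorners ℝ E H} {M : Type*} [TopologicalSpace M] [ChartedSpace H M]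
  [IsManifold I ∞ M] {g : BilinField I M} {α τ : Form I M} {p : M}

/-- Two representatives of one covector have the same pairing with every vector. -/
theorem RepresentsAt.apply_eq (hM : HasLocalFrames I M) {v v' : TangentSpace I p}
    (hv : RepresentsAt g α p v) (hv' : RepresentsAt g α p v') (w : TangentSpace I p) :
    g p v w = g p v' w := by
  obtain ⟨W, hW, rfl⟩ := hM.exists_field p w
  rw [← hv W hW, ← hv' W hW]

/-- The chosen representatives may be exchanged for any others, one slot at a time, because
representatives of one covector pair equally with every vector. -/
theorem annihInner_eq (hM : HasLocalFrames I M) (hg : IsSingularMetric g) {v w : TangentSpace I p}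
    (hv : RepresentsAt g α p v) (hw : RepresentsAt g τ p w) : annihInner g α τ p = g p v w := by
  have h : (∃ v : TangentSpace I p, RepresentsAt g α p v) ∧
      ∃ w : TangentSpace I p, RepresentsAt g τ p w := ⟨⟨v, hv⟩, ⟨w, hw⟩⟩
  rw [annihInner, dif_pos h, h.1.choose_spec.apply_eq hM hv, hg.symm,
    h.2.choose_spec.apply_eq hM hw, hg.symm]

end AnnihInner

section Region

variable {E : Type*} [NormedAddCommGroup E] [NormedSpace ℝ E] {H : Type*} [TopologicalSpace H]
  {I : ModelWithCorners ℝ E H} {M : Type*} [TopologicalSpace M] [ChartedSpace H M]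

/-! ### Density of the regions of constant signature -/

instance finiteDimensional_tangentSpace [FiniteDimensional ℝ E] (p : M) :
    FiniteDimensional ℝ (TangentSpace I p) := inferInstanceAs (FiniteDimensional ℝ E)

variable [IsManifold I ∞ M] {g : BilinField I M}

/-- The expression `X(α(Y)) - ⟨⟨∇^♭_X Y, α⟩⟩_•`, evaluated pointwise at all points. -/
def pointwiseCovDeriv (g : BilinField I M) (X : VecField I M) (α : Form I M) : Form I M :=
  fun Y q => dirDeriv X (α Y) q - annihInner g (lowerDeriv g X Y) α q

theorem covDeriv_eq_pointwiseCovDeriv {X Y : VecField I M} {α : Form I M} {p : M}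
    (hp : p ∈ constSignatureRegion g) :
    covDeriv g X α Y p = pointwiseCovDeriv g X α Y p := by
  rw [covDeriv, if_pos hp, pointwiseCovDeriv]

variable [FiniteDimensional ℝ E]

theorem exists_linearIndependent_apply {V W : Type*} [AddCommGroup V] [Module ℝ V]
    [FiniteDimensional ℝ V] [AddCommGroup W] [Module ℝ W] (A : V →ₗ[ℝ] W) :
    ∃ v : Fin (Module.finrank ℝ (LinearMap.range A)) → V, LinearIndependent ℝ (fun i => A (v i)) := by
  let b := Module.finBasis ℝ (LinearMap.range A)
  choose v hv using fun i => (b i).2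
  refine ⟨v, ?_⟩
  simp only [hv]
  exact b.linearIndependent.map' (LinearMap.range A).subtype (Submodule.ker_subtype _)

theorem le_finrank_range_of_linearIndependent {V W : Type*} [AddCommGroup V] [Module ℝ V]
    [FiniteDimensional ℝ V] [AddCommGroup W] [Module ℝ W] (A : V →ₗ[ℝ] W) {r : ℕ} {v : Fin r → V}
    (h : LinearIndependent ℝ (fun i => A (v i))) : r ≤ Module.finrank ℝ (LinearMap.range A) := by
  have h2 : LinearIndependent ℝ (fun i => (⟨A (v i), v i, rfl⟩ : LinearMap.range A)) :=
    LinearIndependent.of_comp (LinearMap.range A).subtype h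
  simpa using h2.fintype_card_le_finrank

/-- The rank of a singular metric is lower semicontinuous. -/
theorem eventually_finrank_range_le (hM : HasLocalFrames I M) (hg : IsSingularMetric g) (p : M) :
    ∀ᶠ q in 𝓝 p, Module.finrank ℝ (LinearMap.range (g p).toLinearMap)
      ≤ Module.finrank ℝ (LinearMap.range (g q).toLinearMap) := by
  let G : M → E →L[ℝ] E →L[ℝ] ℝ := fun q => g q
  change ∀ᶠ q in 𝓝 p, Module.finrank ℝ (LinearMap.range (G p).toLinearMap)
      ≤ Module.finrank ℝ (LinearMap.range (G q).toLinearMap)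
  obtain ⟨v, hv⟩ := exists_linearIndependent_apply (G p).toLinearMap
  choose V hVs hV using fun i => hM.exists_field p (v i)
  obtain ⟨ι, _, e, x, he, hx, hs⟩ := hM p
  -- Evaluation on a frame carries covectors at varying points into one fixed space, where linear
  -- independence is an open condition. At `p` it is injective because the frame spans.
  let ev : M → ((E →L[ℝ] ℝ) →ₗ[ℝ] (ι → ℝ)) := fun q =>
    LinearMap.pi fun a =>
      { toFun := fun L => L (e a q), map_add' := fun _ _ => rfl, map_smul' := fun _ _ => rfl }
  let w : ∀ q : M, Fin (Module.finrank ℝ (LinearMap.range (G p).toLinearMap)) → (E →L[ℝ] ℝ) :=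
    fun q i => g q (V i q)
  have hlin : LinearIndependent ℝ (fun i => ev p (w p i)) := by
    have h1 : LinearIndependent ℝ (w p) := by
      have : w p = fun i => (G p).toLinearMap (v i) := funext fun i => congrArg (g p) (hV i)
      rw [this]
      exact hv
    refine h1.map' (ev p) (LinearMap.ker_eq_bot'.2 fun L hL => ?_)
    refine ContinuousLinearMap.ext fun u => ?_
    obtain ⟨c, e', h2, h3⟩ : ∃ (c : ι → ℝ) (e' : ι → E), ∑ a, c a • e' a = u ∧ ∀ a, L (e' a) = 0 :=
      ⟨fun a => mvfderiv I (x a) p u, fun a => e a p, hs.self_of_nhds u, congrFun hL⟩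
    simp [← h2, map_sum, h3]
  have hcont : Continuous (fun q => fun i => ev q (w q i)) :=
    continuous_pi fun i => continuous_pi fun a =>
      (hg.smooth (V i) (e a) (hVs i) (he a)).continuous
  have hopen : IsOpen {f : Fin (Module.finrank ℝ (LinearMap.range (G p).toLinearMap)) → ι → ℝ |
    LinearIndependent ℝ f} := isOpen_setOfPred_linearIndependent
  filter_upwards [(hopen.preimage hcont).mem_nhds hlin] with q hq
  have h1 : LinearIndependent ℝ (w q) := LinearIndependent.of_comp (ev q) hq
  exact le_finrank_range_of_linearIndependent (G q).toLinearMap h1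

/-- The rank is an integer bounded by dim E, so it attains a maximum on every nonempty open set; by
lower semicontinuity it is constant near a point where the maximum is attained. -/
theorem dense_constSignatureRegion (hM : HasLocalFrames I M) (hg : IsSingularMetric g) :
    Dense (constSignatureRegion g) := by
  rw [dense_iff_inter_open]
  intro U hU hne
  let r : M → ℕ := fun q => Module.finrank ℝ (LinearMap.range (g q).toLinearMap)
  have hb : BddAbove (r '' U) := by
    refine ⟨Module.finrank ℝ E, ?_⟩
    rintro _ ⟨q, -, rfl⟩
    exact LinearMap.finrank_range_le (g q).toLinearMap
  obtain ⟨q, hq, hqm⟩ := Nat.sSup_mem (hne.image r) hb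
  refine ⟨q, hq, ?_⟩
  filter_upwards [eventually_finrank_range_le hM hg q, hU.mem_nhds hq] with q' h1 h2
  exact le_antisymm ((le_csSup hb (mem_image_of_mem r h2)).trans hqm.ge) h1

/-! ### The covariant derivative on the regions of constant signature -/

/-- This is how covariant derivatives are computed at singular points: a function continuous at `p`
that matches the pointwise formula on the regions of constant signature must be the limit, since
these regions accumulate at `p`. -/
theorem covDeriv_eq_of_continuousAt (hM : HasLocalFrames I M) (hg : IsSingularMetric g)
    {X Y : VecField I M} {α : Form I M} {C : M → ℝ} {p : M} (hC : ContinuousAt C p)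
    (h : ∀ᶠ q in 𝓝 p, q ∈ constSignatureRegion g → pointwiseCovDeriv g X α Y q = C q) :
    covDeriv g X α Y p = C p := by
  by_cases hp : p ∈ constSignatureRegion g
  · rw [covDeriv, if_pos hp]
    exact h.self_of_nhds hp
  · rw [covDeriv, if_neg hp]
    have : (𝓝[constSignatureRegion g] p).NeBot :=
      mem_closure_iff_nhdsWithin_neBot.1 (dense_constSignatureRegion hM hg p)
    refine Tendsto.limUnder_eq ((hC.mono_left nhdsWithin_le_nhds).congr' ?_)
    filter_upwards [nhdsWithin_le_nhds h, self_mem_nhdsWithin] with q hq hq'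
    exact (hq hq').symm

theorem covDeriv_eventuallyEq (hM : HasLocalFrames I M) (hg : IsSingularMetric g)
    {X Y : VecField I M} {α : Form I M} {C : M → ℝ} {p : M} (hC : Continuous C)
    (h : ∀ᶠ q in 𝓝 p, q ∈ constSignatureRegion g → pointwiseCovDeriv g X α Y q = C q) :
    covDeriv g X α Y =ᶠ[𝓝 p] C :=
  h.eventually_nhds.mono fun _ hq => covDeriv_eq_of_continuousAt hM hg hC.continuousAt hq

end Region

section Tensoriality

variable {E : Type*} [NormedAddCommGroup E] [NormedSpace ℝ E] {H : Type*} [TopologicalSpace H]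
  {I : ModelWithCorners ℝ E H} {M : Type*} [TopologicalSpace M] [ChartedSpace H M]
  [IsManifold I ∞ M] {g : BilinField I M} {X X' Y Y' Z Z' T T' : VecField I M} {φ : M → ℝ}
  {p : M} {v v' : TangentSpace I p}

/-! ### Tensoriality of the lower covariant derivative -/

theorem representsAt_congr {α α' : Form I M}
    (h : ∀ Z, IsSmoothField Z → α Z p = α' Z p) (hv : RepresentsAt g α p v) :
    RepresentsAt g α' p v := fun Z hZ => (h Z hZ).symm.trans (hv Z hZ)

theorem representsAt_lowerDeriv_congr (hX : X =ᶠ[𝓝 p] X') (hY : Y =ᶠ[𝓝 p] Y')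
    (hv : RepresentsAt g (lowerDeriv g X Y) p v) : RepresentsAt g (lowerDeriv g X' Y') p v :=
  representsAt_congr (fun _ _ => koszul_congr hX hY .rfl) hv

/-- The representatives in `annihInner` are picked by choice, so the predicates themselves are shown
to be equal; the choices then coincide, without any assumption on the metric. -/
theorem annihInner_congr {α α' τ τ' : Form I M} (hα : ∀ Z, IsSmoothField Z → α Z p = α' Z p)
    (hτ : ∀ Z, IsSmoothField Z → τ Z p = τ' Z p) : annihInner g α τ p = annihInner g α' τ' p := by
  have h1 : ∀ v, RepresentsAt g α p v = RepresentsAt g α' p v := fun v =>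
    propext ⟨representsAt_congr hα, representsAt_congr fun Z hZ => (hα Z hZ).symm⟩
  have h2 : ∀ v, RepresentsAt g τ p v = RepresentsAt g τ' p v := fun v =>
    propext ⟨representsAt_congr hτ, representsAt_congr fun Z hZ => (hτ Z hZ).symm⟩
  have h3 : RepresentsAt g α p = RepresentsAt g α' p := funext h1
  have h4 : RepresentsAt g τ p = RepresentsAt g τ' p := funext h2
  simp only [annihInner]
  rw! [h3, h4]
  rfl

theorem pointwiseCovDeriv_congr (hZ : Z =ᶠ[𝓝 p] Z') (hX : X =ᶠ[𝓝 p] X') (hY : Y =ᶠ[𝓝 p] Y')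
    (hT : T =ᶠ[𝓝 p] T') :
    pointwiseCovDeriv g Z (lowerDeriv g X Y) T p
      = pointwiseCovDeriv g Z' (lowerDeriv g X' Y') T' p := by
  have h1 : lowerDeriv g X Y T =ᶠ[𝓝 p] lowerDeriv g X' Y' T' := by
    filter_upwards [hX.eventuallyEq_nhds, hY.eventuallyEq_nhds, hT.eventuallyEq_nhds]
      with q h1 h2 h3 using koszul_congr h1 h2 h3
  rw [pointwiseCovDeriv, pointwiseCovDeriv, dirDeriv_congr hZ.self_of_nhds h1,
    annihInner_congr (α := lowerDeriv g Z T) (α' := lowerDeriv g Z' T') (τ := lowerDeriv g X Y)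
      (τ' := lowerDeriv g X' Y') (fun _ _ => koszul_congr hZ hT .rfl)
      (fun _ _ => koszul_congr hX hY .rfl)]

theorem IsAnnihForm.add_apply {α : Form I M} (hα : IsAnnihForm g α) (hT : IsSmoothField T)
    (hT' : IsSmoothField T') (p : M) : α (T + T') p = α T p + α T' p := by
  obtain ⟨w, hw⟩ := hα.2 p
  rw [hw T hT, hw T' hT', hw _ (hT.add hT'), Pi.add_apply, map_add]

theorem IsAnnihForm.smul_apply {α : Form I M} (hα : IsAnnihForm g α) (hφ : IsSmoothFun (I := I) φ)
    (hT : IsSmoothField T) (p : M) : α (φ • T) p = φ p * α T p := by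
  obtain ⟨w, hw⟩ := hα.2 p
  rw [hw T hT, hw _ (hT.smul hφ), Pi.smul_apply', map_smul, smul_eq_mul]

theorem IsAnnihForm.congr_apply {α : Form I M} (hα : IsAnnihForm g α) (hT : IsSmoothField T)
    (hT' : IsSmoothField T') {p : M} (h : T p = T' p) : α T p = α T' p := by
  obtain ⟨w, hw⟩ := hα.2 p
  rw [hw T hT, hw T' hT', h]

variable [CompleteSpace E]

namespace IsSingularMetric

theorem isSmoothFun_lowerDeriv (hg : IsSingularMetric g) (hX : IsSmoothField X)
    (hY : IsSmoothField Y) (hZ : IsSmoothField Z) : IsSmoothFun (I := I) (lowerDeriv g X Y Z) :=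
  hg.isSmoothFun_koszul hX hY hZ

theorem representsAt_add_left (hg : IsSingularMetric g) (hX : IsSmoothField X)
    (hX' : IsSmoothField X') (hY : IsSmoothField Y) (hv : RepresentsAt g (lowerDeriv g X Y) p v)
    (hv' : RepresentsAt g (lowerDeriv g X' Y) p v') :
    RepresentsAt g (lowerDeriv g (X + X') Y) p (v + v') := fun Z hZ => by
  rw [lowerDeriv, hg.koszul_add_left hX hX' hY hZ, map_add, add_apply,
    ← hv Z hZ, ← hv' Z hZ, lowerDeriv, lowerDeriv]

theorem representsAt_add_right (hg : IsSingularMetric g) (hX : IsSmoothField X)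
    (hY : IsSmoothField Y) (hY' : IsSmoothField Y') (hv : RepresentsAt g (lowerDeriv g X Y) p v)
    (hv' : RepresentsAt g (lowerDeriv g X Y') p v') :
    RepresentsAt g (lowerDeriv g X (Y + Y')) p (v + v') := fun Z hZ => by
  rw [lowerDeriv, hg.koszul_add_mid hX hY hY' hZ, map_add, add_apply,
    ← hv Z hZ, ← hv' Z hZ, lowerDeriv, lowerDeriv]

theorem representsAt_smul_left (hg : IsSingularMetric g) (hφ : IsSmoothFun (I := I) φ)
    (hX : IsSmoothField X) (hY : IsSmoothField Y) (hv : RepresentsAt g (lowerDeriv g X Y) p v) :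
    RepresentsAt g (lowerDeriv g (φ • X) Y) p (φ p • v) := fun Z hZ => by
  rw [lowerDeriv, hg.koszul_smul_left hφ hX hY hZ, map_smul, smul_apply, ← hv Z hZ, lowerDeriv,
    smul_eq_mul]

theorem representsAt_smul_right (hg : IsSingularMetric g) (hφ : IsSmoothFun (I := I) φ)
    (hX : IsSmoothField X) (hY : IsSmoothField Y) (hv : RepresentsAt g (lowerDeriv g X Y) p v) :
    RepresentsAt g (lowerDeriv g X (φ • Y)) p (φ p • v + dirDeriv X φ p • Y p) := fun Z hZ => by
  rw [lowerDeriv, hg.koszul_smul_mid hφ hX hY hZ, map_add, map_smul, map_smul, add_apply,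
    smul_apply, smul_apply, ← hv Z hZ, lowerDeriv, smul_eq_mul, smul_eq_mul, pairing]

end IsSingularMetric

/-- All the covectors `(∇^♭_X Y)_p` are of the form `v^♭`. -/
def IsRadicalStationary (g : BilinField I M) : Prop :=
  ∀ X Y : VecField I M, IsSmoothField X → IsSmoothField Y → ∀ p,
    ∃ v : TangentSpace I p, RepresentsAt g (lowerDeriv g X Y) p v

theorem IsRadicalStationary.isAnnihForm (hr : IsRadicalStationary g) (hg : IsSingularMetric g)
    (hX : IsSmoothField X) (hY : IsSmoothField Y) : IsAnnihForm g (lowerDeriv g X Y) :=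
  ⟨fun _ hZ => hg.isSmoothFun_lowerDeriv hX hY hZ, hr X Y hX hY⟩

/-! ### Leibniz rules for the pointwise covariant derivative, in each slot. -/

section Pointwise

variable (hM : HasLocalFrames I M) (hg : IsSingularMetric g) (hr : IsRadicalStationary g)
include hM hg hr

theorem pointwiseCovDeriv_add_dir {α : Form I M} (hα : IsAnnihForm g α) (hZ : IsSmoothField Z)
    (hZ' : IsSmoothField Z') (hT : IsSmoothField T) (p : M) :
    pointwiseCovDeriv g (Z + Z') α T p
      = pointwiseCovDeriv g Z α T p + pointwiseCovDeriv g Z' α T p := by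
  obtain ⟨w, hw⟩ := hα.2 p
  obtain ⟨v, hv⟩ := hr Z T hZ hT p
  obtain ⟨v', hv'⟩ := hr Z' T hZ' hT p
  simp only [pointwiseCovDeriv]
  rw [annihInner_eq hM hg hv hw, annihInner_eq hM hg hv' hw,
    annihInner_eq hM hg (hg.representsAt_add_left hZ hZ' hT hv hv') hw, dirDeriv_field_add,
    map_add, add_apply]
  ring

theorem pointwiseCovDeriv_smul_dir {α : Form I M} (hα : IsAnnihForm g α)
    (hφ : IsSmoothFun (I := I) φ) (hZ : IsSmoothField Z) (hT : IsSmoothField T) (p : M) :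
    pointwiseCovDeriv g (φ • Z) α T p = φ p * pointwiseCovDeriv g Z α T p := by
  obtain ⟨w, hw⟩ := hα.2 p
  obtain ⟨v, hv⟩ := hr Z T hZ hT p
  simp only [pointwiseCovDeriv]
  rw [annihInner_eq hM hg hv hw,
    annihInner_eq hM hg (hg.representsAt_smul_left hφ hZ hT hv) hw, dirDeriv_field_smul,
    map_smul, smul_apply, smul_eq_mul]
  ring

theorem pointwiseCovDeriv_add_arg {α : Form I M} (hα : IsAnnihForm g α) (hZ : IsSmoothField Z)
    (hT : IsSmoothField T) (hT' : IsSmoothField T') (p : M) :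
    pointwiseCovDeriv g Z α (T + T') p
      = pointwiseCovDeriv g Z α T p + pointwiseCovDeriv g Z α T' p := by
  obtain ⟨w, hw⟩ := hα.2 p
  obtain ⟨v, hv⟩ := hr Z T hZ hT p
  obtain ⟨v', hv'⟩ := hr Z T' hZ hT' p
  have h1 : α (T + T') = fun q => α T q + α T' q := funext fun q => hα.add_apply hT hT' q
  simp only [pointwiseCovDeriv]
  rw [annihInner_eq hM hg hv hw, annihInner_eq hM hg hv' hw,
    annihInner_eq hM hg (hg.representsAt_add_right hZ hT hT' hv hv') hw, h1,
    dirDeriv_add ((hα.1 T hT).mdifferentiableAt p)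
      ((hα.1 T' hT').mdifferentiableAt p), map_add, add_apply]
  ring

/-- The derivative of φ enters twice, as Z(φ) α(T) from the Leibniz rule and as the pairing of Z(φ)
T with a representative of α. These are equal and cancel. -/
theorem pointwiseCovDeriv_smul_arg {α : Form I M} (hα : IsAnnihForm g α)
    (hφ : IsSmoothFun (I := I) φ) (hZ : IsSmoothField Z) (hT : IsSmoothField T) (p : M) :
    pointwiseCovDeriv g Z α (φ • T) p = φ p * pointwiseCovDeriv g Z α T p := by
  obtain ⟨w, hw⟩ := hα.2 p
  obtain ⟨v, hv⟩ := hr Z T hZ hT p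
  have h1 : α (φ • T) = fun q => φ q * α T q := funext fun q => hα.smul_apply hφ hT q
  simp only [pointwiseCovDeriv]
  rw [annihInner_eq hM hg hv hw,
    annihInner_eq hM hg (hg.representsAt_smul_right hφ hZ hT hv) hw, h1,
    dirDeriv_mul (hφ.mdifferentiableAt p) ((hα.1 T hT).mdifferentiableAt p),
    map_add, map_smul, map_smul, add_apply, smul_apply, smul_apply, smul_eq_mul, smul_eq_mul,
    hg.symm p (T p) w, ← hw T hT]
  ring

theorem pointwiseCovDeriv_add_left (hZ : IsSmoothField Z) (hX : IsSmoothField X)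
    (hX' : IsSmoothField X') (hY : IsSmoothField Y) (hT : IsSmoothField T) (p : M) :
    pointwiseCovDeriv g Z (lowerDeriv g (X + X') Y) T p
      = pointwiseCovDeriv g Z (lowerDeriv g X Y) T p
        + pointwiseCovDeriv g Z (lowerDeriv g X' Y) T p := by
  obtain ⟨w, hw⟩ := hr X Y hX hY p
  obtain ⟨w', hw'⟩ := hr X' Y hX' hY p
  obtain ⟨v, hv⟩ := hr Z T hZ hT p
  have h1 : lowerDeriv g (X + X') Y T = fun q => lowerDeriv g X Y T q + lowerDeriv g X' Y T q :=
    funext fun q => hg.koszul_add_left hX hX' hY hT q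
  simp only [pointwiseCovDeriv]
  rw [annihInner_eq hM hg hv hw, annihInner_eq hM hg hv hw',
    annihInner_eq hM hg hv (hg.representsAt_add_left hX hX' hY hw hw'), h1,
    dirDeriv_add ((hg.isSmoothFun_lowerDeriv hX hY hT).mdifferentiableAt p)
      ((hg.isSmoothFun_lowerDeriv hX' hY hT).mdifferentiableAt p), map_add]
  ring

theorem pointwiseCovDeriv_smul_left (hφ : IsSmoothFun (I := I) φ) (hZ : IsSmoothField Z)
    (hX : IsSmoothField X) (hY : IsSmoothField Y) (hT : IsSmoothField T) (p : M) :
    pointwiseCovDeriv g Z (lowerDeriv g (φ • X) Y) T p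
      = φ p * pointwiseCovDeriv g Z (lowerDeriv g X Y) T p
        + dirDeriv Z φ p * koszul g X Y T p := by
  obtain ⟨w, hw⟩ := hr X Y hX hY p
  obtain ⟨v, hv⟩ := hr Z T hZ hT p
  have h1 : lowerDeriv g (φ • X) Y T = fun q => φ q * lowerDeriv g X Y T q :=
    funext fun q => hg.koszul_smul_left hφ hX hY hT q
  simp only [pointwiseCovDeriv]
  rw [annihInner_eq hM hg hv hw,
    annihInner_eq hM hg hv (hg.representsAt_smul_left hφ hX hY hw), h1,
    dirDeriv_mul (hφ.mdifferentiableAt p) ((hg.isSmoothFun_lowerDeriv hX hY hT).mdifferentiableAt p),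
    map_smul, smul_eq_mul, lowerDeriv]
  ring

theorem pointwiseCovDeriv_add_mid (hZ : IsSmoothField Z) (hX : IsSmoothField X)
    (hY : IsSmoothField Y) (hY' : IsSmoothField Y') (hT : IsSmoothField T) (p : M) :
    pointwiseCovDeriv g Z (lowerDeriv g X (Y + Y')) T p
      = pointwiseCovDeriv g Z (lowerDeriv g X Y) T p
        + pointwiseCovDeriv g Z (lowerDeriv g X Y') T p := by
  obtain ⟨w, hw⟩ := hr X Y hX hY p
  obtain ⟨w', hw'⟩ := hr X Y' hX hY' p
  obtain ⟨v, hv⟩ := hr Z T hZ hT p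
  have h1 : lowerDeriv g X (Y + Y') T = fun q => lowerDeriv g X Y T q + lowerDeriv g X Y' T q :=
    funext fun q => hg.koszul_add_mid hX hY hY' hT q
  simp only [pointwiseCovDeriv]
  rw [annihInner_eq hM hg hv hw, annihInner_eq hM hg hv hw',
    annihInner_eq hM hg hv (hg.representsAt_add_right hX hY hY' hw hw'), h1,
    dirDeriv_add ((hg.isSmoothFun_lowerDeriv hX hY hT).mdifferentiableAt p)
      ((hg.isSmoothFun_lowerDeriv hX hY' hT).mdifferentiableAt p), map_add]
  ring

/-- The Leibniz rule gives X(φ) Z⟨Y,T⟩, and the inner product takes away X(φ) 𝒦(Z,T,Y); by metric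
compatibility X(φ) 𝒦(Z,Y,T) is left. Thus each correction term, as a form in T, is again a covector
of the form v^♭. -/
theorem pointwiseCovDeriv_smul_mid (hφ : IsSmoothFun (I := I) φ) (hZ : IsSmoothField Z)
    (hX : IsSmoothField X) (hY : IsSmoothField Y) (hT : IsSmoothField T) (p : M) :
    pointwiseCovDeriv g Z (lowerDeriv g X (φ • Y)) T p
      = φ p * pointwiseCovDeriv g Z (lowerDeriv g X Y) T p
        + dirDeriv Z φ p * koszul g X Y T p + dirDeriv Z (dirDeriv X φ) p * pairing g Y T p
        + dirDeriv X φ p * koszul g Z Y T p := by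
  obtain ⟨w, hw⟩ := hr X Y hX hY p
  obtain ⟨v, hv⟩ := hr Z T hZ hT p
  have h1 : lowerDeriv g X (φ • Y) T
      = fun q => φ q * lowerDeriv g X Y T q + dirDeriv X φ q * pairing g Y T q :=
    funext fun q => hg.koszul_smul_mid hφ hX hY hT q
  have h2 := hg.koszul_add_koszul_swap_right (X := Z) (Y := Y) (Z := T) p
  have h3 := hv Y hY
  have hK : IsSmoothFun (I := I) (lowerDeriv g X Y T) := hg.isSmoothFun_lowerDeriv hX hY hT
  have hP := hg.smooth Y T hY hT
  simp only [pointwiseCovDeriv]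
  rw [annihInner_eq hM hg hv hw,
    annihInner_eq hM hg hv (hg.representsAt_smul_right hφ hX hY hw), h1,
    dirDeriv_add ((hφ.mul hK).mdifferentiableAt p)
      (((hX.dirDeriv hφ).mul hP).mdifferentiableAt p),
    dirDeriv_mul (hφ.mdifferentiableAt p) (hK.mdifferentiableAt p),
    dirDeriv_mul ((hX.dirDeriv hφ).mdifferentiableAt p) (hP.mdifferentiableAt p),
    map_add, map_smul, map_smul, smul_eq_mul, smul_eq_mul, ← h3, ← h2]
  simp only [lowerDeriv]
  ring

end Pointwise

end Tensoriality

section Generators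

variable {E : Type*} [NormedAddCommGroup E] [NormedSpace ℝ E] {H : Type*} [TopologicalSpace H]
  {I : ModelWithCorners ℝ E H} {M : Type*} [TopologicalSpace M] [ChartedSpace H M]
  [IsManifold I ∞ M] {g : BilinField I M} {X X' Y Y' Z Z' T T' : VecField I M} {φ : M → ℝ} {p : M}

/-! ### Semi-regularity can be tested on generating vector fields -/

/-- Every smooth vector field is, near every point, a combination of members of `𝓛` with smooth
coefficients. -/
structure LocallyGenerates (𝓛 : Set (VecField I M)) : Prop where
  smooth : ∀ L ∈ 𝓛, IsSmoothField L
  zero_mem : 0 ∈ 𝓛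
  generates : ∀ (p : M) (X : VecField I M), IsSmoothField X →
    ∃ (ι : Type) (_ : Fintype ι) (φ : ι → M → ℝ) (L : ι → VecField I M),
      (∀ i, IsSmoothFun (I := I) (φ i)) ∧ (∀ i, L i ∈ 𝓛) ∧
        (fun q => ∑ i, φ i q • L i q) =ᶠ[𝓝 p] X

/-- A property that is local at `p`, additive and stable under smooth multiples passes from the
generators to all smooth fields. Locality is needed because a field is a combination of generators
only near `p`. -/
theorem LocallyGenerates.induction {𝓛 : Set (VecField I M)} (h𝓛 : LocallyGenerates 𝓛) (p : M)
    {P : VecField I M → Prop}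
    (congr : ∀ X X', IsSmoothField X → IsSmoothField X' → X =ᶠ[𝓝 p] X' → P X → P X')
    (add : ∀ X X', IsSmoothField X → IsSmoothField X' → P X → P X' → P (X + X'))
    (smul : ∀ (φ : M → ℝ) X, IsSmoothFun (I := I) φ → IsSmoothField X → P X → P (φ • X))
    (mem : ∀ L ∈ 𝓛, P L) (X : VecField I M) (hX : IsSmoothField X) : P X := by
  obtain ⟨ι, _, φ, L, hφ, hL, h⟩ := h𝓛.generates p X hX
  have hs : ∀ s : Finset ι, IsSmoothField (fun q => ∑ i ∈ s, φ i q • L i q) := fun s =>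
    IsSmoothField.sum (X := fun i => φ i • L i) fun i _ => (h𝓛.smooth _ (hL i)).smul (hφ i)
  refine congr _ X (hs _) hX h ?_
  classical
  have key : ∀ s : Finset ι, P (fun q => ∑ i ∈ s, φ i q • L i q) := by
    intro s
    induction s using Finset.induction_on with
    | empty =>
      simp only [Finset.sum_empty]
      exact mem 0 h𝓛.zero_mem
    | insert a s ha ih =>
      simp only [Finset.sum_insert ha]
      exact add (φ a • L a) _ ((h𝓛.smooth _ (hL a)).smul (hφ a)) (hs s)
        (smul _ _ (hφ a) (h𝓛.smooth _ (hL a)) (mem _ (hL a))) ih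
  exact key _

variable [FiniteDimensional ℝ E]

omit [FiniteDimensional ℝ E] in
theorem representsAt_lowerDeriv_of_generators [CompleteSpace E] (hg : IsSingularMetric g)
    {𝓛 : Set (VecField I M)} (h𝓛 : LocallyGenerates 𝓛) (hX : IsSmoothField X)
    (hY : IsSmoothField Y) {v : TangentSpace I p}
    (hv : ∀ L ∈ 𝓛, koszul g X Y L p = g p v (L p)) : RepresentsAt g (lowerDeriv g X Y) p v := by
  refine h𝓛.induction p (P := fun Z => lowerDeriv g X Y Z p = g p v (Z p)) ?_ ?_ ?_ hv
  · intro Z Z' _ _ hZZ' hZ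
    rw [← hZZ'.self_of_nhds, ← hZ]
    exact koszul_congr .rfl .rfl hZZ'.symm
  · intro Z Z' hZ hZ' e e'
    rw [lowerDeriv, hg.koszul_add_right hX hY hZ hZ', Pi.add_apply,
      map_add, ← e, ← e', lowerDeriv, lowerDeriv]
  · intro φ Z hφ hZ e
    rw [lowerDeriv, hg.koszul_smul_right hφ hX hY hZ,
      Pi.smul_apply', map_smul, ← e, lowerDeriv, smul_eq_mul]

/-- One induction per slot: last, middle, first. Representatives add and scale along, with an extra
X(φ) Y when the middle slot is scaled. -/
theorem isRadicalStationary_of_generators (hg : IsSingularMetric g) {𝓛 : Set (VecField I M)}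
    (h𝓛 : LocallyGenerates 𝓛)
    (h : ∀ L₁ ∈ 𝓛, ∀ L₂ ∈ 𝓛, ∀ p, ∃ v, ∀ L₃ ∈ 𝓛, koszul g L₁ L₂ L₃ p = g p v (L₃ p)) :
    IsRadicalStationary g := by
  have := FiniteDimensional.complete ℝ E
  intro X Y hX hY p
  have h1 : ∀ L₁ ∈ 𝓛, ∀ L₂ ∈ 𝓛, ∃ v, RepresentsAt g (lowerDeriv g L₁ L₂) p v := by
    intro L₁ h₁ L₂ h₂
    obtain ⟨v, hv⟩ := h L₁ h₁ L₂ h₂ p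
    exact ⟨v, representsAt_lowerDeriv_of_generators hg h𝓛 (h𝓛.smooth _ h₁) (h𝓛.smooth _ h₂) hv⟩
  have h2 : ∀ L₁ ∈ 𝓛, ∃ v, RepresentsAt g (lowerDeriv g L₁ Y) p v := by
    intro L₁ h₁
    refine h𝓛.induction p (P := fun Y => ∃ v, RepresentsAt g (lowerDeriv g L₁ Y) p v) ?_ ?_ ?_
      (h1 L₁ h₁) Y hY
    · exact fun Y Y' _ _ hY ⟨v, hv⟩ => ⟨v, representsAt_lowerDeriv_congr .rfl hY hv⟩
    · exact fun Y Y' hY hY' ⟨v, hv⟩ ⟨v', hv'⟩ =>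
        ⟨_, hg.representsAt_add_right (h𝓛.smooth _ h₁) hY hY' hv hv'⟩
    · exact fun φ Y hφ hY ⟨v, hv⟩ => ⟨_, hg.representsAt_smul_right hφ (h𝓛.smooth _ h₁) hY hv⟩
  refine h𝓛.induction p (P := fun X => ∃ v, RepresentsAt g (lowerDeriv g X Y) p v) ?_ ?_ ?_ h2 X hX
  · exact fun X X' _ _ hX ⟨v, hv⟩ => ⟨v, representsAt_lowerDeriv_congr hX .rfl hv⟩
  · exact fun X X' hX hX' ⟨v, hv⟩ ⟨v', hv'⟩ => ⟨_, hg.representsAt_add_left hX hX' hY hv hv'⟩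
  · exact fun φ X hφ hX ⟨v, hv⟩ => ⟨_, hg.representsAt_smul_left hφ hX hY hv⟩

/-- Near `p`, the function `C` agrees with `(∇_Z ∇^♭_X Y)(T)` on the regions of constant signature,
and its value at `p` is `g_p(v, T_p)`. -/
def ExtendsCovDeriv (g : BilinField I M) (p : M) (v : TangentSpace I p) (Z X Y T : VecField I M)
    (C : M → ℝ) : Prop :=
  IsSmoothFun (I := I) C ∧
    (∀ᶠ q in 𝓝 p, q ∈ constSignatureRegion g →
      pointwiseCovDeriv g Z (lowerDeriv g X Y) T q = C q) ∧ C p = g p v (T p)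

/-- Near `p`, the form `∇_Z ∇^♭_X Y` extends smoothly from the regions of constant signature, with
a value in `T_p^•M` at `p`. -/
def ExtendsAt (g : BilinField I M) (p : M) (Z X Y : VecField I M) : Prop :=
  ∃ v : TangentSpace I p, ∀ T, IsSmoothField T → ∃ C, ExtendsCovDeriv g p v Z X Y T C

omit [FiniteDimensional ℝ E] in
theorem ExtendsAt.congr (hZ : Z =ᶠ[𝓝 p] Z') (hX : X =ᶠ[𝓝 p] X') (hY : Y =ᶠ[𝓝 p] Y')
    (h : ExtendsAt g p Z X Y) : ExtendsAt g p Z' X' Y' := by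
  obtain ⟨v, hv⟩ := h
  refine ⟨v, fun T hT => ?_⟩
  obtain ⟨C, hC, h1, h2⟩ := hv T hT
  refine ⟨C, hC, ?_, h2⟩
  filter_upwards [h1, hZ.eventuallyEq_nhds, hX.eventuallyEq_nhds, hY.eventuallyEq_nhds]
    with q hq a b c hq'
  rw [← hq hq']
  exact (pointwiseCovDeriv_congr a b c .rfl).symm

/-- The slots are released in the order T, Z, X, Y. The vector `v` may not depend on T, so T comes
first; the later inductions then transform `v` and the functions `C` in parallel, following the
Leibniz rules. -/
theorem extendsAt_of_generators (hM : HasLocalFrames I M) (hg : IsSingularMetric g)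
    (hr : IsRadicalStationary g) {𝓛 : Set (VecField I M)} (h𝓛 : LocallyGenerates 𝓛)
    (h : ∀ L₁ ∈ 𝓛, ∀ L₂ ∈ 𝓛, ∀ L₃ ∈ 𝓛, ∃ v : TangentSpace I p, ∀ L₄ ∈ 𝓛,
      ∃ C, ExtendsCovDeriv g p v L₁ L₂ L₃ L₄ C)
    (hZ : IsSmoothField Z) (hX : IsSmoothField X) (hY : IsSmoothField Y) :
    ExtendsAt g p Z X Y := by
  have := FiniteDimensional.complete ℝ E
  have h1 : ∀ L₁ ∈ 𝓛, ∀ L₂ ∈ 𝓛, ∀ L₃ ∈ 𝓛, ExtendsAt g p L₁ L₂ L₃ := by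
    intro L₁ hL₁ L₂ hL₂ L₃ hL₃
    have s₁ := h𝓛.smooth _ hL₁
    have s₂ := h𝓛.smooth _ hL₂
    have s₃ := h𝓛.smooth _ hL₃
    obtain ⟨v, hv⟩ := h L₁ hL₁ L₂ hL₂ L₃ hL₃
    refine ⟨v, h𝓛.induction p (P := fun T => ∃ C, ExtendsCovDeriv g p v L₁ L₂ L₃ T C)
      ?_ ?_ ?_ hv⟩
    · rintro T T' _ _ hTT' ⟨C, hC, e1, e2⟩
      refine ⟨C, hC, ?_, by rw [e2, hTT'.self_of_nhds]⟩
      filter_upwards [e1, hTT'.eventuallyEq_nhds] with q hq a hq'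
      rw [← hq hq']
      exact (pointwiseCovDeriv_congr .rfl .rfl .rfl a).symm
    · rintro T T' hT hT' ⟨C, hC, e1, e2⟩ ⟨C', hC', e1', e2'⟩
      refine ⟨fun q => C q + C' q, hC.add hC', ?_, by simp only [e2, e2', Pi.add_apply, map_add]⟩
      filter_upwards [e1, e1'] with q hq hq' hqr
      rw [pointwiseCovDeriv_add_arg hM hg hr (hr.isAnnihForm hg s₂ s₃) s₁ hT hT', hq hqr, hq' hqr]
    · rintro φ T hφ hT ⟨C, hC, e1, e2⟩
      refine ⟨fun q => φ q * C q, hφ.mul hC, ?_, by simp only [e2, Pi.smul_apply', map_smul, smul_eq_mul]⟩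
      filter_upwards [e1] with q hq hqr
      rw [pointwiseCovDeriv_smul_arg hM hg hr (hr.isAnnihForm hg s₂ s₃) hφ s₁ hT, hq hqr]
  have h2 : ∀ L₂ ∈ 𝓛, ∀ L₃ ∈ 𝓛, ExtendsAt g p Z L₂ L₃ := by
    intro L₂ hL₂ L₃ hL₃
    have s₂ := h𝓛.smooth _ hL₂
    have s₃ := h𝓛.smooth _ hL₃
    refine h𝓛.induction p (P := fun Z => ExtendsAt g p Z L₂ L₃) ?_ ?_ ?_
      (fun L₁ hL₁ => h1 L₁ hL₁ L₂ hL₂ L₃ hL₃) Z hZ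
    · exact fun Z Z' _ _ e h => h.congr e .rfl .rfl
    · rintro Z Z' hZ hZ' ⟨v, hv⟩ ⟨v', hv'⟩
      refine ⟨v + v', fun T hT => ?_⟩
      obtain ⟨C, hC, e1, e2⟩ := hv T hT
      obtain ⟨C', hC', e1', e2'⟩ := hv' T hT
      refine ⟨fun q => C q + C' q, hC.add hC', ?_, by simp only [e2, e2', map_add, add_apply]⟩
      filter_upwards [e1, e1'] with q hq hq' hqr
      rw [pointwiseCovDeriv_add_dir hM hg hr (hr.isAnnihForm hg s₂ s₃) hZ hZ' hT, hq hqr, hq' hqr]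
    · rintro φ Z hφ hZ ⟨v, hv⟩
      refine ⟨φ p • v, fun T hT => ?_⟩
      obtain ⟨C, hC, e1, e2⟩ := hv T hT
      refine ⟨fun q => φ q * C q, hφ.mul hC, ?_, by simp only [e2, map_smul, smul_apply, smul_eq_mul]⟩
      filter_upwards [e1] with q hq hqr
      rw [pointwiseCovDeriv_smul_dir hM hg hr (hr.isAnnihForm hg s₂ s₃) hφ hZ hT, hq hqr]
  have h3 : ∀ L₃ ∈ 𝓛, ExtendsAt g p Z X L₃ := by
    intro L₃ hL₃
    have s₃ := h𝓛.smooth _ hL₃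
    refine h𝓛.induction p (P := fun X => ExtendsAt g p Z X L₃) ?_ ?_ ?_
      (fun L₂ hL₂ => h2 L₂ hL₂ L₃ hL₃) X hX
    · exact fun X X' _ _ e h => h.congr .rfl e .rfl
    · rintro X X' hX hX' ⟨v, hv⟩ ⟨v', hv'⟩
      refine ⟨v + v', fun T hT => ?_⟩
      obtain ⟨C, hC, e1, e2⟩ := hv T hT
      obtain ⟨C', hC', e1', e2'⟩ := hv' T hT
      refine ⟨fun q => C q + C' q, hC.add hC', ?_, by simp only [e2, e2', map_add, add_apply]⟩
      filter_upwards [e1, e1'] with q hq hq' hqr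
      rw [pointwiseCovDeriv_add_left hM hg hr hZ hX hX' s₃ hT, hq hqr, hq' hqr]
    · rintro φ X hφ hX ⟨v, hv⟩
      obtain ⟨w, hw⟩ := hr X L₃ hX s₃ p
      -- Here `w` represents ∇^♭_X L₃ at `p`, which enters with factor Z(φ) when X is scaled.
      refine ⟨φ p • v + dirDeriv Z φ p • w, fun T hT => ?_⟩
      obtain ⟨C, hC, e1, e2⟩ := hv T hT
      refine ⟨fun q => φ q * C q + dirDeriv Z φ q * koszul g X L₃ T q,
        (hφ.mul hC).add ((hZ.dirDeriv hφ).mul (hg.isSmoothFun_koszul hX s₃ hT)), ?_, ?_⟩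
      · filter_upwards [e1] with q hq hqr
        rw [pointwiseCovDeriv_smul_left hM hg hr hφ hZ hX s₃ hT, hq hqr]
      · have e3 : koszul g X L₃ T p = g p w (T p) := hw T hT
        simp only [e2, e3, map_add, map_smul, add_apply, smul_apply, smul_eq_mul]
  refine h𝓛.induction p (P := fun Y => ExtendsAt g p Z X Y) ?_ ?_ ?_ h3 Y hY
  · exact fun Y Y' _ _ e h => h.congr .rfl .rfl e
  · rintro Y Y' hY hY' ⟨v, hv⟩ ⟨v', hv'⟩
    refine ⟨v + v', fun T hT => ?_⟩
    obtain ⟨C, hC, e1, e2⟩ := hv T hT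
    obtain ⟨C', hC', e1', e2'⟩ := hv' T hT
    refine ⟨fun q => C q + C' q, hC.add hC', ?_, by simp only [e2, e2', map_add, add_apply]⟩
    filter_upwards [e1, e1'] with q hq hq' hqr
    rw [pointwiseCovDeriv_add_mid hM hg hr hZ hX hY hY' hT, hq hqr, hq' hqr]
  · rintro φ Y hφ hY ⟨v, hv⟩
    obtain ⟨w, hw⟩ := hr X Y hX hY p
    obtain ⟨u, hu⟩ := hr Z Y hZ hY p
    -- The four summands represent the four terms of `pointwiseCovDeriv_smul_mid`; the third is Y
    -- itself, because the corresponding form is ⟨Y, ·⟩.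
    refine ⟨φ p • v + dirDeriv Z φ p • w + dirDeriv Z (dirDeriv X φ) p • Y p
      + dirDeriv X φ p • u, fun T hT => ?_⟩
    obtain ⟨C, hC, e1, e2⟩ := hv T hT
    refine ⟨fun q => φ q * C q + dirDeriv Z φ q * koszul g X Y T q
        + dirDeriv Z (dirDeriv X φ) q * pairing g Y T q + dirDeriv X φ q * koszul g Z Y T q,
      (((hφ.mul hC).add ((hZ.dirDeriv hφ).mul (hg.isSmoothFun_koszul hX hY hT))).add
        ((hZ.dirDeriv (hX.dirDeriv hφ)).mul (hg.smooth Y T hY hT))).add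
        ((hX.dirDeriv hφ).mul (hg.isSmoothFun_koszul hZ hY hT)), ?_, ?_⟩
    · filter_upwards [e1] with q hq hqr
      rw [pointwiseCovDeriv_smul_mid hM hg hr hφ hZ hX hY hT, hq hqr]
    · have e3 : koszul g X Y T p = g p w (T p) := hw T hT
      have e4 : koszul g Z Y T p = g p u (T p) := hu T hT
      simp only [e2, e3, e4, pairing, map_add, map_smul, add_apply, smul_apply, smul_eq_mul]

/-- A singular metric is semi-regular as soon as the defining conditions hold on a generating set of
vector fields. -/
theorem isSemiRegular_of_generators (hM : HasLocalFrames I M) (hg : IsSingularMetric g)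
    {𝓛 : Set (VecField I M)} (h𝓛 : LocallyGenerates 𝓛)
    (hK : ∀ L₁ ∈ 𝓛, ∀ L₂ ∈ 𝓛, ∀ p, ∃ v, ∀ L₃ ∈ 𝓛, koszul g L₁ L₂ L₃ p = g p v (L₃ p))
    (hC : ∀ p : M, ∀ L₁ ∈ 𝓛, ∀ L₂ ∈ 𝓛, ∀ L₃ ∈ 𝓛, ∃ v : TangentSpace I p, ∀ L₄ ∈ 𝓛,
      ∃ C, ExtendsCovDeriv g p v L₁ L₂ L₃ L₄ C) : IsSemiRegular g := by
  have := FiniteDimensional.complete ℝ E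
  have hr := isRadicalStationary_of_generators hg h𝓛 hK
  refine ⟨hg, fun X Y hX hY => ⟨fun Z hZ => hg.isSmoothFun_koszul hX hY hZ, hr X Y hX hY⟩,
    fun X Y Z hX hY hZ => ⟨fun T hT p => ?_, fun p => ?_⟩⟩
  · obtain ⟨v, hv⟩ := extendsAt_of_generators hM hg hr h𝓛 (hC p) hZ hX hY
    obtain ⟨C, hCs, h1, -⟩ := hv T hT
    exact (hCs.contMDiff p).congr_of_eventuallyEq
      (covDeriv_eventuallyEq hM hg hCs.continuous h1)
  · obtain ⟨v, hv⟩ := extendsAt_of_generators hM hg hr h𝓛 (hC p) hZ hX hY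
    refine ⟨v, fun T hT => ?_⟩
    obtain ⟨C, hCs, h1, h2⟩ := hv T hT
    rw [covDeriv_eq_of_continuousAt hM hg hCs.continuous.continuousAt h1, h2]

end Generators

/-! ### Coordinate projections of finite products of manifolds -/

section PiManifold

variable {ι : Type*} [Fintype ι] {E : ι → Type*} [∀ i, NormedAddCommGroup (E i)]
  [∀ i, NormedSpace ℝ (E i)] {H : ι → Type*} [∀ i, TopologicalSpace (H i)]
  {I : ∀ i, ModelWithCorners ℝ (E i) (H i)} {F : ι → Type*}
  [∀ i, TopologicalSpace (F i)] [∀ i, ChartedSpace (H i) (F i)]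

/-- The charts of a finite product are products of charts, so on the chart target a coordinate
projection reads as the linear projection of the model spaces. -/
theorem writtenInExtChartAt_proj_eventuallyEq (y : ∀ i, F i) (j : ι) :
    writtenInExtChartAt (ModelWithCorners.pi I) (I j) y (fun z : ∀ i, F i => z j)
      =ᶠ[𝓝[range (ModelWithCorners.pi I)] (extChartAt (ModelWithCorners.pi I) y y)]
        ContinuousLinearMap.proj (R := ℝ) (φ := E) j := by
  filter_upwards [extChartAt_target_mem_nhdsWithin (I := ModelWithCorners.pi I) y] with z hz
  have hz' : z j ∈ (extChartAt (I j) (y j)).target := by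
    have h1 := (extChartAt (ModelWithCorners.pi I) y).map_target hz
    have h2 := (extChartAt (ModelWithCorners.pi I) y).right_inv hz
    have h3 : (extChartAt (ModelWithCorners.pi I) y).symm z j ∈ (extChartAt (I j) (y j)).source := by
      rw [extChartAt_source] at h1 ⊢
      exact h1 j (mem_univ j)
    have h4 := (extChartAt (I j) (y j)).map_source h3
    have h5 : extChartAt (I j) (y j) ((extChartAt (ModelWithCorners.pi I) y).symm z j) = z j :=
      congrFun h2 j
    rwa [h5] at h4
  exact (extChartAt (I j) (y j)).right_inv hz'

theorem contMDiff_pi_proj {n : ℕ∞ω} (j : ι) :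
    ContMDiff (ModelWithCorners.pi I) (I j) n (fun z : ∀ i, F i => z j) := by
  intro y
  rw [contMDiffAt_iff]
  refine ⟨(continuous_apply j).continuousAt, ?_⟩
  refine ((ContinuousLinearMap.proj (R := ℝ) (φ := E) j).contDiff.contDiffWithinAt).congr_of_eventuallyEq
    (writtenInExtChartAt_proj_eventuallyEq y j) ?_
  exact (writtenInExtChartAt_proj_eventuallyEq y j).self_of_nhdsWithin
    (extChartAt_target_subset_range y (mem_extChartAt_target y))

theorem hasMFDerivAt_pi_proj (y : ∀ i, F i) (j : ι) :
    HasMFDerivAt (ModelWithCorners.pi I) (I j) (fun z : ∀ i, F i => z j) y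
      (ContinuousLinearMap.proj (R := ℝ) (φ := E) j) := by
  refine ⟨(continuous_apply j).continuousAt, ?_⟩
  refine (ContinuousLinearMap.proj (R := ℝ) (φ := E) j).hasFDerivWithinAt.congr_of_eventuallyEq
    (writtenInExtChartAt_proj_eventuallyEq y j) ?_
  exact (writtenInExtChartAt_proj_eventuallyEq y j).self_of_nhdsWithin
    (extChartAt_target_subset_range y (mem_extChartAt_target y))

end PiManifold

/-! ### Smoothness of vector fields in a chart -/

section Chart

variable {E : Type*} [NormedAddCommGroup E] [NormedSpace ℝ E] {H : Type*} [TopologicalSpace H]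
  {I : ModelWithCorners ℝ E H} {M : Type*} [TopologicalSpace M] [ChartedSpace H M]
  [IsManifold I ∞ M] {X : VecField I M}

/-- Over the chart domain, the trivialization of the tangent bundle is the differential of the
chart. In this form, smoothness of a field on a product can be compared with the factors by the
chain rule. -/
theorem contMDiffAt_field_iff (X : VecField I M) (p : M) :
    ContMDiffAt I I.tangent ∞ (fun q => (⟨q, X q⟩ : TangentBundle I M)) p ↔
      ContMDiffAt I 𝓘(ℝ, E) ∞ (fun q => mvfderiv I (extChartAt I p) q (X q)) p := by
  refine (Bundle.contMDiffAt_section p).trans ?_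
  refine Filter.EventuallyEq.contMDiffAt_iff ?_
  filter_upwards [chart_source_mem_nhds H p] with q hq
  have h1 := congrArg (fun L => L (X q))
    (TangentBundle.continuousLinearMapAt_trivializationAt (I := I) hq)
  have h2 : (trivializationAt E (TangentSpace I) p).continuousLinearMapAt ℝ q (X q)
      = (trivializationAt E (TangentSpace I) p ⟨q, X q⟩).2 :=
    Bundle.Trivialization.continuousLinearMapAt_apply_of_mem (R := ℝ) _ hq (X q)
  exact h2.symm.trans h1

end Chart

theorem apply_mvfderiv {E : Type*} [NormedAddCommGroup E] [NormedSpace ℝ E] {H : Type*}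
    [TopologicalSpace H] {I : ModelWithCorners ℝ E H} {M : Type*} [TopologicalSpace M]
    [ChartedSpace H M] {V W : Type*} [NormedAddCommGroup V] [NormedSpace ℝ V]
    [NormedAddCommGroup W] [NormedSpace ℝ W] (L : V →L[ℝ] W) {φ : M → V} {q : M}
    (hφ : MDifferentiableAt I 𝓘(ℝ, V) φ q) (v : TangentSpace I q) :
    L (mvfderiv I φ q v) = mvfderiv I (fun q => L (φ q)) q v := by
  have h1 := (HasMFDerivAt.comp q L.hasMFDerivAt hφ.hasMFDerivAt).mfderiv
  exact (congrArg (fun A => A v) h1).symm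

section Product

variable {EB : Type*} [NormedAddCommGroup EB] [NormedSpace ℝ EB] {HB : Type*} [TopologicalSpace HB]
  {IB : ModelWithCorners ℝ EB HB} {B : Type*} [TopologicalSpace B] [ChartedSpace HB B]
  {l : ℕ} {EF : Fin l → Type*} [∀ j, NormedAddCommGroup (EF j)] [∀ j, NormedSpace ℝ (EF j)]
  {HF : Fin l → Type*} [∀ j, TopologicalSpace (HF j)]
  {IF : ∀ j, ModelWithCorners ℝ (EF j) (HF j)}
  {F : Fin l → Type*} [∀ j, TopologicalSpace (F j)] [∀ j, ChartedSpace (HF j) (F j)]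

/-! ### Tangent vectors and split vector fields of a product -/

theorem contMDiff_base {n : ℕ∞ω} :
    ContMDiff (IB.prod (ModelWithCorners.pi IF)) IB n (fun q : B × ∀ j, F j => q.1) :=
  contMDiff_fst

theorem contMDiff_fiber {n : ℕ∞ω} (j : Fin l) :
    ContMDiff (IB.prod (ModelWithCorners.pi IF)) (IF j) n (fun q : B × ∀ j, F j => q.2 j) :=
  (contMDiff_pi_proj j).comp contMDiff_snd

/-- The component in the base of a tangent vector of the product. -/
def tangentBase (p : B × ∀ j, F j) :
    TangentSpace (IB.prod (ModelWithCorners.pi IF)) p →L[ℝ] TangentSpace IB p.1 :=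
  mfderiv (IB.prod (ModelWithCorners.pi IF)) IB (fun q : B × ∀ j, F j => q.1) p

/-- The component in the `j`-th fiber of a tangent vector of the product. -/
def tangentFiber (p : B × ∀ j, F j) (j : Fin l) :
    TangentSpace (IB.prod (ModelWithCorners.pi IF)) p →L[ℝ] TangentSpace (IF j) (p.2 j) :=
  mfderiv (IB.prod (ModelWithCorners.pi IF)) (IF j) (fun q : B × ∀ j, F j => q.2 j) p

/-- The tangent vector of the product with given components. -/
def tangentMk (p : B × ∀ j, F j) (v : TangentSpace IB p.1)
    (w : ∀ j, TangentSpace (IF j) (p.2 j)) :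
    TangentSpace (IB.prod (ModelWithCorners.pi IF)) p :=
  ((v, w) : EB × ∀ j, EF j)

theorem tangentBase_apply (p : B × ∀ j, F j)
    (v : TangentSpace (IB.prod (ModelWithCorners.pi IF)) p) :
    tangentBase p v = (v : EB × ∀ j, EF j).1 := by
  rw [tangentBase, (hasMFDerivAt_fst (I := IB) (I' := ModelWithCorners.pi IF) p).mfderiv]
  rfl

theorem tangentFiber_apply (p : B × ∀ j, F j) (j : Fin l)
    (v : TangentSpace (IB.prod (ModelWithCorners.pi IF)) p) :
    tangentFiber p j v = (v : EB × ∀ j, EF j).2 j := by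
  have h := HasMFDerivAt.comp p (hasMFDerivAt_pi_proj (I := IF) p.2 j)
    (hasMFDerivAt_snd (I := IB) (I' := ModelWithCorners.pi IF) p)
  have h' := h.mfderiv
  exact congrArg (fun L => L v) h'

@[simp]
theorem tangentBase_mk (p : B × ∀ j, F j) (v : TangentSpace IB p.1)
    (w : ∀ j, TangentSpace (IF j) (p.2 j)) : tangentBase p (tangentMk p v w) = v :=
  tangentBase_apply p _

@[simp]
theorem tangentFiber_mk (p : B × ∀ j, F j) (v : TangentSpace IB p.1)
    (w : ∀ j, TangentSpace (IF j) (p.2 j)) (j : Fin l) :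
    tangentFiber p j (tangentMk p v w) = w j :=
  tangentFiber_apply p j _

theorem tangent_ext {p : B × ∀ j, F j} {v w : TangentSpace (IB.prod (ModelWithCorners.pi IF)) p}
    (h : tangentBase p v = tangentBase p w) (h' : ∀ j, tangentFiber p j v = tangentFiber p j w) :
    v = w := by
  rw [tangentBase_apply, tangentBase_apply] at h
  refine Prod.ext h (funext fun j => ?_)
  have := h' j
  rwa [tangentFiber_apply, tangentFiber_apply] at this

/-- The vector field on the product with components lifted from the factors. -/
def splitField (X : VecField IB B) (U : ∀ j, VecField (IF j) (F j)) :
    VecField (IB.prod (ModelWithCorners.pi IF)) (B × ∀ j, F j) :=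
  fun p => tangentMk p (X p.1) (fun j => U j (p.2 j))

theorem liftB_eq_splitField (X : VecField IB B) :
    liftB (IF := IF) (F := F) X = splitField X 0 := rfl

theorem liftF_eq_splitField (j : Fin l) (V : VecField (IF j) (F j)) :
    liftF (IB := IB) (B := B) j V = splitField 0 (Pi.single j V) := by
  funext p
  refine tangent_ext (p := p) ?_ fun k => ?_
  · rw [tangentBase_apply, tangentBase_apply]
    rfl
  · rw [tangentFiber_apply, tangentFiber_apply]
    change (Pi.single j (V (p.2 j)) : ∀ j, EF j) k
      = (Pi.single j V : ∀ j, VecField (IF j) (F j)) k (p.2 k)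
    by_cases h : k = j
    · subst h
      exact (Pi.single_eq_same (M := EF) k _).trans
        (congrFun (Pi.single_eq_same (M := fun j => VecField (IF j) (F j)) k V) (p.2 k)).symm
    · exact (Pi.single_eq_of_ne (M := EF) h _).trans
        (congrFun (Pi.single_eq_of_ne (M := fun j => VecField (IF j) (F j)) h V) (p.2 k)).symm

/-! ### Functions pulled back from the factors and their derivatives along split fields. -/

section Deriv

variable {h : B → ℝ} {j : Fin l} {k : F j → ℝ}

theorem mvfderiv_comp_base {p : B × ∀ j, F j} (hh : MDifferentiableAt IB 𝓘(ℝ, ℝ) h p.1)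
    (v : TangentSpace (IB.prod (ModelWithCorners.pi IF)) p) :
    mvfderiv (IB.prod (ModelWithCorners.pi IF)) (fun q : B × ∀ j, F j => h q.1) p v
      = mvfderiv IB h p.1 (tangentBase p v) :=
  mvfderiv_comp_apply p (f := fun q : B × ∀ j, F j => q.1) hh
    ((contMDiff_base (n := 1) p).mdifferentiableAt one_ne_zero) v

theorem mvfderiv_comp_fiber {p : B × ∀ j, F j} (hk : MDifferentiableAt (IF j) 𝓘(ℝ, ℝ) k (p.2 j))
    (v : TangentSpace (IB.prod (ModelWithCorners.pi IF)) p) :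
    mvfderiv (IB.prod (ModelWithCorners.pi IF)) (fun q : B × ∀ j, F j => k (q.2 j)) p v
      = mvfderiv (IF j) k (p.2 j) (tangentFiber p j v) :=
  mvfderiv_comp_apply p (f := fun q : B × ∀ j, F j => q.2 j) hk
    ((contMDiff_fiber (n := 1) j p).mdifferentiableAt one_ne_zero) v

theorem IsSmoothFun.comp_base (hh : IsSmoothFun (I := IB) h) :
    IsSmoothFun (I := IB.prod (ModelWithCorners.pi IF)) (fun q : B × ∀ j, F j => h q.1) :=
  hh.contMDiff.comp contMDiff_base

theorem IsSmoothFun.comp_fiber (hk : IsSmoothFun (I := IF j) k) :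
    IsSmoothFun (I := IB.prod (ModelWithCorners.pi IF)) (fun q : B × ∀ j, F j => k (q.2 j)) :=
  hk.contMDiff.comp (contMDiff_fiber j)

theorem dirDeriv_splitField_base (X : VecField IB B) (U : ∀ j, VecField (IF j) (F j))
    (hh : IsSmoothFun (I := IB) h) (p : B × ∀ j, F j) :
    dirDeriv (splitField X U) (fun q : B × ∀ j, F j => h q.1) p = dirDeriv X h p.1 := by
  rw [dirDeriv_eq_mvfderiv, mvfderiv_comp_base (hh.mdifferentiableAt _), splitField, tangentBase_mk,
    dirDeriv_eq_mvfderiv]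

theorem dirDeriv_splitField_fiber (X : VecField IB B) (U : ∀ j, VecField (IF j) (F j))
    (hk : IsSmoothFun (I := IF j) k) (p : B × ∀ j, F j) :
    dirDeriv (splitField X U) (fun q : B × ∀ j, F j => k (q.2 j)) p = dirDeriv (U j) k (p.2 j) := by
  rw [dirDeriv_eq_mvfderiv, mvfderiv_comp_fiber (hk.mdifferentiableAt _), splitField,
    tangentFiber_mk, dirDeriv_eq_mvfderiv]

end Deriv

variable [IsManifold IB ∞ B] [∀ j, IsManifold (IF j) ∞ (F j)]

/-- Each component of the product chart is a chart of a factor composed with a projection, so the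
chart components of the split field are those of `X` and `U j`, pulled back. -/
theorem IsSmoothField.splitField {X : VecField IB B} {U : ∀ j, VecField (IF j) (F j)}
    (hX : IsSmoothField X) (hU : ∀ j, IsSmoothField (U j)) :
    IsSmoothField (splitField X U) := by
  intro p
  rw [contMDiffAt_field_iff]
  set 𝕀 := IB.prod (ModelWithCorners.pi IF)
  have hchart : ∀ᶠ q in 𝓝 p, MDifferentiableAt 𝕀 𝓘(ℝ, EB × ∀ j, EF j) (extChartAt 𝕀 p) q := by
    filter_upwards [chart_source_mem_nhds (ModelProd HB (ModelPi HF)) p] with q hq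
    exact mdifferentiableAt_extChartAt hq
  rw [contMDiffAt_prod_module_iff]
  constructor
  · have h1 := ((contMDiffAt_field_iff X p.1).1 (hX p.1)).comp p
      (contMDiff_base (IF := IF) (n := ∞) p)
    refine h1.congr_of_eventuallyEq ?_
    filter_upwards [hchart, (continuous_fst.tendsto p).eventually
      (chart_source_mem_nhds HB p.1)] with q hq hq'
    refine (apply_mvfderiv (ContinuousLinearMap.fst ℝ EB (∀ j, EF j)) hq _).trans ?_
    have h2 := (HasMFDerivAt.comp q (mdifferentiableAt_extChartAt (I := IB) hq').hasMFDerivAt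
      ((contMDiff_base (IF := IF) (n := 1) q).mdifferentiableAt one_ne_zero).hasMFDerivAt).mfderiv
    have h3 := congrArg (fun A => A (SingularGeometry.splitField X U q)) h2
    refine h3.trans ?_
    exact congrArg (mvfderiv IB (extChartAt IB p.1) q.1) (tangentBase_mk q _ _)
  · rw [contMDiffAt_pi_space]
    intro j
    have h1 := ((contMDiffAt_field_iff (U j) (p.2 j)).1 (hU j (p.2 j))).comp p
      (contMDiff_fiber (IB := IB) (n := ∞) j p)
    refine h1.congr_of_eventuallyEq ?_
    filter_upwards [hchart, ((continuous_apply j).comp continuous_snd).continuousAt.eventually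
      (chart_source_mem_nhds (HF j) (p.2 j))] with q hq hq'
    refine (apply_mvfderiv ((ContinuousLinearMap.proj j).comp
      (ContinuousLinearMap.snd ℝ EB (∀ j, EF j))) hq _).trans ?_
    have h2 := (HasMFDerivAt.comp q (mdifferentiableAt_extChartAt (I := IF j) hq').hasMFDerivAt
      ((contMDiff_fiber (IB := IB) (n := 1) j q).mdifferentiableAt
        one_ne_zero).hasMFDerivAt).mfderiv
    have h3 := congrArg (fun A => A (SingularGeometry.splitField X U q)) h2
    refine h3.trans ?_
    exact congrArg (mvfderiv (IF j) (extChartAt (IF j) (p.2 j)) (q.2 j)) (tangentFiber_mk q _ _ j)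

end Product

section ProductFrames

variable {EB : Type*} [NormedAddCommGroup EB] [NormedSpace ℝ EB] {HB : Type*} [TopologicalSpace HB]
  {IB : ModelWithCorners ℝ EB HB} {B : Type*} [TopologicalSpace B] [ChartedSpace HB B]
  {l : ℕ} {EF : Fin l → Type*} [∀ j, NormedAddCommGroup (EF j)] [∀ j, NormedSpace ℝ (EF j)]
  {HF : Fin l → Type*} [∀ j, TopologicalSpace (HF j)]
  {IF : ∀ j, ModelWithCorners ℝ (EF j) (HF j)}
  {F : Fin l → Type*} [∀ j, TopologicalSpace (F j)] [∀ j, ChartedSpace (HF j) (F j)]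
  [IsManifold IB ∞ B] [∀ j, IsManifold (IF j) ∞ (F j)]

/-! ### Local frames of a product -/

theorem isSmoothField_single (j : Fin l) {V : VecField (IF j) (F j)} (hV : IsSmoothField V)
    (k : Fin l) : IsSmoothField ((Pi.single j V : ∀ j, VecField (IF j) (F j)) k) := by
  by_cases h : k = j
  · subst h
    rwa [Pi.single_eq_same]
  · rw [Pi.single_eq_of_ne h]
    exact IsSmoothField.zero

variable (IB B IF F) in
/-- The vector fields on the product with components lifted from the factors. -/
def splitFields : Set (VecField (IB.prod (ModelWithCorners.pi IF)) (B × ∀ j, F j)) :=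
  {L | ∃ (X : VecField IB B) (U : ∀ j, VecField (IF j) (F j)), IsSmoothField X ∧
    (∀ j, IsSmoothField (U j)) ∧ L = splitField X U}

/-- The frames of all factors taken together. The frame fields are split and the coordinate
functions are pullbacks, so this serves both as a local frame and as the proof that split fields
generate. -/
theorem exists_split_frame (hB : HasLocalFrames IB B) (hF : ∀ j, HasLocalFrames (IF j) (F j))
    (p : B × ∀ j, F j) :
    ∃ (ι : Type) (_ : Fintype ι)
      (e : ι → VecField (IB.prod (ModelWithCorners.pi IF)) (B × ∀ j, F j))
      (x : ι → (B × ∀ j, F j) → ℝ),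
      (∀ a, e a ∈ splitFields IB B IF F) ∧
      (∀ a, IsSmoothFun (I := IB.prod (ModelWithCorners.pi IF)) (x a)) ∧
      ∀ᶠ q in 𝓝 p, ∀ v : TangentSpace (IB.prod (ModelWithCorners.pi IF)) q,
        ∑ a, mvfderiv (IB.prod (ModelWithCorners.pi IF)) (x a) q v • e a q = v := by
  obtain ⟨ι, _, e, x, he, hx, hs⟩ := hB p.1
  choose κ hκ e' x' he' hx' hs' using fun j => hF j (p.2 j)
  refine ⟨ι ⊕ (Σ j, κ j), inferInstance,
    Sum.elim (fun a => splitField (e a) 0) (fun a => splitField 0 (Pi.single a.1 (e' a.1 a.2))),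
    Sum.elim (fun a q => x a q.1) (fun a q => x' a.1 a.2 (q.2 a.1)), ?_, ?_, ?_⟩
  · rintro (a | ⟨j, a⟩)
    · exact ⟨e a, 0, he a, fun _ => .zero, rfl⟩
    · exact ⟨0, Pi.single j (e' j a), .zero, isSmoothField_single j (he' j a), rfl⟩
  · rintro (a | ⟨j, a⟩)
    · exact (hx a).comp_base
    · exact (hx' j a).comp_fiber
  · have h1 : ∀ᶠ q : B × ∀ j, F j in 𝓝 p, ∀ v : TangentSpace IB q.1,
        ∑ a, mvfderiv IB (x a) q.1 v • e a q.1 = v := (continuous_fst.tendsto p).eventually hs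
    have h2 : ∀ᶠ q : B × ∀ j, F j in 𝓝 p, ∀ (j : Fin l) (v : TangentSpace (IF j) (q.2 j)),
        ∑ a, mvfderiv (IF j) (x' j a) (q.2 j) v • e' j a (q.2 j) = v :=
      eventually_all.2 fun j =>
        ((continuous_apply j).comp continuous_snd).continuousAt.eventually (hs' j)
    filter_upwards [h1, h2] with q hq hq' v
    rw [Fintype.sum_sum_type, Fintype.sum_sigma]
    simp only [Sum.elim_inl, Sum.elim_inr]
    refine tangent_ext ?_ fun k => ?_
    · simp only [map_add, map_sum, map_smul, splitField, tangentBase_mk, Pi.zero_apply, smul_zero,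
        Finset.sum_const_zero, add_zero]
      refine Eq.trans (Finset.sum_congr rfl fun a _ => ?_) (hq (tangentBase q v))
      rw [mvfderiv_comp_base ((hx a).mdifferentiableAt _)]
    · simp only [map_add, map_sum, map_smul, splitField, tangentFiber_mk, Pi.zero_apply, smul_zero,
        Finset.sum_const_zero, zero_add]
      -- Frame fields lifted from other fibers have no component along the k-th fiber.
      rw [Finset.sum_eq_single k]
      · simp only [Pi.single_eq_same]
        refine Eq.trans (Finset.sum_congr rfl fun a _ => ?_) (hq' k (tangentFiber q k v))
        rw [mvfderiv_comp_fiber ((hx' k a).mdifferentiableAt _)]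
      · intro j _ hj
        refine Finset.sum_eq_zero fun a _ => ?_
        rw [Pi.single_eq_of_ne hj.symm, Pi.zero_apply, smul_zero]
      · simp

theorem splitFields_smooth {L} (hL : L ∈ splitFields IB B IF F) : IsSmoothField L := by
  obtain ⟨X, U, hX, hU, rfl⟩ := hL
  exact hX.splitField hU

theorem hasLocalFrames_prod (hB : HasLocalFrames IB B) (hF : ∀ j, HasLocalFrames (IF j) (F j)) :
    HasLocalFrames (IB.prod (ModelWithCorners.pi IF)) (B × ∀ j, F j) := by
  intro p
  obtain ⟨ι, i, e, x, he, hx, h⟩ := exists_split_frame hB hF p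
  exact ⟨ι, i, e, x, fun a => splitFields_smooth (he a), hx, h⟩

theorem locallyGenerates_splitFields (hB : HasLocalFrames IB B)
    (hF : ∀ j, HasLocalFrames (IF j) (F j)) : LocallyGenerates (splitFields IB B IF F) where
  smooth _ hL := splitFields_smooth hL
  zero_mem := ⟨0, 0, .zero, fun _ => .zero, rfl⟩
  generates p X hX := by
    obtain ⟨ι, i, e, x, he, hx, h⟩ := exists_split_frame hB hF p
    exact ⟨ι, i, fun a => dirDeriv X (x a), e, fun a => hX.dirDeriv (hx a), he,
      h.mono fun q hq => hq (X q)⟩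

/-- A split field is related to each of its components under the corresponding projection, and
brackets of related fields are related. -/
theorem mlieBracket_splitField [CompleteSpace EB] [∀ j, CompleteSpace (EF j)]
    (hB : HasLocalFrames IB B) (hF : ∀ j, HasLocalFrames (IF j) (F j)) {X Y : VecField IB B}
    {U V : ∀ j, VecField (IF j) (F j)} (hX : IsSmoothField X) (hY : IsSmoothField Y)
    (hU : ∀ j, IsSmoothField (U j)) (hV : ∀ j, IsSmoothField (V j)) :
    VectorField.mlieBracket (IB.prod (ModelWithCorners.pi IF)) (splitField X U) (splitField Y V)
      = splitField (VectorField.mlieBracket IB X Y)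
        (fun j => VectorField.mlieBracket (IF j) (U j) (V j)) := by
  have hM := hasLocalFrames_prod hB hF
  funext p
  refine tangent_ext ?_ fun j => ?_
  · refine (hM.mfderiv_mlieBracket hB contMDiff_base (hX.splitField hU) (hY.splitField hV) hX hY
      (fun q => tangentBase_mk q _ _) (fun q => tangentBase_mk q _ _) p).trans ?_
    exact (tangentBase_mk p _ _).symm
  · refine (hM.mfderiv_mlieBracket (hF j)
      (contMDiff_fiber (IB := IB) (HF := HF) (IF := IF) (B := B) (F := F) j) (hX.splitField hU)
      (hY.splitField hV) (hU j) (hV j)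
      (fun q => tangentFiber_mk (IF := IF) q (X q.1) (fun k => U k (q.2 k)) j)
      (fun q => tangentFiber_mk (IF := IF) q (Y q.1) (fun k => V k (q.2 k)) j) p).trans ?_
    exact (tangentFiber_mk (IB := IB) (IF := IF) p (VectorField.mlieBracket IB X Y p.1)
      (fun j => VectorField.mlieBracket (IF j) (U j) (V j) (p.2 j)) j).symm

/-! ### The warped metric -/

variable {gB : BilinField IB B} {gF : ∀ j, BilinField (IF j) (F j)} {f : Fin l → B → ℝ}

omit [IsManifold IB ∞ B] [∀ j, IsManifold (IF j) ∞ (F j)] in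
theorem warpedMetric_apply (p : B × ∀ j, F j)
    (v w : TangentSpace (IB.prod (ModelWithCorners.pi IF)) p) :
    warpedMetric gB gF f p v w = gB p.1 (tangentBase p v) (tangentBase p w)
      + ∑ j, f j p.1 ^ 2 * gF j (p.2 j) (tangentFiber p j v) (tangentFiber p j w) := by
  simp only [warpedMetric, add_apply, sum_apply, smul_apply, smul_eq_mul]
  rfl

omit [IsManifold IB ∞ B] [∀ j, IsManifold (IF j) ∞ (F j)] in
theorem pairing_warpedMetric_splitField (X Y : VecField IB B)
    (U V : ∀ j, VecField (IF j) (F j)) (p : B × ∀ j, F j) :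
    pairing (warpedMetric gB gF f) (splitField X U) (splitField Y V) p
      = pairing gB X Y p.1 + ∑ j, f j p.1 ^ 2 * pairing (gF j) (U j) (V j) (p.2 j) := by
  simp only [pairing, warpedMetric_apply, splitField, tangentBase_mk, tangentFiber_mk]

/-- The pairing is local and bilinear over smooth functions in both slots, so its smoothness need
only be seen on split fields, where it is an explicit sum of products of pullbacks. -/
theorem isSingularMetric_warpedMetric (hB : HasLocalFrames IB B)
    (hF : ∀ j, HasLocalFrames (IF j) (F j)) (hgB : IsSingularMetric gB)
    (hgF : ∀ j, IsSingularMetric (gF j)) (hf : ∀ j, IsSmoothFun (I := IB) (f j)) :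
    IsSingularMetric (warpedMetric gB gF f) where
  symm p v w := by
    simp only [warpedMetric_apply, hgB.symm p.1 (tangentBase p v)]
    refine congrArg _ (Finset.sum_congr rfl fun j _ => ?_)
    rw [(hgF j).symm]
  smooth X Y hX hY p := by
    have hgen := locallyGenerates_splitFields hB hF
    have hc : ∀ {X X' Y Y' : VecField (IB.prod (ModelWithCorners.pi IF)) (B × ∀ j, F j)}, X =ᶠ[𝓝 p] X' → Y =ᶠ[𝓝 p] Y' →
        ContMDiffAt (IB.prod (ModelWithCorners.pi IF)) 𝓘(ℝ, ℝ) ∞ (pairing (warpedMetric gB gF f) X Y) p →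
          ContMDiffAt (IB.prod (ModelWithCorners.pi IF)) 𝓘(ℝ, ℝ) ∞ (pairing (warpedMetric gB gF f) X' Y') p := by
      intro X X' Y Y' h1 h2 h
      refine h.congr_of_eventuallyEq ?_
      filter_upwards [h1, h2] with q e1 e2
      simp only [pairing, e1, e2]
    refine hgen.induction p (P := fun X => ContMDiffAt (IB.prod (ModelWithCorners.pi IF)) 𝓘(ℝ, ℝ) ∞ (pairing (warpedMetric gB gF f) X Y) p)
      (fun _ _ _ _ e => hc e .rfl) ?_ ?_ ?_ X hX
    · intro X X' _ _ h h'
      rw [pairing_add_left]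
      exact h.add h'
    · intro φ X hφ _ h
      rw [pairing_smul_left]
      exact (hφ.contMDiff p).mul h
    rintro L ⟨X, U, hX, hU, rfl⟩
    refine hgen.induction p (P := fun Y => ContMDiffAt (IB.prod (ModelWithCorners.pi IF)) 𝓘(ℝ, ℝ) ∞ (pairing (warpedMetric gB gF f) _ Y) p)
      (fun _ _ _ _ e => hc .rfl e) ?_ ?_ ?_ Y hY
    · intro X X' _ _ h h'
      rw [pairing_add_right]
      exact h.add h'
    · intro φ X hφ _ h
      rw [pairing_smul_right]
      exact (hφ.contMDiff p).mul h
    rintro L ⟨Y, V, hY, hV, rfl⟩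
    rw [show pairing (warpedMetric gB gF f) (splitField X U) (splitField Y V) = _ from
      funext (pairing_warpedMetric_splitField X Y U V)]
    have h1 : IsSmoothFun (I := IB.prod (ModelWithCorners.pi IF))
        (fun q : B × ∀ j, F j => pairing gB X Y q.1) := (hgB.smooth X Y hX hY).comp_base
    have h2 : ∀ j, IsSmoothFun (I := IB.prod (ModelWithCorners.pi IF))
        (fun q : B × ∀ j, F j => f j q.1 ^ 2 * pairing (gF j) (U j) (V j) (q.2 j)) := fun j =>
      ((hf j).pow 2).comp_base.mul ((hgF j).smooth _ _ (hU j) (hV j)).comp_fiber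
    exact (h1.add (IsSmoothFun.sum fun j _ => h2 j)).contMDiff p

/-- The Koszul form of a multiply warped product, on split vector fields. -/
theorem koszul_warpedMetric [CompleteSpace EB] [∀ j, CompleteSpace (EF j)]
    (hB : HasLocalFrames IB B) (hF : ∀ j, HasLocalFrames (IF j) (F j)) (hgB : IsSingularMetric gB)
    (hgF : ∀ j, IsSingularMetric (gF j)) (hf : ∀ j, IsSmoothFun (I := IB) (f j))
    {X Y Z : VecField IB B} {U V W : ∀ j, VecField (IF j) (F j)}
    (hX : IsSmoothField X) (hY : IsSmoothField Y) (hZ : IsSmoothField Z)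
    (hU : ∀ j, IsSmoothField (U j)) (hV : ∀ j, IsSmoothField (V j))
    (hW : ∀ j, IsSmoothField (W j)) (p : B × ∀ j, F j) :
    koszul (warpedMetric gB gF f) (splitField X U) (splitField Y V) (splitField Z W) p
      = koszul gB X Y Z p.1 + ∑ j,
        (f j p.1 * dirDeriv X (f j) p.1 * pairing (gF j) (V j) (W j) (p.2 j)
          + f j p.1 * dirDeriv Y (f j) p.1 * pairing (gF j) (U j) (W j) (p.2 j)
          - f j p.1 * dirDeriv Z (f j) p.1 * pairing (gF j) (U j) (V j) (p.2 j)
          + f j p.1 ^ 2 * koszul (gF j) (U j) (V j) (W j) (p.2 j)) := by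
  -- One formula covers the three derivative terms of the Koszul form. The 2 from differentiating
  -- f_j² is absorbed by the factor 1/2.
  have hd : ∀ {X Y Z : VecField IB B} {U V W : ∀ j, VecField (IF j) (F j)},
      IsSmoothField Y → IsSmoothField Z → (∀ j, IsSmoothField (V j)) → (∀ j, IsSmoothField (W j)) →
      dirDeriv (splitField X U) (pairing (warpedMetric gB gF f) (splitField Y V) (splitField Z W)) p
        = dirDeriv X (pairing gB Y Z) p.1 + ∑ j,
          (2 * f j p.1 * dirDeriv X (f j) p.1 * pairing (gF j) (V j) (W j) (p.2 j)
            + f j p.1 ^ 2 * dirDeriv (U j) (pairing (gF j) (V j) (W j)) (p.2 j)) := by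
    intro X Y Z U V W hY hZ hV hW
    have s1 := (hgB.smooth Y Z hY hZ)
    have s2 := fun j => (hgF j).smooth _ _ (hV j) (hW j)
    have s3 : ∀ j, IsSmoothFun (I := IB.prod (ModelWithCorners.pi IF))
        (fun q : B × ∀ j, F j => f j q.1 ^ 2 * pairing (gF j) (V j) (W j) (q.2 j)) := fun j =>
      ((hf j).pow 2).comp_base.mul (s2 j).comp_fiber
    rw [show pairing (warpedMetric gB gF f) (splitField Y V) (splitField Z W) = _ from
      funext (pairing_warpedMetric_splitField Y Z V W),
      dirDeriv_add (s1.comp_base.mdifferentiableAt p)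
        ((IsSmoothFun.sum fun j _ => s3 j).mdifferentiableAt p),
      dirDeriv_splitField_base _ _ s1, dirDeriv_sum _ s3]
    refine congrArg _ (Finset.sum_congr rfl fun j _ => ?_)
    rw [dirDeriv_mul (((hf j).pow 2).comp_base.mdifferentiableAt p)
      ((s2 j).comp_fiber.mdifferentiableAt p), dirDeriv_splitField_fiber _ _ (s2 j),
      dirDeriv_splitField_base _ _ ((hf j).pow 2)]
    have : dirDeriv X (fun q => f j q ^ 2) p.1 = 2 * f j p.1 * dirDeriv X (f j) p.1 := by
      simp only [pow_two]
      rw [dirDeriv_mul ((hf j).mdifferentiableAt _) ((hf j).mdifferentiableAt _)]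
      ring
    rw [this]
    ring
  simp only [koszul]
  rw [hd hY hZ hV hW, hd hZ hX hW hU, hd hX hY hU hV, mlieBracket_splitField hB hF hX hY hU hV,
    mlieBracket_splitField hB hF hY hZ hV hW, mlieBracket_splitField hB hF hZ hX hW hU]
  simp only [warpedMetric_apply, splitField, tangentBase_mk, tangentFiber_mk]
  have hsum : ∀ a b c d e k : Fin l → ℝ, ∀ A C D G J K : ℝ,
      (1 / 2 : ℝ) * (A + ∑ j, a j + (C + ∑ j, b j) - (D + ∑ j, c j) - (G + ∑ j, d j)
        + (J + ∑ j, e j) + (K + ∑ j, k j))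
        = 1 / 2 * (A + C - D - G + J + K)
          + ∑ j, 1 / 2 * (a j + b j - c j - d j + e j + k j) := by
    intro a b c d e k A C D G J K
    rw [← Finset.mul_sum]
    simp only [Finset.sum_add_distrib, Finset.sum_sub_distrib]
    ring
  rw [hsum]
  refine congrArg _ (Finset.sum_congr rfl fun j _ => ?_)
  rw [(hgF j).pairing_comm (X := W j) (Y := U j)]
  ring

end ProductFrames

/-! ### Regions of constant signature of a warped product -/

/-- Rank-nullity: the kernel of `G` is the product of the kernels of the `A j`, and the factor `VB`
contributes nothing to it. -/
theorem finrank_range_of_ker_split {ι VB W : Type*} [Fintype ι] {V W' : ι → Type*} [AddCommGroup VB]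
    [Module ℝ VB] [FiniteDimensional ℝ VB] [∀ j, AddCommGroup (V j)] [∀ j, Module ℝ (V j)]
    [∀ j, FiniteDimensional ℝ (V j)] [AddCommGroup W] [Module ℝ W] [∀ j, AddCommGroup (W' j)]
    [∀ j, Module ℝ (W' j)] (G : (VB × ∀ j, V j) →ₗ[ℝ] W) (A : ∀ j, V j →ₗ[ℝ] W' j)
    (h : ∀ v, G v = 0 ↔ v.1 = 0 ∧ ∀ j, A j (v.2 j) = 0) :
    Module.finrank ℝ (LinearMap.range G)
      = Module.finrank ℝ VB + ∑ j, Module.finrank ℝ (LinearMap.range (A j)) := by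
  let e : LinearMap.ker G ≃ₗ[ℝ] ∀ j, LinearMap.ker (A j) :=
    { toFun := fun v j => ⟨v.1.2 j, ((h v.1).1 v.2).2 j⟩
      map_add' := fun _ _ => rfl
      map_smul' := fun _ _ => rfl
      invFun := fun w => ⟨(0, fun j => (w j).1), (h _).2 ⟨rfl, fun j => (w j).2⟩⟩
      left_inv := fun v => Subtype.ext (Prod.ext ((h v.1).1 v.2).1.symm rfl)
      right_inv := fun _ => rfl }
  have h1 := LinearMap.finrank_range_add_finrank_ker G
  have h2 := fun j => LinearMap.finrank_range_add_finrank_ker (A j)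
  have h3 : ∑ j, (Module.finrank ℝ (LinearMap.range (A j)) + Module.finrank ℝ (LinearMap.ker (A j)))
      = ∑ j, Module.finrank ℝ (V j) := Finset.sum_congr rfl fun j _ => h2 j
  rw [e.finrank_eq, Module.finrank_prod, Module.finrank_pi_fintype, Module.finrank_pi_fintype] at h1
  rw [Finset.sum_add_distrib] at h3
  omega

section WarpedRegion

variable {EB : Type*} [NormedAddCommGroup EB] [NormedSpace ℝ EB] {HB : Type*} [TopologicalSpace HB]
  {IB : ModelWithCorners ℝ EB HB} {B : Type*} [TopologicalSpace B] [ChartedSpace HB B]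
  {l : ℕ} {EF : Fin l → Type*} [∀ j, NormedAddCommGroup (EF j)] [∀ j, NormedSpace ℝ (EF j)]
  {HF : Fin l → Type*} [∀ j, TopologicalSpace (HF j)]
  {IF : ∀ j, ModelWithCorners ℝ (EF j) (HF j)}
  {F : Fin l → Type*} [∀ j, TopologicalSpace (F j)] [∀ j, ChartedSpace (HF j) (F j)]
  {gB : BilinField IB B} {gF : ∀ j, BilinField (IF j) (F j)} {f : Fin l → B → ℝ}

/-- Testing against vectors tangent to one factor separates the summands; non-degeneracy of the base
metric removes the base component. -/
theorem warpedMetric_apply_eq_zero_iff (hnd : IsNondegenerate gB) (p : B × ∀ j, F j)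
    (v : TangentSpace (IB.prod (ModelWithCorners.pi IF)) p) :
    warpedMetric gB gF f p v = 0
      ↔ tangentBase p v = 0 ∧ ∀ j, (f j p.1 ^ 2 • gF j (p.2 j)) (tangentFiber p j v) = 0 := by
  constructor
  · intro h
    have h1 : ∀ w, warpedMetric gB gF f p v w = 0 := fun w => by rw [h]; rfl
    refine ⟨hnd _ _ fun w => ?_, fun j => ContinuousLinearMap.ext fun w => ?_⟩
    · have := h1 (tangentMk p w 0)
      simpa [warpedMetric_apply] using this
    · have := h1 (tangentMk p 0 (Pi.single j w))
      rw [warpedMetric_apply, Finset.sum_eq_single j] at this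
      · simpa using this
      · intro k _ hk
        simp [Pi.single_eq_of_ne hk]
      · simp
  · rintro ⟨h1, h2⟩
    refine ContinuousLinearMap.ext fun w => ?_
    rw [warpedMetric_apply, h1]
    have : ∀ j, f j p.1 ^ 2 * gF j (p.2 j) (tangentFiber p j v) (tangentFiber p j w) = 0 :=
      fun j => congrArg (fun L => L (tangentFiber p j w)) (h2 j)
    simp [this]

variable [FiniteDimensional ℝ EB] [∀ j, FiniteDimensional ℝ (EF j)]

theorem finrank_range_warpedMetric (hnd : IsNondegenerate gB) (p : B × ∀ j, F j) :
    Module.finrank ℝ (LinearMap.range (warpedMetric gB gF f p).toLinearMap)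
      = Module.finrank ℝ EB
        + ∑ j, Module.finrank ℝ (LinearMap.range (f j p.1 ^ 2 • gF j (p.2 j)).toLinearMap) := by
  let G : (EB × ∀ j, EF j) →L[ℝ] (EB × ∀ j, EF j) →L[ℝ] ℝ := warpedMetric gB gF f p
  let A : ∀ j, EF j →L[ℝ] EF j →L[ℝ] ℝ := fun j => f j p.1 ^ 2 • gF j (p.2 j)
  refine finrank_range_of_ker_split G.toLinearMap (fun j => (A j).toLinearMap) fun v => ?_
  refine (warpedMetric_apply_eq_zero_iff hnd p v).trans ?_
  exact ⟨fun h => ⟨(tangentBase_apply p v).symm.trans h.1,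
    fun j => (congrArg (A j) (tangentFiber_apply p j v)).symm.trans (h.2 j)⟩,
    fun h => ⟨(tangentBase_apply p v).trans h.1,
      fun j => (congrArg (A j) (tangentFiber_apply p j v)).trans (h.2 j)⟩⟩

variable [∀ j, IsManifold (IF j) ∞ (F j)]

/-- The rank of every summand of the warped metric is constant near a point of the region of
constant signature. -/
theorem eventually_finrank_range_smul_eq (hF : ∀ j, HasLocalFrames (IF j) (F j))
    (hnd : IsNondegenerate gB) (hgF : ∀ j, IsSingularMetric (gF j)) (hf : ∀ j, Continuous (f j))
    {p : B × ∀ j, F j} (hp : p ∈ constSignatureRegion (warpedMetric gB gF f)) :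
    ∀ᶠ q in 𝓝 p, ∀ j,
      Module.finrank ℝ (LinearMap.range (f j q.1 ^ 2 • gF j (q.2 j)).toLinearMap)
        = Module.finrank ℝ (LinearMap.range (f j p.1 ^ 2 • gF j (p.2 j)).toLinearMap) := by
  have hlow : ∀ᶠ q in 𝓝 p, ∀ j,
      Module.finrank ℝ (LinearMap.range (f j p.1 ^ 2 • gF j (p.2 j)).toLinearMap)
        ≤ Module.finrank ℝ (LinearMap.range (f j q.1 ^ 2 • gF j (q.2 j)).toLinearMap) := by
    refine eventually_all.2 fun j => ?_
    -- At a zero of f_j the summand has rank 0 and the bound is trivial. Elsewhere f_j stays nonzero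
    -- nearby, and scaling by a nonzero number keeps the rank of g_j, which is lower semicontinuous.
    by_cases h0 : f j p.1 = 0
    · refine Eventually.of_forall fun q => ?_
      have : f j p.1 ^ 2 • gF j (p.2 j) = 0 := by
        rw [h0, zero_pow two_ne_zero]
        exact ContinuousLinearMap.ext fun v => ContinuousLinearMap.ext fun w =>
          zero_mul (gF j (p.2 j) v w)
      rw [this, ContinuousLinearMap.toLinearMap_zero, LinearMap.range_zero, finrank_bot]
      exact Nat.zero_le _
    · have h1 : ∀ᶠ q : B × ∀ j, F j in 𝓝 p, f j q.1 ≠ 0 :=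
        ((hf j).comp continuous_fst).continuousAt.eventually_ne h0
      have h2 := ((continuous_apply j).comp continuous_snd).continuousAt.eventually
        (eventually_finrank_range_le (hF j) (hgF j) (p.2 j))
      filter_upwards [h1, h2] with q hq hq'
      rw [ContinuousLinearMap.toLinearMap_smul, ContinuousLinearMap.toLinearMap_smul,
        LinearMap.range_smul _ _ (pow_ne_zero 2 h0), LinearMap.range_smul _ _ (pow_ne_zero 2 hq)]
      exact hq'
  filter_upwards [hlow, hp] with q h1 h2 j
  rw [finrank_range_warpedMetric hnd, finrank_range_warpedMetric hnd] at h2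
  -- Termwise inequalities between two equal sums are equalities.
  have := (Finset.sum_eq_sum_iff_of_le fun j _ => h1 j).1 (Nat.add_left_cancel h2).symm
  exact (this j (Finset.mem_univ j)).symm

/-- Only the j-th fiber coordinate is moved: the factor f_j² is then a nonzero constant, and the
constancy of the rank of f_j² g_j is inherited by g_j. -/
theorem mem_constSignatureRegion_fiber (hF : ∀ j, HasLocalFrames (IF j) (F j))
    (hnd : IsNondegenerate gB) (hgF : ∀ j, IsSingularMetric (gF j)) (hf : ∀ j, Continuous (f j))
    {p : B × ∀ j, F j} (hp : p ∈ constSignatureRegion (warpedMetric gB gF f)) {j : Fin l}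
    (hj : f j p.1 ≠ 0) : p.2 j ∈ constSignatureRegion (gF j) := by
  have h := eventually_finrank_range_smul_eq hF hnd hgF hf hp
  have hc : ContinuousAt (fun y : F j => (p.1, Function.update p.2 j y)) (p.2 j) :=
    (continuous_const.prodMk (continuous_const.update j continuous_id)).continuousAt
  rw [ContinuousAt, Function.update_eq_self] at hc
  filter_upwards [hc.eventually h] with y hy
  have := hy j
  rw [ContinuousLinearMap.toLinearMap_smul, ContinuousLinearMap.toLinearMap_smul,
    LinearMap.range_smul _ _ (pow_ne_zero 2 hj), LinearMap.range_smul _ _ (pow_ne_zero 2 hj)]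
    at this
  -- The tangent space depends on the point, so the updated coordinate is identified with `y` by
  -- substitution.
  have key : ∀ z, z = y → Module.finrank ℝ (LinearMap.range (gF j z).toLinearMap)
      = Module.finrank ℝ (LinearMap.range (gF j (p.2 j)).toLinearMap) →
      Module.finrank ℝ (LinearMap.range (gF j y).toLinearMap)
      = Module.finrank ℝ (LinearMap.range (gF j (p.2 j)).toLinearMap) := by
    rintro _ rfl
    exact id
  exact key _ (Function.update_self ..) this

/-- If f_j does not vanish identically near the base point, it is nonzero at base points arbitrarily
close by. Above such a point, at the same fiber point, the j-th summand has the rank of g_j, and by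
constancy this rank is the 0 found at `p`. -/
theorem mvfderiv_eq_zero_or_eq_zero (hF : ∀ j, HasLocalFrames (IF j) (F j))
    (hnd : IsNondegenerate gB) (hgF : ∀ j, IsSingularMetric (gF j)) (hf : ∀ j, Continuous (f j))
    {p : B × ∀ j, F j} (hp : p ∈ constSignatureRegion (warpedMetric gB gF f)) {j : Fin l}
    (hj : f j p.1 = 0) : mvfderiv IB (f j) p.1 = 0 ∨ gF j (p.2 j) = 0 := by
  have h := eventually_finrank_range_smul_eq hF hnd hgF hf hp
  by_cases he : ∀ᶠ x in 𝓝 p.1, f j x = 0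
  · left
    have : mvfderiv IB (f j) p.1 = mvfderiv IB (fun _ => (0 : ℝ)) p.1 :=
      Filter.EventuallyEq.mfderiv_eq (I' := 𝓘(ℝ, ℝ)) he
    rw [this]
    exact mfderiv_const
  · right
    have hc : ContinuousAt (fun x : B => (x, p.2)) p.1 :=
      (continuous_id.prodMk continuous_const).continuousAt
    obtain ⟨x, hx, hx'⟩ := ((not_eventually.1 he).and_eventually (hc.eventually h)).exists
    have h1 := hx' j
    have h0 : f j p.1 ^ 2 • gF j (p.2 j) = 0 := by
      rw [hj, zero_pow two_ne_zero]
      exact ContinuousLinearMap.ext fun v => ContinuousLinearMap.ext fun w =>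
        zero_mul (gF j (p.2 j) v w)
    rw [h0, ContinuousLinearMap.toLinearMap_zero, LinearMap.range_zero, finrank_bot,
      ContinuousLinearMap.toLinearMap_smul, LinearMap.range_smul _ _ (pow_ne_zero 2 hx)] at h1
    have h2 := LinearMap.range_eq_bot.1 (Submodule.finrank_eq_zero.1 h1)
    exact ContinuousLinearMap.ext fun v => congrArg (fun L => L v) h2

end WarpedRegion

section Nondegenerate

variable {E : Type*} [NormedAddCommGroup E] [NormedSpace ℝ E] {H : Type*} [TopologicalSpace H]
  {I : ModelWithCorners ℝ E H} {M : Type*} [TopologicalSpace M] [ChartedSpace H M]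
  {g : BilinField I M} {X Y Z T : VecField I M} {α τ : Form I M}

/-! ### Non-degenerate metrics -/

theorem IsNondegenerate.exists_apply_eq [FiniteDimensional ℝ E] (hnd : IsNondegenerate g) (p : M)
    (L : TangentSpace I p →ₗ[ℝ] ℝ) : ∃ v, ∀ w, g p v w = L w := by
  let G : E →ₗ[ℝ] Module.Dual ℝ E :=
    (LinearMap.toContinuousLinearMap (𝕜 := ℝ) (E := E) (F' := ℝ)).symm.toLinearMap
      ∘ₗ (show E →L[ℝ] E →L[ℝ] ℝ from g p).toLinearMap
  have hinj : Function.Injective G := by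
    rw [← LinearMap.ker_eq_bot, LinearMap.ker_eq_bot']
    exact fun v hv => hnd p v fun w => congrArg (fun A => A w) hv
  have hsurj := (LinearMap.injective_iff_surjective_of_finrank_eq_finrank
    (Subspace.dual_finrank_eq (K := ℝ) (V := E)).symm).1 hinj
  obtain ⟨v, hv⟩ := hsurj L
  exact ⟨v, fun w => congrArg (fun A : Module.Dual ℝ E => A w) hv⟩

theorem IsNondegenerate.constSignatureRegion_eq (hnd : IsNondegenerate g) :
    constSignatureRegion g = univ := by
  have h : ∀ p : M, Module.finrank ℝ (LinearMap.range (g p).toLinearMap) = Module.finrank ℝ E := by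
    intro p
    refine LinearMap.finrank_range_of_inj (f := (g p).toLinearMap) ?_
    rw [← LinearMap.ker_eq_bot, LinearMap.ker_eq_bot']
    exact fun v hv => hnd p v fun w => congrArg (fun A => A w) hv
  refine eq_univ_of_forall fun p => Eventually.of_forall fun q => ?_
  rw [h, h]

variable [IsManifold I ∞ M]

theorem IsNondegenerate.covDeriv_eq [FiniteDimensional ℝ E] (hnd : IsNondegenerate g)
    (X : VecField I M) (α : Form I M) : covDeriv g X α = pointwiseCovDeriv g X α := by
  funext Y p
  exact covDeriv_eq_pointwiseCovDeriv (by rw [hnd.constSignatureRegion_eq]; trivial)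

/-- A form tensorial at `p` is determined by its values on a frame, hence is a linear function of
Z_p; non-degeneracy represents every linear function. -/
theorem IsNondegenerate.exists_representsAt [FiniteDimensional ℝ E] (hnd : IsNondegenerate g)
    (hM : HasLocalFrames I M) {p : M}
    (congr : ∀ Z Z', IsSmoothField Z → IsSmoothField Z' → Z =ᶠ[𝓝 p] Z' → α Z p = α Z' p)
    (add : ∀ Z Z', IsSmoothField Z → IsSmoothField Z' → α (Z + Z') p = α Z p + α Z' p)
    (smul : ∀ (φ : M → ℝ) Z, IsSmoothFun (I := I) φ → IsSmoothField Z →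
      α (φ • Z) p = φ p * α Z p) : ∃ v, RepresentsAt g α p v := by
  obtain ⟨ι, _, e, x, he, hx, hs⟩ := hM p
  obtain ⟨v, hv⟩ := hnd.exists_apply_eq p
    (∑ a, (α (e a) p) • (mvfderiv I (x a) p).toLinearMap)
  refine ⟨v, fun Z hZ => ?_⟩
  rw [hv, LinearMap.sum_apply]
  have hsm : ∀ s : Finset ι, IsSmoothField (fun q => ∑ a ∈ s, dirDeriv Z (x a) q • e a q) :=
    fun s => IsSmoothField.sum (X := fun a => dirDeriv Z (x a) • e a) fun a _ =>
      (he a).smul (hZ.dirDeriv (hx a))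
  have h0 : α 0 p = 0 := by
    have := smul (fun _ => 0) 0 (.const 0) .zero
    rwa [zero_mul, smul_zero] at this
  have hsum : ∀ s : Finset ι, α (fun q => ∑ a ∈ s, dirDeriv Z (x a) q • e a q) p
      = ∑ a ∈ s, dirDeriv Z (x a) p * α (e a) p := by
    classical
    intro s
    induction s using Finset.induction_on with
    | empty =>
      simp only [Finset.sum_empty]
      exact h0
    | insert a s ha ih =>
      simp only [Finset.sum_insert ha]
      rw [← ih, ← smul _ _ (hZ.dirDeriv (hx a)) (he a)]
      exact add (dirDeriv Z (x a) • e a) _ ((he a).smul (hZ.dirDeriv (hx a))) (hsm s)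
  rw [congr Z (fun q => ∑ a, dirDeriv Z (x a) q • e a q) hZ (hsm _)
    (hs.mono fun q hq => (hq (Z q)).symm), hsum]
  exact Finset.sum_congr rfl fun a _ => mul_comm _ _

theorem isAnnihForm_differential [FiniteDimensional ℝ E] (hnd : IsNondegenerate g) {h : M → ℝ}
    (hh : IsSmoothFun (I := I) h) : IsAnnihForm g (differential (I := I) h) := by
  refine ⟨fun Z hZ => hZ.dirDeriv hh, fun p => ?_⟩
  obtain ⟨v, hv⟩ := hnd.exists_apply_eq p (mvfderiv I h p).toLinearMap
  exact ⟨v, fun Z _ => (hv (Z p)).symm⟩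

theorem IsNondegenerate.isRadicalStationary [FiniteDimensional ℝ E] (hnd : IsNondegenerate g)
    (hM : HasLocalFrames I M) (hg : IsSingularMetric g) : IsRadicalStationary g := by
  have := FiniteDimensional.complete ℝ E
  exact fun X Y hX hY p => hnd.exists_representsAt hM
    (fun Z Z' _ _ h => koszul_congr .rfl .rfl h)
    (fun Z Z' hZ hZ' => hg.koszul_add_right hX hY hZ hZ' p)
    (fun φ Z hφ hZ => hg.koszul_smul_right hφ hX hY hZ p)

/-- With respect to a non-degenerate metric, the inner product of smooth one-forms is smooth. -/
theorem IsNondegenerate.isSmoothFun_annihInner [FiniteDimensional ℝ E] [T2Space M]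
    (hnd : IsNondegenerate g) (hg : IsSingularMetric g) (hα : IsAnnihForm g α)
    (hτ : IsAnnihForm g τ) : IsSmoothFun (I := I) (annihInner g α τ) := by
  intro p
  obtain ⟨n, e, x, he, hx, hs⟩ := exists_dual_frame (I := I) p
  let δ : Fin n → Fin n → (Fin n → ℝ) →L[ℝ] (Fin n → ℝ) := fun a b =>
    (ContinuousLinearMap.proj (R := ℝ) (φ := fun _ : Fin n => ℝ) a).smulRight (Pi.single b 1)
  -- The Gram matrix of the frame as an operator: it sends the coefficients of a vector v to the
  -- values ⟨v, e_b⟩.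
  let ℓ : M → (Fin n → ℝ) →L[ℝ] (Fin n → ℝ) := fun q =>
    ∑ a, ∑ b, pairing g (e a) (e b) q • δ a b
  have hℓ : ∀ q c b, ℓ q c b = ∑ a, c a * pairing g (e a) (e b) q := by
    intro q c b
    simp only [ℓ, δ, sum_apply, smul_apply, ContinuousLinearMap.smulRight_apply,
      ContinuousLinearMap.proj_apply, Finset.sum_apply, Pi.smul_apply, smul_eq_mul, Pi.single_apply,
      mul_ite, mul_one, mul_zero]
    refine Finset.sum_congr rfl fun a _ => ?_
    rw [Finset.sum_ite_eq Finset.univ b, if_pos (Finset.mem_univ b), mul_comm]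
  have hℓs : ContMDiff I 𝓘(ℝ, (Fin n → ℝ) →L[ℝ] (Fin n → ℝ)) ∞ ℓ :=
    contMDiff_finsetSum fun a _ => contMDiff_finsetSum fun b _ =>
      (hg.smooth _ _ (he a) (he b)).contMDiff.smul contMDiff_const
  have hinv : ∀ᶠ q in 𝓝 p, ∃ L : (Fin n → ℝ) ≃L[ℝ] (Fin n → ℝ), ℓ q = L := by
    filter_upwards [hs] with q ⟨h1, h2⟩
    -- If all ⟨v, e_b⟩ vanish, then v = 0 by non-degeneracy, and the dual functions show that its
    -- coefficients vanish.
    have hinj : Function.Injective (ℓ q) := by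
      rw [injective_iff_map_eq_zero]
      intro c hc
      have h3 : ∑ a, c a • e a q = 0 := by
        refine hnd q _ fun w => ?_
        rw [← h1 w, map_sum]
        refine Finset.sum_eq_zero fun b _ => ?_
        have h4 : ℓ q c b = 0 := by rw [hc]; rfl
        rw [hℓ] at h4
        rw [map_smul, map_sum, sum_apply]
        refine (congrArg (mvfderiv I (x b) q w • ·) ?_).trans (smul_zero _)
        refine Eq.trans (Finset.sum_congr rfl fun a _ => ?_) h4
        rw [map_smul, smul_apply, smul_eq_mul, pairing]
      funext a
      have h5 := congrArg (mvfderiv I (x a) q) h3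
      simpa [map_sum, map_smul, h2] using h5
    exact ⟨(LinearEquiv.ofInjectiveEndo (ℓ q).toLinearMap hinj).toContinuousLinearEquiv, rfl⟩
  have hsm : ContMDiffAt I 𝓘(ℝ, (Fin n → ℝ) →L[ℝ] (Fin n → ℝ)) ∞ (fun q => (ℓ q).inverse) p := by
    obtain ⟨L, hL⟩ := hinv.self_of_nhds
    have h1 : ContDiffAt ℝ ∞ ContinuousLinearMap.inverse (ℓ p) := by
      rw [hL]
      exact contDiffAt_map_inverse L
    exact h1.contMDiffAt.comp p (hℓs p)
  have hvec : ContMDiffAt I 𝓘(ℝ, Fin n → ℝ) ∞ (fun q => fun b => α (e b) q) p :=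
    contMDiffAt_pi_space.2 fun b => (hα.1 _ (he b)).contMDiff p
  -- The coefficients of the vector representing α are the inverse Gram matrix applied to the values
  -- α(e_b); this makes them smooth near `p`.
  have hcoef : ContMDiffAt I 𝓘(ℝ, Fin n → ℝ) ∞ (fun q => (ℓ q).inverse (fun b => α (e b) q)) p :=
    hsm.clm_apply hvec
  have hfin : ContMDiffAt I 𝓘(ℝ, ℝ) ∞
      (fun q => ∑ a, (ℓ q).inverse (fun b => α (e b) q) a * τ (e a) q) p :=
    contMDiffAt_finsetSum fun a _ =>
      (contMDiffAt_pi_space.1 hcoef a).mul ((hτ.1 _ (he a)).contMDiff p)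
  refine hfin.congr_of_eventuallyEq ?_
  filter_upwards [hs, hinv] with q ⟨h1, h2⟩ ⟨L, hL⟩
  obtain ⟨v, hv⟩ := hα.2 q
  obtain ⟨w, hw⟩ := hτ.2 q
  let c : Fin n → ℝ := fun a => mvfderiv I (x a) q v
  have hc : ℓ q c = fun b => α (e b) q := by
    funext b
    rw [hℓ, hv _ (he b)]
    conv_rhs => rw [← h1 v]
    rw [map_sum, sum_apply]
    exact Finset.sum_congr rfl fun a _ => by rw [map_smul, smul_apply, smul_eq_mul, pairing]
  have hc' : (ℓ q).inverse (fun b => α (e b) q) = c := by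
    rw [← hc, hL, ContinuousLinearMap.inverse_equiv]
    exact L.symm_apply_apply c
  rw [hc', annihInner_eq (hasLocalFrames) hg hv hw]
  conv_lhs => rw [← h1 v]
  rw [map_sum, sum_apply]
  refine Finset.sum_congr rfl fun a _ => ?_
  rw [map_smul, smul_apply, smul_eq_mul, hw _ (he a), hg.symm]

theorem IsNondegenerate.isAnnihForm_covDeriv [FiniteDimensional ℝ E] [T2Space M]
    (hnd : IsNondegenerate g) (hg : IsSingularMetric g) (hα : IsAnnihForm g α)
    (hX : IsSmoothField X) : IsAnnihForm g (covDeriv g X α) := by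
  have := FiniteDimensional.complete ℝ E
  have hM : HasLocalFrames I M := hasLocalFrames
  have hr := hnd.isRadicalStationary hM hg
  rw [hnd.covDeriv_eq]
  refine ⟨fun T hT => (hX.dirDeriv (hα.1 T hT)).sub
    (hnd.isSmoothFun_annihInner hg (hr.isAnnihForm hg hX hT) hα), fun p => ?_⟩
  refine hnd.exists_representsAt hM (fun T T' hT hT' h => ?_)
    (fun T T' hT hT' => pointwiseCovDeriv_add_arg hM hg hr hα hX hT hT' p)
    (fun φ T hφ hT => pointwiseCovDeriv_smul_arg hM hg hr hα hφ hX hT p)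
  have h1 : α T =ᶠ[𝓝 p] α T' := h.mono fun q hq => hα.congr_apply hT hT' hq
  rw [pointwiseCovDeriv, pointwiseCovDeriv, dirDeriv_congr rfl h1,
    annihInner_congr (α := lowerDeriv g X T) (α' := lowerDeriv g X T')
      (fun _ _ => koszul_congr .rfl h .rfl) fun _ _ => rfl]

theorem IsNondegenerate.isSemiRegular [FiniteDimensional ℝ E] [T2Space M]
    (hnd : IsNondegenerate g) (hg : IsSingularMetric g) : IsSemiRegular g := by
  have := FiniteDimensional.complete ℝ E
  have hr := hnd.isRadicalStationary hasLocalFrames hg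
  exact ⟨hg, fun X Y hX hY => hr.isAnnihForm hg hX hY,
    fun X Y Z hX hY hZ => hnd.isAnnihForm_covDeriv hg (hr.isAnnihForm hg hX hY) hZ⟩

end Nondegenerate

/-- The convention a / 0 = 0 makes this valid at b = 0, which is what allows warping functions with
zeros. -/
theorem sq_mul_div_self (a b : ℝ) : b ^ 2 * (a / b) = b * a := by
  by_cases h : b = 0
  · simp [h]
  · field_simp

section WarpedCovDeriv

variable {EB : Type*} [NormedAddCommGroup EB] [NormedSpace ℝ EB] {HB : Type*} [TopologicalSpace HB]
  {IB : ModelWithCorners ℝ EB HB} {B : Type*} [TopologicalSpace B] [ChartedSpace HB B]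
  {l : ℕ} {EF : Fin l → Type*} [∀ j, NormedAddCommGroup (EF j)] [∀ j, NormedSpace ℝ (EF j)]
  {HF : Fin l → Type*} [∀ j, TopologicalSpace (HF j)]
  {IF : ∀ j, ModelWithCorners ℝ (EF j) (HF j)}
  {F : Fin l → Type*} [∀ j, TopologicalSpace (F j)] [∀ j, ChartedSpace (HF j) (F j)]
  [IsManifold IB ∞ B] [∀ j, IsManifold (IF j) ∞ (F j)]
  {gB : BilinField IB B} {gF : ∀ j, BilinField (IF j) (F j)} {f : Fin l → B → ℝ}
  {X Y Z T : VecField IB B} {U V W Q : ∀ j, VecField (IF j) (F j)} {p : B × ∀ j, F j}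

/-! ### The covariant derivative of a warped product -/

/-- A representative of `∇^♭` on split fields, built from representatives on the factors. -/
def warpedRep (gF : ∀ j, BilinField (IF j) (F j)) (f : Fin l → B → ℝ) (p : B × ∀ j, F j)
    (X Y : VecField IB B) (U V : ∀ j, VecField (IF j) (F j)) (v : TangentSpace IB p.1)
    (n : Fin l → TangentSpace IB p.1) (w : ∀ j, TangentSpace (IF j) (p.2 j)) :
    TangentSpace (IB.prod (ModelWithCorners.pi IF)) p :=
  tangentMk p (v - ∑ j, (f j p.1 * pairing (gF j) (U j) (V j) (p.2 j)) • n j) fun j =>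
    (dirDeriv X (f j) p.1 / f j p.1) • V j (p.2 j) + (dirDeriv Y (f j) p.1 / f j p.1) • U j (p.2 j)
      + w j

/-- Valid at every point, zeros of the f_j included: each W_j enters with f_j X(f_j), f_j Y(f_j) or
f_j², so `sq_mul_div_self` undoes the quotients. The terms with Z(f_j) go to the base through a
representative of df_j. -/
theorem koszul_warpedMetric_eq_warpedRep [CompleteSpace EB] [∀ j, CompleteSpace (EF j)]
    (hB : HasLocalFrames IB B) (hF : ∀ j, HasLocalFrames (IF j) (F j)) (hgB : IsSingularMetric gB)
    (hgF : ∀ j, IsSingularMetric (gF j)) (hf : ∀ j, IsSmoothFun (I := IB) (f j))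
    (hX : IsSmoothField X) (hY : IsSmoothField Y) (hU : ∀ j, IsSmoothField (U j))
    (hV : ∀ j, IsSmoothField (V j)) {v : TangentSpace IB p.1}
    (hv : RepresentsAt gB (lowerDeriv gB X Y) p.1 v)
    {n : Fin l → TangentSpace IB p.1} (hn : ∀ j, RepresentsAt gB (differential (f j)) p.1 (n j))
    {w : ∀ j, TangentSpace (IF j) (p.2 j)}
    (hw : ∀ j, RepresentsAt (gF j) (lowerDeriv (gF j) (U j) (V j)) (p.2 j) (w j))
    {L} (hL : L ∈ splitFields IB B IF F) :
    koszul (warpedMetric gB gF f) (splitField X U) (splitField Y V) L p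
      = warpedMetric gB gF f p (warpedRep gF f p X Y U V v n w) (L p) := by
  obtain ⟨Z, W, hZ, hW, rfl⟩ := hL
  rw [koszul_warpedMetric hB hF hgB hgF hf hX hY hZ hU hV hW, warpedMetric_apply]
  have h1 : koszul gB X Y Z p.1 = gB p.1 v (Z p.1) := hv Z hZ
  have h2 : ∀ j, dirDeriv Z (f j) p.1 = gB p.1 (n j) (Z p.1) := fun j => hn j Z hZ
  have h3 : ∀ j, koszul (gF j) (U j) (V j) (W j) (p.2 j) = gF j (p.2 j) (w j) (W j (p.2 j)) :=
    fun j => hw j (W j) (hW j)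
  simp only [warpedRep, splitField, tangentBase_mk, tangentFiber_mk, h1, h2, h3, map_sub, map_sum,
    map_smul, map_add, sub_apply, sum_apply, smul_apply, add_apply, smul_eq_mul]
  rw [sub_add, ← Finset.sum_sub_distrib, sub_eq_add_neg, ← Finset.sum_neg_distrib]
  refine congrArg _ (Finset.sum_congr rfl fun j _ => ?_)
  rw [mul_add, mul_add, ← mul_assoc, ← mul_assoc, sq_mul_div_self, sq_mul_div_self]
  simp only [pairing]
  ring

/-- The `j`-th summand of `(∇_X ∇^♭_Y Z)(T)` on split vector fields of a warped product. -/
def covSummand (gB : BilinField IB B) (gF : ∀ j, BilinField (IF j) (F j)) (f : Fin l → B → ℝ)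
    (X Y Z T : VecField IB B) (U V W Q : ∀ j, VecField (IF j) (F j)) (j : Fin l)
    (p : B × ∀ j, F j) : ℝ :=
  -(f j p.1 * hessian gB (f j) X T p.1 * pairing (gF j) (V j) (W j) (p.2 j))
  - dirDeriv T (f j) p.1 * (dirDeriv X (f j) p.1 * pairing (gF j) (V j) (W j) (p.2 j)
    + f j p.1 * dirDeriv (U j) (pairing (gF j) (V j) (W j)) (p.2 j)
    + dirDeriv Y (f j) p.1 * pairing (gF j) (U j) (W j) (p.2 j)
    + dirDeriv Z (f j) p.1 * pairing (gF j) (U j) (V j) (p.2 j)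
    + f j p.1 * koszul (gF j) (V j) (W j) (U j) (p.2 j))
  + f j p.1 * (dirDeriv X (dirDeriv Y (f j)) p.1 * pairing (gF j) (W j) (Q j) (p.2 j)
    + dirDeriv X (dirDeriv Z (f j)) p.1 * pairing (gF j) (V j) (Q j) (p.2 j)
    + dirDeriv Y (f j) p.1 * koszul (gF j) (U j) (W j) (Q j) (p.2 j)
    + dirDeriv Z (f j) p.1 * koszul (gF j) (U j) (V j) (Q j) (p.2 j)
    + dirDeriv X (f j) p.1 * koszul (gF j) (V j) (W j) (Q j) (p.2 j)
    + annihInner gB (lowerDeriv gB Y Z) (differential (f j)) p.1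
      * pairing (gF j) (U j) (Q j) (p.2 j)
    - (∑ k, f k p.1 * annihInner gB (differential (f k)) (differential (f j)) p.1
      * pairing (gF k) (V k) (W k) (p.2 k)) * pairing (gF j) (U j) (Q j) (p.2 j))
  + f j p.1 ^ 2 * covDeriv (gF j) (U j) (lowerDeriv (gF j) (V j) (W j)) (Q j) (p.2 j)

/-- `(∇_X ∇^♭_Y Z)(T)` on split vector fields of a warped product. -/
def warpedCovDeriv (gB : BilinField IB B) (gF : ∀ j, BilinField (IF j) (F j)) (f : Fin l → B → ℝ)
    (X Y Z T : VecField IB B) (U V W Q : ∀ j, VecField (IF j) (F j)) (p : B × ∀ j, F j) : ℝ :=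
  covDeriv gB X (lowerDeriv gB Y Z) T p.1 + ∑ j, covSummand gB gF f X Y Z T U V W Q j p

variable [FiniteDimensional ℝ EB] [∀ j, FiniteDimensional ℝ (EF j)] [T2Space B]
  [∀ j, T2Space (F j)] (hgB : IsSingularMetric gB) (hnd : IsNondegenerate gB)
  (hgF : ∀ j, IsSemiRegular (gF j)) (hf : ∀ j, IsSmoothFun (I := IB) (f j))
include hgB hnd hgF hf

theorem isRadicalStationary_warpedMetric : IsRadicalStationary (warpedMetric gB gF f) := by
  have := FiniteDimensional.complete ℝ EB
  have := fun j => FiniteDimensional.complete ℝ (EF j)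
  have hB : HasLocalFrames IB B := hasLocalFrames
  have hF : ∀ j, HasLocalFrames (IF j) (F j) := fun j => hasLocalFrames
  have hS := fun j => (hgF j).toIsSingularMetric
  refine isRadicalStationary_of_generators (isSingularMetric_warpedMetric hB hF hgB hS hf)
    (locallyGenerates_splitFields hB hF) ?_
  rintro _ ⟨X, U, hX, hU, rfl⟩ _ ⟨Y, V, hY, hV, rfl⟩ p
  obtain ⟨v, hv⟩ := hnd.isRadicalStationary hB hgB X Y hX hY p.1
  choose n hn using fun j => (isAnnihForm_differential hnd (hf j)).2 p.1
  choose w hw using fun j => ((hgF j).radical_stationary _ _ (hU j) (hV j)).2 (p.2 j)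
  exact ⟨_, fun L hL => koszul_warpedMetric_eq_warpedRep hB hF hgB hS hf hX hY hU hV hv hn hw hL⟩

omit [∀ j, T2Space (F j)] in
-- No term contains a quotient. Covariant derivatives in the base are smooth by non-degeneracy,
-- those in the fibers by semi-regularity.
theorem isSmoothFun_warpedCovDeriv (hX : IsSmoothField X) (hY : IsSmoothField Y)
    (hZ : IsSmoothField Z) (hT : IsSmoothField T) (hU : ∀ j, IsSmoothField (U j))
    (hV : ∀ j, IsSmoothField (V j)) (hW : ∀ j, IsSmoothField (W j))
    (hQ : ∀ j, IsSmoothField (Q j)) :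
    IsSmoothFun (I := IB.prod (ModelWithCorners.pi IF)) (warpedCovDeriv gB gF f X Y Z T U V W Q) := by
  have := FiniteDimensional.complete ℝ EB
  have := fun j => FiniteDimensional.complete ℝ (EF j)
  have hr := hnd.isRadicalStationary hasLocalFrames hgB
  have base : ∀ {h : B → ℝ}, IsSmoothFun (I := IB) h →
      IsSmoothFun (I := IB.prod (ModelWithCorners.pi IF)) (fun q : B × ∀ j, F j => h q.1) :=
    fun h => h.comp_base
  have fib : ∀ j {h : F j → ℝ}, IsSmoothFun (I := IF j) h →
      IsSmoothFun (I := IB.prod (ModelWithCorners.pi IF)) (fun q : B × ∀ j, F j => h (q.2 j)) :=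
    fun j _ h => h.comp_fiber
  have hd := fun j => isAnnihForm_differential hnd (hf j)
  have hG := fun j {A C : VecField (IF j) (F j)} (hA : IsSmoothField A) (hC : IsSmoothField C) =>
    fib j ((hgF j).smooth A C hA hC)
  have hK := fun j {A C D : VecField (IF j) (F j)} (hA : IsSmoothField A) (hC : IsSmoothField C)
    (hD : IsSmoothField D) => fib j ((hgF j).toIsSingularMetric.isSmoothFun_koszul hA hC hD)
  have hfj := fun j => base (hf j)
  have hD := fun j {A : VecField IB B} (hA : IsSmoothField A) => base (hA.dirDeriv (hf j))
  have hDD := fun j {A C : VecField IB B} (hA : IsSmoothField A) (hC : IsSmoothField C) =>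
    base (hA.dirDeriv (hC.dirDeriv (hf j)))
  refine (base ((hnd.isAnnihForm_covDeriv hgB (hr.isAnnihForm hgB hY hZ) hX).1 T hT)).add
    (IsSmoothFun.sum fun j _ => ?_)
  have hN := base (hnd.isSmoothFun_annihInner hgB (hr.isAnnihForm hgB hY hZ) (hd j))
  have hH := base ((hnd.isAnnihForm_covDeriv hgB (hd j) hX).1 T hT)
  have h1 := ((hfj j).mul hH).mul (hG j (hV j) (hW j))
  have h2 := (hD j hT).mul ((((((hD j hX).mul (hG j (hV j) (hW j))).add ((hfj j).mul
    (fib j ((hU j).dirDeriv ((hgF j).smooth _ _ (hV j) (hW j)))))).add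
    ((hD j hY).mul (hG j (hU j) (hW j)))).add ((hD j hZ).mul (hG j (hU j) (hV j)))).add
    ((hfj j).mul (hK j (hV j) (hW j) (hU j))))
  have h3 := IsSmoothFun.sum (s := Finset.univ) fun k _ =>
    ((hfj k).mul (base (hnd.isSmoothFun_annihInner hgB (hd k) (hd j)))).mul (hG k (hV k) (hW k))
  have h4 := (hfj j).mul ((((((((hDD j hX hY).mul (hG j (hW j) (hQ j))).add
    ((hDD j hX hZ).mul (hG j (hV j) (hQ j)))).add
    ((hD j hY).mul (hK j (hU j) (hW j) (hQ j)))).add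
    ((hD j hZ).mul (hK j (hU j) (hV j) (hQ j)))).add
    ((hD j hX).mul (hK j (hV j) (hW j) (hQ j)))).add (hN.mul (hG j (hU j) (hQ j)))).sub
    (h3.mul (hG j (hU j) (hQ j))))
  have h5 := ((hfj j).pow 2).mul
    (fib j (((hgF j).semi_regular _ _ _ (hV j) (hW j) (hU j)).1 _ (hQ j)))
  exact ((h1.neg.sub h2).add h4).add h5

end WarpedCovDeriv

/-! ### Semi-regularity and covariant derivative of the warped product. -/

section WarpedSemiRegular

variable {EB : Type*} [NormedAddCommGroup EB] [NormedSpace ℝ EB] {HB : Type*} [TopologicalSpace HB]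
  {IB : ModelWithCorners ℝ EB HB} {B : Type*} [TopologicalSpace B] [ChartedSpace HB B]
  {l : ℕ} {EF : Fin l → Type*} [∀ j, NormedAddCommGroup (EF j)] [∀ j, NormedSpace ℝ (EF j)]
  {HF : Fin l → Type*} [∀ j, TopologicalSpace (HF j)]
  {IF : ∀ j, ModelWithCorners ℝ (EF j) (HF j)}
  {F : Fin l → Type*} [∀ j, TopologicalSpace (F j)] [∀ j, ChartedSpace (HF j) (F j)]
  [IsManifold IB ∞ B] [∀ j, IsManifold (IF j) ∞ (F j)]
  {gB : BilinField IB B} {gF : ∀ j, BilinField (IF j) (F j)} {f : Fin l → B → ℝ}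
  {X Y Z T : VecField IB B} {U V W Q : ∀ j, VecField (IF j) (F j)} {p : B × ∀ j, F j}

theorem dirDeriv_koszul_warpedMetric [CompleteSpace EB] [∀ j, CompleteSpace (EF j)]
    (hB : HasLocalFrames IB B) (hF : ∀ j, HasLocalFrames (IF j) (F j)) (hgB : IsSingularMetric gB)
    (hgF : ∀ j, IsSingularMetric (gF j)) (hf : ∀ j, IsSmoothFun (I := IB) (f j))
    (hY : IsSmoothField Y) (hZ : IsSmoothField Z) (hT : IsSmoothField T)
    (hV : ∀ j, IsSmoothField (V j)) (hW : ∀ j, IsSmoothField (W j))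
    (hQ : ∀ j, IsSmoothField (Q j)) (p : B × ∀ j, F j) :
    dirDeriv (splitField X U)
        (koszul (warpedMetric gB gF f) (splitField Y V) (splitField Z W) (splitField T Q)) p
      = dirDeriv X (koszul gB Y Z T) p.1 + ∑ j,
        ((dirDeriv X (f j) p.1 * dirDeriv Y (f j) p.1 + f j p.1 * dirDeriv X (dirDeriv Y (f j)) p.1)
            * pairing (gF j) (W j) (Q j) (p.2 j)
          + f j p.1 * dirDeriv Y (f j) p.1 * dirDeriv (U j) (pairing (gF j) (W j) (Q j)) (p.2 j)
          + (dirDeriv X (f j) p.1 * dirDeriv Z (f j) p.1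
            + f j p.1 * dirDeriv X (dirDeriv Z (f j)) p.1) * pairing (gF j) (V j) (Q j) (p.2 j)
          + f j p.1 * dirDeriv Z (f j) p.1 * dirDeriv (U j) (pairing (gF j) (V j) (Q j)) (p.2 j)
          - (dirDeriv X (f j) p.1 * dirDeriv T (f j) p.1
            + f j p.1 * dirDeriv X (dirDeriv T (f j)) p.1) * pairing (gF j) (V j) (W j) (p.2 j)
          - f j p.1 * dirDeriv T (f j) p.1 * dirDeriv (U j) (pairing (gF j) (V j) (W j)) (p.2 j)
          + 2 * f j p.1 * dirDeriv X (f j) p.1 * koszul (gF j) (V j) (W j) (Q j) (p.2 j)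
          + f j p.1 ^ 2 * dirDeriv (U j) (koszul (gF j) (V j) (W j) (Q j)) (p.2 j)) := by
  rw [show koszul (warpedMetric gB gF f) (splitField Y V) (splitField Z W) (splitField T Q) = _ from
    funext (koszul_warpedMetric hB hF hgB hgF hf hY hZ hT hV hW hQ)]
  have key : ∀ (j : Fin l) {h : B → ℝ} {k : F j → ℝ}, IsSmoothFun (I := IB) h →
      IsSmoothFun (I := IF j) k →
      IsSmoothFun (I := IB.prod (ModelWithCorners.pi IF))
          (fun q : B × ∀ j, F j => h q.1 * k (q.2 j)) ∧
        dirDeriv (splitField X U) (fun q : B × ∀ j, F j => h q.1 * k (q.2 j)) p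
          = h p.1 * dirDeriv (U j) k (p.2 j) + dirDeriv X h p.1 * k (p.2 j) := by
    intro j h k hh hk
    refine ⟨hh.comp_base.mul hk.comp_fiber, ?_⟩
    rw [dirDeriv_mul (hh.comp_base.mdifferentiableAt p) (hk.comp_fiber.mdifferentiableAt p),
      dirDeriv_splitField_base _ _ hh, dirDeriv_splitField_fiber _ _ hk]
  have sK := hgB.isSmoothFun_koszul hY hZ hT
  have h1 := fun j => key j ((hf j).mul (hY.dirDeriv (hf j)))
    ((hgF j).smooth _ _ (hW j) (hQ j))
  have h2 := fun j => key j ((hf j).mul (hZ.dirDeriv (hf j)))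
    ((hgF j).smooth _ _ (hV j) (hQ j))
  have h3 := fun j => key j ((hf j).mul (hT.dirDeriv (hf j)))
    ((hgF j).smooth _ _ (hV j) (hW j))
  have h4 := fun j => key j ((hf j).pow 2) ((hgF j).isSmoothFun_koszul (hV j) (hW j) (hQ j))
  have sS := fun j => (((h1 j).1.add (h2 j).1).sub (h3 j).1).add (h4 j).1
  rw [dirDeriv_add (sK.comp_base.mdifferentiableAt p)
    ((IsSmoothFun.sum fun j _ => sS j).mdifferentiableAt p), dirDeriv_splitField_base _ _ sK,
    dirDeriv_sum _ sS]
  refine congrArg _ (Finset.sum_congr rfl fun j _ => ?_)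
  rw [dirDeriv_add ((((h1 j).1.add (h2 j).1).sub (h3 j).1).mdifferentiableAt p)
      ((h4 j).1.mdifferentiableAt p),
    dirDeriv_sub (((h1 j).1.add (h2 j).1).mdifferentiableAt p) ((h3 j).1.mdifferentiableAt p),
    dirDeriv_add ((h1 j).1.mdifferentiableAt p) ((h2 j).1.mdifferentiableAt p),
    (h1 j).2, (h2 j).2, (h3 j).2, (h4 j).2]
  have hm : ∀ {A : VecField IB B}, IsSmoothField A →
      dirDeriv X (fun q => f j q * dirDeriv A (f j) q) p.1
        = f j p.1 * dirDeriv X (dirDeriv A (f j)) p.1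
          + dirDeriv X (f j) p.1 * dirDeriv A (f j) p.1 := fun hA =>
    dirDeriv_mul ((hf j).mdifferentiableAt _) ((hA.dirDeriv (hf j)).mdifferentiableAt _)
  have hp : dirDeriv X (fun q => f j q ^ 2) p.1 = 2 * f j p.1 * dirDeriv X (f j) p.1 := by
    simp only [pow_two]
    rw [dirDeriv_mul ((hf j).mdifferentiableAt _) ((hf j).mdifferentiableAt _)]
    ring
  rw [hm hY, hm hZ, hm hT, hp]
  ring

variable [FiniteDimensional ℝ EB] [∀ j, FiniteDimensional ℝ (EF j)] [T2Space B]
  [∀ j, T2Space (F j)] (hgB : IsSingularMetric gB) (hnd : IsNondegenerate gB)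
  (hgF : ∀ j, IsSemiRegular (gF j)) (hf : ∀ j, IsSmoothFun (I := IB) (f j))
include hgB hnd hgF hf

/-- The inner product of lower derivatives of split vector fields, on the regions of constant
signature. -/
theorem annihInner_warpedMetric (hp : p ∈ constSignatureRegion (warpedMetric gB gF f))
    (hX : IsSmoothField X) (hY : IsSmoothField Y)
    (hZ : IsSmoothField Z) (hT : IsSmoothField T) (hU : ∀ j, IsSmoothField (U j))
    (hV : ∀ j, IsSmoothField (V j)) (hW : ∀ j, IsSmoothField (W j))
    (hQ : ∀ j, IsSmoothField (Q j)) :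
    annihInner (warpedMetric gB gF f)
        (lowerDeriv (warpedMetric gB gF f) (splitField X U) (splitField Y V))
        (lowerDeriv (warpedMetric gB gF f) (splitField Z W) (splitField T Q)) p
      = annihInner gB (lowerDeriv gB X Y) (lowerDeriv gB Z T) p.1 + ∑ j,
        (-(f j p.1 * pairing (gF j) (W j) (Q j) (p.2 j)
            * annihInner gB (lowerDeriv gB X Y) (differential (f j)) p.1)
          - f j p.1 * pairing (gF j) (U j) (V j) (p.2 j)
            * annihInner gB (lowerDeriv gB Z T) (differential (f j)) p.1
          + f j p.1 * pairing (gF j) (U j) (V j) (p.2 j)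
            * ∑ k, f k p.1 * annihInner gB (differential (f k)) (differential (f j)) p.1
              * pairing (gF k) (W k) (Q k) (p.2 k)
          + (dirDeriv X (f j) p.1 * dirDeriv Z (f j) p.1 * pairing (gF j) (V j) (Q j) (p.2 j)
            + dirDeriv X (f j) p.1 * dirDeriv T (f j) p.1 * pairing (gF j) (V j) (W j) (p.2 j)
            + dirDeriv Y (f j) p.1 * dirDeriv Z (f j) p.1 * pairing (gF j) (U j) (Q j) (p.2 j)
            + dirDeriv Y (f j) p.1 * dirDeriv T (f j) p.1 * pairing (gF j) (U j) (W j) (p.2 j))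
          + f j p.1 * (dirDeriv X (f j) p.1 * koszul (gF j) (W j) (Q j) (V j) (p.2 j)
            + dirDeriv Y (f j) p.1 * koszul (gF j) (W j) (Q j) (U j) (p.2 j)
            + dirDeriv Z (f j) p.1 * koszul (gF j) (U j) (V j) (Q j) (p.2 j)
            + dirDeriv T (f j) p.1 * koszul (gF j) (U j) (V j) (W j) (p.2 j))
          + f j p.1 ^ 2 * annihInner (gF j) (lowerDeriv (gF j) (U j) (V j))
            (lowerDeriv (gF j) (W j) (Q j)) (p.2 j)) := by
  have := FiniteDimensional.complete ℝ EB
  have := fun j => FiniteDimensional.complete ℝ (EF j)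
  have hB : HasLocalFrames IB B := hasLocalFrames
  have hF : ∀ j, HasLocalFrames (IF j) (F j) := fun j => hasLocalFrames
  have hS := fun j => (hgF j).toIsSingularMetric
  have hg := isSingularMetric_warpedMetric hB hF hgB hS hf
  have hgen := locallyGenerates_splitFields hB hF
  have hr := hnd.isRadicalStationary hB hgB
  obtain ⟨v, hv⟩ := hr X Y hX hY p.1
  obtain ⟨v', hv'⟩ := hr Z T hZ hT p.1
  choose n hn using fun j => (isAnnihForm_differential hnd (hf j)).2 p.1
  choose w hw using fun j => ((hgF j).radical_stationary _ _ (hU j) (hV j)).2 (p.2 j)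
  choose w' hw' using fun j => ((hgF j).radical_stationary _ _ (hW j) (hQ j)).2 (p.2 j)
  have e1 := representsAt_lowerDeriv_of_generators hg hgen (hX.splitField hU) (hY.splitField hV)
    fun L hL => koszul_warpedMetric_eq_warpedRep hB hF hgB hS hf hX hY hU hV hv hn hw hL
  have e2 := representsAt_lowerDeriv_of_generators hg hgen (hZ.splitField hW) (hT.splitField hQ)
    fun L hL => koszul_warpedMetric_eq_warpedRep hB hF hgB hS hf hZ hT hW hQ hv' hn hw' hL
  rw [annihInner_eq (hasLocalFrames_prod hB hF) hg e1 e2, annihInner_eq hB hgB hv hv',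
    warpedMetric_apply]
  have b1 : ∀ j, annihInner gB (lowerDeriv gB X Y) (differential (f j)) p.1 = gB p.1 v (n j) :=
    fun j => annihInner_eq hB hgB hv (hn j)
  have b2 : ∀ j, annihInner gB (lowerDeriv gB Z T) (differential (f j)) p.1 = gB p.1 (n j) v' :=
    fun j => (annihInner_eq hB hgB hv' (hn j)).trans (hgB.symm _ _ _)
  have b3 : ∀ j k, annihInner gB (differential (f k)) (differential (f j)) p.1
      = gB p.1 (n j) (n k) :=
    fun j k => (annihInner_eq hB hgB (hn k) (hn j)).trans (hgB.symm _ _ _)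
  have b4 : ∀ j, annihInner (gF j) (lowerDeriv (gF j) (U j) (V j))
      (lowerDeriv (gF j) (W j) (Q j)) (p.2 j) = gF j (p.2 j) (w j) (w' j) :=
    fun j => annihInner_eq (hF j) (hS j) (hw j) (hw' j)
  simp only [b1, b2, b3, b4, warpedRep, tangentBase_mk, tangentFiber_mk]
  -- The base components expand to the product on B, two mixed sums and a double sum. The last one
  -- couples different fibers through g_B^*(df_k, df_j).
  have base : gB p.1 (v - ∑ j, (f j p.1 * pairing (gF j) (U j) (V j) (p.2 j)) • n j)
      (v' - ∑ j, (f j p.1 * pairing (gF j) (W j) (Q j) (p.2 j)) • n j)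
      = gB p.1 v v' + ∑ j, (-(f j p.1 * pairing (gF j) (W j) (Q j) (p.2 j) * gB p.1 v (n j))
        - f j p.1 * pairing (gF j) (U j) (V j) (p.2 j) * gB p.1 (n j) v'
        + f j p.1 * pairing (gF j) (U j) (V j) (p.2 j) * ∑ k, f k p.1 * gB p.1 (n j) (n k)
              * pairing (gF k) (W k) (Q k) (p.2 k)) := by
    simp only [map_sub, map_sum, map_smul, sub_apply, sum_apply, smul_apply, smul_eq_mul,
      Finset.sum_add_distrib, Finset.sum_sub_distrib, Finset.sum_neg_distrib, Finset.mul_sum, mul_sub]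
    have hc : ∑ k, ∑ j, f k p.1 * pairing (gF k) (W k) (Q k) (p.2 k)
          * (f j p.1 * pairing (gF j) (U j) (V j) (p.2 j) * gB p.1 (n j) (n k))
        = ∑ j, ∑ k, f j p.1 * pairing (gF j) (U j) (V j) (p.2 j) * (f k p.1 * gB p.1 (n j) (n k)
              * pairing (gF k) (W k) (Q k) (p.2 k)) := by
      rw [Finset.sum_comm]
      exact Finset.sum_congr rfl fun j _ => Finset.sum_congr rfl fun k _ => by ring
    linarith [hc]
  rw [base, add_assoc, ← Finset.sum_add_distrib]
  refine congrArg _ (Finset.sum_congr rfl fun j _ => ?_)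
  have k1 : koszul (gF j) (W j) (Q j) (V j) (p.2 j) = gF j (p.2 j) (V j (p.2 j)) (w' j) :=
    (hw' j (V j) (hV j)).trans ((hS j).symm _ _ _)
  have k2 : koszul (gF j) (W j) (Q j) (U j) (p.2 j) = gF j (p.2 j) (U j (p.2 j)) (w' j) :=
    (hw' j (U j) (hU j)).trans ((hS j).symm _ _ _)
  have k3 : koszul (gF j) (U j) (V j) (Q j) (p.2 j) = gF j (p.2 j) (w j) (Q j (p.2 j)) :=
    hw j (Q j) (hQ j)
  have k4 : koszul (gF j) (U j) (V j) (W j) (p.2 j) = gF j (p.2 j) (w j) (W j (p.2 j)) :=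
    hw j (W j) (hW j)
  rw [k1, k2, k3, k4]
  simp only [pairing, map_add, map_smul, add_apply, smul_apply, smul_eq_mul]
  -- At a zero the quotients on the left are 0, while the right still contains products such as
  -- X(f_j) Z(f_j) g_j(V_j,Q_j). Constancy of the signature makes df_j or g_j vanish, and with it
  -- these products.
  by_cases h0 : f j p.1 = 0
  · rcases mvfderiv_eq_zero_or_eq_zero hF hnd hS (fun j => (hf j).continuous) hp h0 with h1 | h1
    · have h2 : ∀ A : VecField IB B, dirDeriv A (f j) p.1 = 0 := fun A => by
        rw [dirDeriv_eq_mvfderiv, h1]; rfl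
      simp [h0, h2]
    · have h2 : ∀ a b, gF j (p.2 j) a b = 0 := fun a b => by rw [h1]; rfl
      simp [h0, h2]
  · field_simp
    ring

theorem pointwiseCovDeriv_warpedMetric (hp : p ∈ constSignatureRegion (warpedMetric gB gF f))
    (hX : IsSmoothField X) (hY : IsSmoothField Y)
    (hZ : IsSmoothField Z) (hT : IsSmoothField T) (hU : ∀ j, IsSmoothField (U j))
    (hV : ∀ j, IsSmoothField (V j)) (hW : ∀ j, IsSmoothField (W j))
    (hQ : ∀ j, IsSmoothField (Q j)) :
    pointwiseCovDeriv (warpedMetric gB gF f) (splitField X U)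
        (lowerDeriv (warpedMetric gB gF f) (splitField Y V) (splitField Z W)) (splitField T Q) p
      = warpedCovDeriv gB gF f X Y Z T U V W Q p := by
  have := FiniteDimensional.complete ℝ EB
  have := fun j => FiniteDimensional.complete ℝ (EF j)
  have hB : HasLocalFrames IB B := hasLocalFrames
  have hF : ∀ j, HasLocalFrames (IF j) (F j) := fun j => hasLocalFrames
  have hS := fun j => (hgF j).toIsSingularMetric
  rw [pointwiseCovDeriv, annihInner_warpedMetric hgB hnd hgF hf hp hX hT hY hZ hU hQ hV hW]
  refine (congrArg (· - _) (dirDeriv_koszul_warpedMetric hB hF hgB hS hf hY hZ hT hV hW hQ p)).trans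
    ?_
  rw [warpedCovDeriv, hnd.covDeriv_eq, add_sub_add_comm, ← Finset.sum_sub_distrib]
  refine congrArg _ (Finset.sum_congr rfl fun j _ => ?_)
  rw [covSummand, hessian, hnd.covDeriv_eq]
  -- At a zero of f_j both sides vanish. Elsewhere the fiber point lies in a region of constant
  -- signature of g_j, where the covariant derivative is given by the pointwise formula.
  have c1 : f j p.1 ^ 2 * covDeriv (gF j) (U j) (lowerDeriv (gF j) (V j) (W j)) (Q j) (p.2 j)
      = f j p.1 ^ 2 * (dirDeriv (U j) (koszul (gF j) (V j) (W j) (Q j)) (p.2 j)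
        - annihInner (gF j) (lowerDeriv (gF j) (U j) (Q j)) (lowerDeriv (gF j) (V j) (W j))
          (p.2 j)) := by
    by_cases h0 : f j p.1 = 0
    · simp [h0]
    · rw [covDeriv_eq_pointwiseCovDeriv
        (mem_constSignatureRegion_fiber hF hnd hS (fun j => (hf j).continuous) hp h0)]
      rfl
  -- U⟨W,Q⟩ and U⟨V,Q⟩ split into two Koszul terms each; those with Q in the middle cancel against
  -- the inner product.
  have c2 := (hS j).koszul_add_koszul_swap_right (X := U j) (Y := W j) (Z := Q j) (p.2 j)
  have c3 := (hS j).koszul_add_koszul_swap_right (X := U j) (Y := V j) (Z := Q j) (p.2 j)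
  have c4 : pointwiseCovDeriv gB X (differential (f j)) T p.1
      = dirDeriv X (dirDeriv T (f j)) p.1
        - annihInner gB (lowerDeriv gB X T) (differential (f j)) p.1 := rfl
  rw [c1, c4, ← c2, ← c3, (hS j).pairing_comm (X := Q j) (Y := W j),
    (hS j).pairing_comm (X := Q j) (Y := V j)]
  ring

omit [∀ j, FiniteDimensional ℝ (EF j)] [∀ j, T2Space (F j)] in
/-- The value of `warpedCovDeriv` at a point is a covector of the form `v^♭`. -/
theorem exists_warpedCovDeriv_eq (p : B × ∀ j, F j)
    (hX : IsSmoothField X) (hY : IsSmoothField Y)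
    (hZ : IsSmoothField Z) (hU : ∀ j, IsSmoothField (U j))
    (hV : ∀ j, IsSmoothField (V j)) (hW : ∀ j, IsSmoothField (W j)) :
    ∃ v, ∀ T Q, IsSmoothField T → (∀ j, IsSmoothField (Q j)) →
      warpedCovDeriv gB gF f X Y Z T U V W Q p = warpedMetric gB gF f p v (splitField T Q p) := by
  have := FiniteDimensional.complete ℝ EB
  have hr := hnd.isRadicalStationary hasLocalFrames hgB
  have hd := fun j => isAnnihForm_differential hnd (hf j)
  obtain ⟨c, hc⟩ := (hnd.isAnnihForm_covDeriv hgB (hr.isAnnihForm hgB hY hZ) hX).2 p.1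
  choose n hn using fun j => (hd j).2 p.1
  choose h hh using fun j => (hnd.isAnnihForm_covDeriv hgB (hd j) hX).2 p.1
  choose w1 hw1 using fun j => ((hgF j).radical_stationary _ _ (hU j) (hW j)).2 (p.2 j)
  choose w2 hw2 using fun j => ((hgF j).radical_stationary _ _ (hU j) (hV j)).2 (p.2 j)
  choose w3 hw3 using fun j => ((hgF j).radical_stationary _ _ (hV j) (hW j)).2 (p.2 j)
  choose d hd' using fun j => ((hgF j).semi_regular _ _ _ (hV j) (hW j) (hU j)).2 (p.2 j)
  -- The terms in T are represented on the base through `h` (Hessians) and `n` (differentials).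
  -- Those in Q_j carry f_j and are divided by it to become fiber components, except the one with
  -- f_j², which is represented by `d j`.
  refine ⟨tangentMk p
    (c + ∑ j, (-((f j p.1 * pairing (gF j) (V j) (W j) (p.2 j)) • h j)
      - (dirDeriv X (f j) p.1 * pairing (gF j) (V j) (W j) (p.2 j)
        + f j p.1 * dirDeriv (U j) (pairing (gF j) (V j) (W j)) (p.2 j)
        + dirDeriv Y (f j) p.1 * pairing (gF j) (U j) (W j) (p.2 j)
        + dirDeriv Z (f j) p.1 * pairing (gF j) (U j) (V j) (p.2 j)
        + f j p.1 * koszul (gF j) (V j) (W j) (U j) (p.2 j)) • n j))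
    (fun j => (1 / f j p.1) • (dirDeriv X (dirDeriv Y (f j)) p.1 • W j (p.2 j)
      + dirDeriv X (dirDeriv Z (f j)) p.1 • V j (p.2 j)
      + dirDeriv Y (f j) p.1 • w1 j + dirDeriv Z (f j) p.1 • w2 j + dirDeriv X (f j) p.1 • w3 j
      + annihInner gB (lowerDeriv gB Y Z) (differential (f j)) p.1 • U j (p.2 j)
      - (∑ k, f k p.1 * annihInner gB (differential (f k)) (differential (f j)) p.1
        * pairing (gF k) (V k) (W k) (p.2 k)) • U j (p.2 j)) + d j), fun T Q hT hQ => ?_⟩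
  rw [warpedCovDeriv, warpedMetric_apply]
  simp only [splitField, tangentBase_mk, tangentFiber_mk]
  rw [hc T hT, map_add, add_apply, map_sum, sum_apply, add_assoc, ← Finset.sum_add_distrib]
  refine congrArg _ (Finset.sum_congr rfl fun j _ => ?_)
  have q0 : hessian gB (f j) X T p.1 = gB p.1 (h j) (T p.1) := hh j T hT
  have q1 : koszul (gF j) (U j) (W j) (Q j) (p.2 j) = gF j (p.2 j) (w1 j) (Q j (p.2 j)) :=
    hw1 j (Q j) (hQ j)
  have q2 : koszul (gF j) (U j) (V j) (Q j) (p.2 j) = gF j (p.2 j) (w2 j) (Q j (p.2 j)) :=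
    hw2 j (Q j) (hQ j)
  have q3 : koszul (gF j) (V j) (W j) (Q j) (p.2 j) = gF j (p.2 j) (w3 j) (Q j (p.2 j)) :=
    hw3 j (Q j) (hQ j)
  have q4 : dirDeriv T (f j) p.1 = gB p.1 (n j) (T p.1) := hn j T hT
  rw [covSummand, q0, q1, q2, q3, q4, hd' j (Q j) (hQ j)]
  simp only [map_add, map_sub, map_neg, map_smul, add_apply, sub_apply, neg_apply, smul_apply,
    smul_eq_mul]
  rw [mul_add (f j p.1 ^ 2), ← mul_assoc (f j p.1 ^ 2), sq_mul_div_self]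
  simp only [pairing]
  ring

theorem isSemiRegular_warpedMetric : IsSemiRegular (warpedMetric gB gF f) := by
  have := FiniteDimensional.complete ℝ EB
  have := fun j => FiniteDimensional.complete ℝ (EF j)
  have hB : HasLocalFrames IB B := hasLocalFrames
  have hF : ∀ j, HasLocalFrames (IF j) (F j) := fun j => hasLocalFrames
  have hS := fun j => (hgF j).toIsSingularMetric
  have hg := isSingularMetric_warpedMetric hB hF hgB hS hf
  have hgen := locallyGenerates_splitFields hB hF
  refine isSemiRegular_of_generators (hasLocalFrames_prod hB hF) hg hgen ?_ ?_
  · intro L₁ h₁ L₂ h₂ p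
    obtain ⟨v, hv⟩ := isRadicalStationary_warpedMetric hgB hnd hgF hf L₁ L₂
      (splitFields_smooth h₁) (splitFields_smooth h₂) p
    exact ⟨v, fun L₃ h₃ => hv L₃ (splitFields_smooth h₃)⟩
  · rintro p _ ⟨X, U, hX, hU, rfl⟩ _ ⟨Y, V, hY, hV, rfl⟩ _ ⟨Z, W, hZ, hW, rfl⟩
    obtain ⟨v, hv⟩ := exists_warpedCovDeriv_eq hgB hnd hgF hf p hX hY hZ hU hV hW
    refine ⟨v, ?_⟩
    rintro _ ⟨T, Q, hT, hQ, rfl⟩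
    exact ⟨warpedCovDeriv gB gF f X Y Z T U V W Q,
      isSmoothFun_warpedCovDeriv hgB hnd hgF hf hX hY hZ hT hU hV hW hQ,
      Eventually.of_forall fun q hq =>
        pointwiseCovDeriv_warpedMetric hgB hnd hgF hf hq hX hY hZ hT hU hV hW hQ, hv T Q hT hQ⟩

theorem covDeriv_warpedMetric (hX : IsSmoothField X) (hY : IsSmoothField Y)
    (hZ : IsSmoothField Z) (hT : IsSmoothField T) (hU : ∀ j, IsSmoothField (U j))
    (hV : ∀ j, IsSmoothField (V j)) (hW : ∀ j, IsSmoothField (W j))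
    (hQ : ∀ j, IsSmoothField (Q j)) (p : B × ∀ j, F j) :
    covDeriv (warpedMetric gB gF f) (splitField X U)
        (lowerDeriv (warpedMetric gB gF f) (splitField Y V) (splitField Z W)) (splitField T Q) p
      = warpedCovDeriv gB gF f X Y Z T U V W Q p := by
  have hB : HasLocalFrames IB B := hasLocalFrames
  have hF : ∀ j, HasLocalFrames (IF j) (F j) := fun j => hasLocalFrames
  have hS := fun j => (hgF j).toIsSingularMetric
  exact covDeriv_eq_of_continuousAt (hasLocalFrames_prod hB hF)
    (isSingularMetric_warpedMetric hB hF hgB hS hf)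
    (isSmoothFun_warpedCovDeriv hgB hnd hgF hf hX hY hZ hT hU hV hW hQ).continuous.continuousAt
    (Eventually.of_forall fun q hq =>
      pointwiseCovDeriv_warpedMetric hgB hnd hgF hf hq hX hY hZ hT hU hV hW hQ)

end WarpedSemiRegular

section Zero

variable {E : Type*} [NormedAddCommGroup E] [NormedSpace ℝ E] {H : Type*} [TopologicalSpace H]
  {I : ModelWithCorners ℝ E H} {M : Type*} [TopologicalSpace M] [ChartedSpace H M]
  {g : BilinField I M} {X Y Z T : VecField I M} {p : M}

/-! ### Vanishing arguments -/

@[simp]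
theorem pairing_zero_left (Y : VecField I M) (p : M) : pairing g 0 Y p = 0 := by
  simp [pairing]

@[simp]
theorem pairing_zero_right (X : VecField I M) (p : M) : pairing g X 0 p = 0 := by
  simp [pairing]

/-- Writing 0 as 0 • 0 turns homogeneity over smooth functions into the vanishing of expressions
with a zero argument. -/
theorem zero_smul_field (X : VecField I M) : (fun _ : M => (0 : ℝ)) • X = 0 := by
  funext q
  exact zero_smul ℝ (X q)

variable [IsManifold I ∞ M]

theorem IsSemiRegular.isRadicalStationary (hg : IsSemiRegular g) : IsRadicalStationary g :=
  fun X Y hX hY => (hg.radical_stationary X Y hX hY).2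

variable [FiniteDimensional ℝ E]

theorem IsSingularMetric.koszul_zero_left (hg : IsSingularMetric g) (hY : IsSmoothField Y)
    (hZ : IsSmoothField Z) (p : M) : koszul g 0 Y Z p = 0 := by
  have := FiniteDimensional.complete ℝ E
  have h := hg.koszul_smul_left (X := 0) (.const 0) .zero hY hZ p
  rwa [zero_smul_field, zero_mul] at h

theorem IsSingularMetric.koszul_zero_mid (hg : IsSingularMetric g) (hX : IsSmoothField X)
    (hZ : IsSmoothField Z) (p : M) : koszul g X 0 Z p = 0 := by
  have := FiniteDimensional.complete ℝ E
  have h := hg.koszul_smul_mid (Y := 0) (.const 0) hX .zero hZ p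
  rwa [zero_smul_field, zero_mul, pairing_zero_left, mul_zero, add_zero] at h

theorem IsSingularMetric.koszul_zero_right (hg : IsSingularMetric g) (hX : IsSmoothField X)
    (hY : IsSmoothField Y) (p : M) : koszul g X Y 0 p = 0 := by
  have := FiniteDimensional.complete ℝ E
  have h := hg.koszul_smul_right (Z := 0) (.const 0) hX hY .zero p
  rwa [zero_smul_field, zero_mul] at h

section CovDeriv

variable [T2Space M] {α : Form I M}

/-- Homogeneity is available for the pointwise formula; this carries its consequence over to the
limits at the remaining points. -/
theorem covDeriv_eq_zero (hg : IsSingularMetric g)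
    (h : ∀ p, pointwiseCovDeriv g X α Y p = 0) (p : M) : covDeriv g X α Y p = 0 :=
  covDeriv_eq_of_continuousAt hasLocalFrames hg (C := fun _ => 0) continuousAt_const
    (Eventually.of_forall fun q _ => h q)

theorem covDeriv_zero_dir (hg : IsSingularMetric g) (hr : IsRadicalStationary g)
    (hα : IsAnnihForm g α) (hY : IsSmoothField Y) (p : M) : covDeriv g 0 α Y p = 0 := by
  have := FiniteDimensional.complete ℝ E
  refine covDeriv_eq_zero hg (fun q => ?_) p
  have h := pointwiseCovDeriv_smul_dir (Z := 0) hasLocalFrames hg hr hα (.const 0) .zero hY q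
  rwa [zero_smul_field, zero_mul] at h

theorem covDeriv_zero_arg (hg : IsSingularMetric g) (hr : IsRadicalStationary g)
    (hα : IsAnnihForm g α) (hX : IsSmoothField X) (p : M) : covDeriv g X α 0 p = 0 := by
  have := FiniteDimensional.complete ℝ E
  refine covDeriv_eq_zero hg (fun q => ?_) p
  have h := pointwiseCovDeriv_smul_arg (T := 0) hasLocalFrames hg hr hα (.const 0) hX .zero q
  rwa [zero_smul_field, zero_mul] at h

theorem covDeriv_zero_left (hg : IsSingularMetric g) (hr : IsRadicalStationary g)
    (hX : IsSmoothField X) (hZ : IsSmoothField Z) (hT : IsSmoothField T) (p : M) :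
    covDeriv g X (lowerDeriv g 0 Z) T p = 0 := by
  have := FiniteDimensional.complete ℝ E
  refine covDeriv_eq_zero hg (fun q => ?_) p
  have h := pointwiseCovDeriv_smul_left (X := 0) hasLocalFrames hg hr (.const 0) hX .zero hZ hT q
  rwa [zero_smul_field, zero_mul, hg.koszul_zero_left hZ hT, mul_zero, add_zero] at h

theorem covDeriv_zero_mid (hg : IsSingularMetric g) (hr : IsRadicalStationary g)
    (hX : IsSmoothField X) (hY : IsSmoothField Y) (hT : IsSmoothField T) (p : M) :
    covDeriv g X (lowerDeriv g Y 0) T p = 0 := by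
  have := FiniteDimensional.complete ℝ E
  refine covDeriv_eq_zero hg (fun q => ?_) p
  have h := pointwiseCovDeriv_smul_mid (Y := 0) hasLocalFrames hg hr (.const 0) hX hY .zero hT q
  rwa [zero_smul_field, zero_mul, hg.koszul_zero_mid hY hT, hg.koszul_zero_mid hX hT,
    pairing_zero_left, mul_zero, mul_zero, mul_zero, add_zero, add_zero, add_zero] at h

end CovDeriv

namespace IsSemiRegular

variable [T2Space M]

theorem curvature_zero_first (hg : IsSemiRegular g) (hY : IsSmoothField Y) (hZ : IsSmoothField Z)
    (hT : IsSmoothField T) (p : M) : curvature g 0 Y Z T p = 0 := by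
  have hs := hg.toIsSingularMetric
  have hr := hg.isRadicalStationary
  rw [curvature, covDeriv_zero_dir hs hr (hg.radical_stationary _ _ hY hZ) hT,
    covDeriv_zero_left hs hr hY hZ hT, VectorField.mlieBracket_zero_left, lowerDeriv,
    hs.koszul_zero_left hZ hT]
  ring

theorem curvature_zero_second (hg : IsSemiRegular g) (hX : IsSmoothField X) (hZ : IsSmoothField Z)
    (hT : IsSmoothField T) (p : M) : curvature g X 0 Z T p = 0 := by
  have hs := hg.toIsSingularMetric
  have hr := hg.isRadicalStationary
  rw [curvature, covDeriv_zero_dir hs hr (hg.radical_stationary _ _ hX hZ) hT,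
    covDeriv_zero_left hs hr hX hZ hT, VectorField.mlieBracket_zero_right, lowerDeriv,
    hs.koszul_zero_left hZ hT]
  ring

theorem curvature_zero_third (hg : IsSemiRegular g) (hX : IsSmoothField X) (hY : IsSmoothField Y)
    (hT : IsSmoothField T) (p : M) : curvature g X Y 0 T p = 0 := by
  have := FiniteDimensional.complete ℝ E
  have hs := hg.toIsSingularMetric
  have hr := hg.isRadicalStationary
  rw [curvature, covDeriv_zero_mid hs hr hX hY hT, covDeriv_zero_mid hs hr hY hX hT, lowerDeriv,
    hs.koszul_zero_mid (hX.mlieBracket hY) hT]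
  ring

theorem curvature_zero_fourth (hg : IsSemiRegular g) (hX : IsSmoothField X) (hY : IsSmoothField Y)
    (hZ : IsSmoothField Z) (p : M) : curvature g X Y Z 0 p = 0 := by
  have := FiniteDimensional.complete ℝ E
  have hs := hg.toIsSingularMetric
  have hr := hg.isRadicalStationary
  rw [curvature, covDeriv_zero_arg hs hr (hg.radical_stationary _ _ hY hZ) hX,
    covDeriv_zero_arg hs hr (hg.radical_stationary _ _ hX hZ) hY, lowerDeriv,
    hs.koszul_zero_right (hX.mlieBracket hY) hZ]
  ring

theorem curvature_eq_zero (hg : IsSemiRegular g) (hX : IsSmoothField X) (hY : IsSmoothField Y)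
    (hZ : IsSmoothField Z) (hT : IsSmoothField T) (h : X = 0 ∨ Y = 0 ∨ Z = 0 ∨ T = 0) (p : M) :
    curvature g X Y Z T p = 0 := by
  rcases h with rfl | rfl | rfl | rfl
  · exact hg.curvature_zero_first hY hZ hT p
  · exact hg.curvature_zero_second hX hZ hT p
  · exact hg.curvature_zero_third hX hY hT p
  · exact hg.curvature_zero_fourth hX hY hZ p

end IsSemiRegular

end Zero

section WarpedCurvature

variable {EB : Type*} [NormedAddCommGroup EB] [NormedSpace ℝ EB] {HB : Type*} [TopologicalSpace HB]
  {IB : ModelWithCorners ℝ EB HB} {B : Type*} [TopologicalSpace B] [ChartedSpace HB B]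
  {l : ℕ} {EF : Fin l → Type*} [∀ j, NormedAddCommGroup (EF j)] [∀ j, NormedSpace ℝ (EF j)]
  {HF : Fin l → Type*} [∀ j, TopologicalSpace (HF j)]
  {IF : ∀ j, ModelWithCorners ℝ (EF j) (HF j)}
  {F : Fin l → Type*} [∀ j, TopologicalSpace (F j)] [∀ j, ChartedSpace (HF j) (F j)]
  [IsManifold IB ∞ B] [∀ j, IsManifold (IF j) ∞ (F j)]
  {gB : BilinField IB B} {gF : ∀ j, BilinField (IF j) (F j)} {f : Fin l → B → ℝ}
  {X Y Z T : VecField IB B} {U V W Q : ∀ j, VecField (IF j) (F j)}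
  [FiniteDimensional ℝ EB] [∀ j, FiniteDimensional ℝ (EF j)] [T2Space B]
  [∀ j, T2Space (F j)]

/-! ### The curvature of a warped product -/

/-- The curvature of a multiply warped product, on split vector fields. -/
theorem curvature_warpedMetric (hgB : IsSingularMetric gB) (hnd : IsNondegenerate gB)
    (hgF : ∀ j, IsSemiRegular (gF j)) (hf : ∀ j, IsSmoothFun (I := IB) (f j))
    (hX : IsSmoothField X) (hY : IsSmoothField Y)
    (hZ : IsSmoothField Z) (hT : IsSmoothField T) (hU : ∀ j, IsSmoothField (U j))
    (hV : ∀ j, IsSmoothField (V j)) (hW : ∀ j, IsSmoothField (W j))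
    (hQ : ∀ j, IsSmoothField (Q j)) (p : B × ∀ j, F j) :
    curvature (warpedMetric gB gF f) (splitField X U) (splitField Y V) (splitField Z W)
        (splitField T Q) p
      = curvature gB X Y Z T p.1 + ∑ j,
        (f j p.1 ^ 2 * curvature (gF j) (U j) (V j) (W j) (Q j) (p.2 j)
          + f j p.1 * (hessian gB (f j) X Z p.1 * pairing (gF j) (V j) (Q j) (p.2 j)
            - hessian gB (f j) Y Z p.1 * pairing (gF j) (U j) (Q j) (p.2 j)
            + hessian gB (f j) Y T p.1 * pairing (gF j) (U j) (W j) (p.2 j)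
            - hessian gB (f j) X T p.1 * pairing (gF j) (V j) (W j) (p.2 j))
          + ∑ k, f k p.1 * f j p.1 * annihInner gB (differential (f k)) (differential (f j)) p.1
            * (pairing (gF k) (U k) (W k) (p.2 k) * pairing (gF j) (V j) (Q j) (p.2 j)
              - pairing (gF k) (V k) (W k) (p.2 k) * pairing (gF j) (U j) (Q j) (p.2 j))) := by
  have := FiniteDimensional.complete ℝ EB
  have := fun j => FiniteDimensional.complete ℝ (EF j)
  have hB : HasLocalFrames IB B := hasLocalFrames
  have hF : ∀ j, HasLocalFrames (IF j) (F j) := fun j => hasLocalFrames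
  have hS := fun j => (hgF j).toIsSingularMetric
  rw [curvature, covDeriv_warpedMetric hgB hnd hgF hf hX hY hZ hT hU hV hW hQ,
    covDeriv_warpedMetric hgB hnd hgF hf hY hX hZ hT hV hU hW hQ,
    mlieBracket_splitField hB hF hX hY hU hV, lowerDeriv,
    koszul_warpedMetric hB hF hgB hS hf (hX.mlieBracket hY) hZ hT
      (fun j => (hU j).mlieBracket (hV j)) hW hQ, warpedCovDeriv, warpedCovDeriv, add_sub_add_comm,
    add_sub_add_comm, ← Finset.sum_sub_distrib, ← Finset.sum_sub_distrib]
  refine congrArg₂ (· + ·) rfl (Finset.sum_congr rfl fun j _ => ?_)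
  -- `k1`, `k2`, `k3` remove the terms with T(f_j): what antisymmetrization leaves is ⟨[U,V], W⟩,
  -- which the bracket term cancels. `k4` does the same for the terms with Z(f_j) and [U,V].
  have k1 := (hS j).koszul_add_koszul_swap_right (X := U j) (Y := V j) (Z := W j) (p.2 j)
  have k2 := (hS j).koszul_add_koszul_swap_right (X := V j) (Y := U j) (Z := W j) (p.2 j)
  have k3 : koszul (gF j) (U j) (V j) (W j) (p.2 j) - koszul (gF j) (V j) (U j) (W j) (p.2 j)
      = pairing (gF j) (VectorField.mlieBracket (IF j) (U j) (V j)) (W j) (p.2 j) :=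
    (hS j).koszul_sub_koszul_swap_left (p.2 j)
  have k4 : koszul (gF j) (U j) (V j) (Q j) (p.2 j) - koszul (gF j) (V j) (U j) (Q j) (p.2 j)
      = pairing (gF j) (VectorField.mlieBracket (IF j) (U j) (V j)) (Q j) (p.2 j) :=
    (hS j).koszul_sub_koszul_swap_left (p.2 j)
  -- This cancels the second derivatives of f_j along X and Y; those involving Z combine with the
  -- g_B^* terms into Hessians through `k6`.
  have k5 := hB.dirDeriv_mlieBracket hX hY (hf j) p.1
  have k6 : ∀ A C : VecField IB B, hessian gB (f j) A C p.1 = dirDeriv A (dirDeriv C (f j)) p.1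
      - annihInner gB (lowerDeriv gB A C) (differential (f j)) p.1 := fun A C => by
    rw [hessian, hnd.covDeriv_eq]
    rfl
  have k7 : ∀ (c : ℝ) (a b : Fin l → ℝ) (x y : ℝ),
      ∑ k, f k p.1 * c * annihInner gB (differential (f k)) (differential (f j)) p.1
          * (a k * x - b k * y)
        = c * ((∑ k, f k p.1 * annihInner gB (differential (f k)) (differential (f j)) p.1
            * a k) * x
          - (∑ k, f k p.1 * annihInner gB (differential (f k)) (differential (f j)) p.1
            * b k) * y) := by
    intro c a b x y
    rw [Finset.sum_mul, Finset.sum_mul, ← Finset.sum_sub_distrib, Finset.mul_sum]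
    exact Finset.sum_congr rfl fun k _ => by ring
  rw [k7, covSummand, covSummand, k5, ← k3, ← k4, ← k1, ← k2, k6 X Z, k6 Y Z, curvature, lowerDeriv,
    (hS j).pairing_comm (X := V j) (Y := U j)]
  ring

/-- The curvature on split vector fields one component of which vanishes in every factor. -/
theorem curvature_warpedMetric_of_eq_zero (hgB : IsSingularMetric gB) (hnd : IsNondegenerate gB)
    (hgF : ∀ j, IsSemiRegular (gF j)) (hf : ∀ j, IsSmoothFun (I := IB) (f j))
    (hX : IsSmoothField X) (hY : IsSmoothField Y)
    (hZ : IsSmoothField Z) (hT : IsSmoothField T) (hU : ∀ j, IsSmoothField (U j))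
    (hV : ∀ j, IsSmoothField (V j)) (hW : ∀ j, IsSmoothField (W j))
    (hQ : ∀ j, IsSmoothField (Q j)) (hB : X = 0 ∨ Y = 0 ∨ Z = 0 ∨ T = 0)
    (hF : ∀ j, U j = 0 ∨ V j = 0 ∨ W j = 0 ∨ Q j = 0) (p : B × ∀ j, F j) :
    curvature (warpedMetric gB gF f) (splitField X U) (splitField Y V) (splitField Z W)
        (splitField T Q) p
      = ∑ j, (f j p.1 * (hessian gB (f j) X Z p.1 * pairing (gF j) (V j) (Q j) (p.2 j)
            - hessian gB (f j) Y Z p.1 * pairing (gF j) (U j) (Q j) (p.2 j)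
            + hessian gB (f j) Y T p.1 * pairing (gF j) (U j) (W j) (p.2 j)
            - hessian gB (f j) X T p.1 * pairing (gF j) (V j) (W j) (p.2 j))
          + ∑ k, f k p.1 * f j p.1 * annihInner gB (differential (f k)) (differential (f j)) p.1
            * (pairing (gF k) (U k) (W k) (p.2 k) * pairing (gF j) (V j) (Q j) (p.2 j)
              - pairing (gF k) (V k) (W k) (p.2 k) * pairing (gF j) (U j) (Q j) (p.2 j))) := by
  rw [curvature_warpedMetric hgB hnd hgF hf hX hY hZ hT hU hV hW hQ,
    (hnd.isSemiRegular hgB).curvature_eq_zero hX hY hZ hT hB, zero_add]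
  refine Finset.sum_congr rfl fun j _ => ?_
  rw [(hgF j).curvature_eq_zero (hU j) (hV j) (hW j) (hQ j) (hF j), mul_zero, zero_add]

omit [IsManifold IB ∞ B] [∀ j, IsManifold (IF j) ∞ (F j)] [FiniteDimensional ℝ EB]
  [∀ j, FiniteDimensional ℝ (EF j)] [T2Space B] [∀ j, T2Space (F j)] in
theorem pairing_single_same (V W : ∀ j, VecField (IF j) (F j)) (a i : Fin l) (q : F i) :
    pairing (gF i) ((Pi.single a (V a) : ∀ j, VecField (IF j) (F j)) i)
        ((Pi.single a (W a) : ∀ j, VecField (IF j) (F j)) i) q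
      = if i = a then pairing (gF i) (V i) (W i) q else 0 := by
  by_cases h : i = a
  · subst h
    rw [Pi.single_eq_same, Pi.single_eq_same, if_pos rfl]
  · rw [Pi.single_eq_of_ne h, pairing_zero_left, if_neg h]

omit [∀ j, IsManifold (IF j) ∞ (F j)] [∀ j, FiniteDimensional ℝ (EF j)] [∀ j, T2Space (F j)] in
theorem single_eq_zero_or {a b : Fin l} (h : a ≠ b) (V : VecField (IF a) (F a))
    (W : VecField (IF b) (F b)) (i : Fin l) :
    (Pi.single a V : ∀ j, VecField (IF j) (F j)) i = 0
      ∨ (Pi.single b W : ∀ j, VecField (IF j) (F j)) i = 0 := by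
  by_cases hi : i = a
  · exact Or.inr (Pi.single_eq_of_ne (hi ▸ h) _)
  · exact Or.inl (Pi.single_eq_of_ne hi _)

omit [∀ j, IsManifold (IF j) ∞ (F j)] [∀ j, FiniteDimensional ℝ (EF j)] [∀ j, T2Space (F j)] in
theorem pairing_single_of_ne {a b : Fin l} (h : a ≠ b) (V W : ∀ j, VecField (IF j) (F j))
    (i : Fin l) (q : F i) :
    pairing (gF i) ((Pi.single a (V a) : ∀ j, VecField (IF j) (F j)) i)
      ((Pi.single b (W b) : ∀ j, VecField (IF j) (F j)) i) q = 0 := by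
  rcases single_eq_zero_or h (V a) (W b) i with e | e
  · rw [e, pairing_zero_left]
  · rw [e, pairing_zero_right]

end WarpedCurvature

end SingularGeometry

end

/-! ### The curvature identities for lifts. -/

theorem theorem5p5
    -- the base `B`
    {EB : Type*} [NormedAddCommGroup EB] [NormedSpace ℝ EB] [FiniteDimensional ℝ EB]
    {HB : Type*} [TopologicalSpace HB] {IB : ModelWithCorners ℝ EB HB} [IB.Boundaryless]
    {B : Type*} [TopologicalSpace B] [ChartedSpace HB B] [IsManifold IB ∞ B] [T2Space B]
    -- the fibers `F_1, …, F_l`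
    {l : ℕ} {EF : Fin l → Type*} [∀ j, NormedAddCommGroup (EF j)] [∀ j, NormedSpace ℝ (EF j)]
    [∀ j, FiniteDimensional ℝ (EF j)]
    {HF : Fin l → Type*} [∀ j, TopologicalSpace (HF j)]
    {IF : ∀ j, ModelWithCorners ℝ (EF j) (HF j)} [∀ j, (IF j).Boundaryless]
    {F : Fin l → Type*} [∀ j, TopologicalSpace (F j)] [∀ j, ChartedSpace (HF j) (F j)]
    [∀ j, IsManifold (IF j) ∞ (F j)] [∀ j, T2Space (F j)]
    -- the metrics and the warping functions
    (gB : BilinField IB B) (hgB : IsSingularMetric gB) (hndB : IsNondegenerate gB)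
    (gF : ∀ j, BilinField (IF j) (F j)) (hgF : ∀ j, IsSemiRegular (gF j))
    (f : Fin l → B → ℝ) (hf : ∀ j, IsSmoothFun (I := IB) (f j)) :
    -- the curvature of the multiply warped product makes sense
    IsSemiRegular (warpedMetric gB gF f) ∧
    ∀ (X Y Z T : VecField IB B), IsSmoothField X → IsSmoothField Y → IsSmoothField Z →
      IsSmoothField T →
    ∀ (U V W Q : ∀ j, VecField (IF j) (F j)), (∀ j, IsSmoothField (U j)) →
      (∀ j, IsSmoothField (V j)) → (∀ j, IsSmoothField (W j)) → (∀ j, IsSmoothField (Q j)) →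
    ∀ p : B × ∀ j, F j,
    -- (1)
    curvature (warpedMetric gB gF f) (liftB X) (liftB Y) (liftB Z) (liftB T) p =
      curvature gB X Y Z T p.1 ∧
    -- (2)
    (∀ j,
      curvature (warpedMetric gB gF f) (liftB X) (liftB Y) (liftB Z) (liftF j (Q j)) p = 0 ∧
      curvature (warpedMetric gB gF f) (liftB X) (liftB Y) (liftF j (W j)) (liftF j (Q j)) p = 0) ∧
    -- (3)
    (∀ j,
      curvature (warpedMetric gB gF f) (liftB X) (liftF j (V j)) (liftF j (W j)) (liftB T) p =
      -(f j p.1 * hessian gB (f j) X T p.1 * pairing (gF j) (V j) (W j) (p.2 j))) ∧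
    -- (4)
    (∀ j k, j ≠ k →
      curvature (warpedMetric gB gF f) (liftB X) (liftB Y) (liftF j (W j)) (liftF k (Q k)) p = 0 ∧
      curvature (warpedMetric gB gF f) (liftB X) (liftF j (V j)) (liftF k (W k)) (liftB T) p = 0 ∧
      curvature (warpedMetric gB gF f) (liftB X) (liftF j (V j)) (liftF k (W k)) (liftF j (Q j)) p = 0 ∧
      curvature (warpedMetric gB gF f) (liftB X) (liftF k (W k)) (liftF j (V j)) (liftF j (Q j)) p = 0) ∧
    -- (5)
    (∀ j,
      curvature (warpedMetric gB gF f) (liftF j (U j)) (liftF j (V j)) (liftB Z) (liftF j (Q j)) p = 0) ∧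
    -- (6)
    (∀ j k a, j ≠ k → j ≠ a → k ≠ a →
      curvature (warpedMetric gB gF f) (liftB X) (liftF k (W k)) (liftF j (V j)) (liftF a (Q a)) p = 0) ∧
    -- (7)
    (∀ j,
      curvature (warpedMetric gB gF f) (liftF j (U j)) (liftF j (V j)) (liftF j (W j)) (liftF j (Q j)) p =
      f j p.1 ^ 2 * curvature (gF j) (U j) (V j) (W j) (Q j) (p.2 j)
        + f j p.1 ^ 2 * annihInner gB (differential (f j)) (differential (f j)) p.1 *
          (pairing (gF j) (U j) (W j) (p.2 j) * pairing (gF j) (V j) (Q j) (p.2 j)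
            - pairing (gF j) (V j) (W j) (p.2 j) * pairing (gF j) (U j) (Q j) (p.2 j))) ∧
    -- (8)
    (∀ j k, j ≠ k →
      curvature (warpedMetric gB gF f) (liftF k (U k)) (liftF j (V j)) (liftF j (W j)) (liftF j (Q j)) p = 0 ∧
      curvature (warpedMetric gB gF f) (liftF k (U k)) (liftF k (V k)) (liftF j (W j)) (liftF j (Q j)) p = 0) ∧
    -- (9)
    (∀ j k, j ≠ k →
      curvature (warpedMetric gB gF f) (liftF k (U k)) (liftF j (V j)) (liftF k (W k)) (liftF j (Q j)) p =
        f k p.1 * f j p.1 * annihInner gB (differential (f k)) (differential (f j)) p.1 *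
          (pairing (gF k) (U k) (W k) (p.2 k) * pairing (gF j) (V j) (Q j) (p.2 j))) ∧
    -- (10)
    (∀ j k a, j ≠ k → j ≠ a → k ≠ a →
      curvature (warpedMetric gB gF f) (liftF j (U j)) (liftF j (V j)) (liftF k (W k)) (liftF a (Q a)) p = 0 ∧
      curvature (warpedMetric gB gF f) (liftF j (U j)) (liftF k (V k)) (liftF j (W j)) (liftF a (Q a)) p = 0) ∧
    -- (11)
    (∀ j k a c, j ≠ k → j ≠ a → j ≠ c → k ≠ a → k ≠ c → a ≠ c →
      curvature (warpedMetric gB gF f) (liftF j (U j)) (liftF k (V k)) (liftF a (W a)) (liftF c (Q c)) p = 0) := by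
  have hrB := hndB.isRadicalStationary hasLocalFrames hgB
  have hd := fun j => isAnnihForm_differential hndB (hf j)
  refine ⟨isSemiRegular_warpedMetric hgB hndB hgF hf, ?_⟩
  intro X Y Z T hX hY hZ hT U V W Q hU hV hW hQ p
  have z : IsSmoothField (0 : VecField IB B) := .zero
  have z' : ∀ j, IsSmoothField ((0 : ∀ j, VecField (IF j) (F j)) j) := fun _ => .zero
  -- A lift from a fiber has base component 0; this discards the Hessian terms in which it appears.
  have Hl : ∀ A, IsSmoothField A → ∀ j, hessian gB (f j) 0 A p.1 = 0 := fun A hA j =>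
    covDeriv_zero_dir hgB hrB (hd j) hA p.1
  have Hr : ∀ A, IsSmoothField A → ∀ j, hessian gB (f j) A 0 p.1 = 0 := fun A hA j =>
    covDeriv_zero_arg hgB hrB (hd j) hA p.1
  have s := fun j {A : VecField (IF j) (F j)} (hA : IsSmoothField A) => isSmoothField_single j hA
  -- For all items but (1) and (7), some argument has zero base component and, in each fiber, some
  -- argument has zero component, so neither R_B nor any R_{F_j} survives.
  have R0 := fun {X Y Z T : VecField IB B} {U V W Q : ∀ j, VecField (IF j) (F j)} =>
    curvature_warpedMetric_of_eq_zero (X := X) (Y := Y) (Z := Z) (T := T) (U := U) (V := V)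
      (W := W) (Q := Q) hgB hndB hgF hf
  simp only [liftB_eq_splitField, liftF_eq_splitField]
  refine ⟨?_, fun j => ⟨?_, ?_⟩, fun j => ?_, fun j k hjk => ⟨?_, ?_, ?_, ?_⟩, fun j => ?_,
    fun j k a hjk hja hka => ?_, fun j => ?_, fun j k hjk => ⟨?_, ?_⟩, fun j k hjk => ?_,
    fun j k a hjk hja hka => ⟨?_, ?_⟩, fun j k a c hjk hja hjc hka hkc hac => ?_⟩
  · rw [curvature_warpedMetric hgB hndB hgF hf hX hY hZ hT z' z' z' z', add_eq_left]
    refine Finset.sum_eq_zero fun i _ => ?_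
    rw [(hgF i).curvature_eq_zero (z' i) (z' i) (z' i) (z' i) (Or.inl rfl)]
    simp
  · rw [R0 hX hY hZ z z' z' z' (s j (hQ j))
      (Or.inr (Or.inr (Or.inr rfl))) (fun _ => Or.inl rfl)]
    simp [Hr _ hX, Hr _ hY]
  · rw [R0 hX hY z z z' z' (s j (hW j)) (s j (hQ j))
      (Or.inr (Or.inr (Or.inl rfl))) (fun _ => Or.inl rfl)]
    simp [Hr _ hX, Hr _ hY]
  · rw [R0 hX z z hT z' (s j (hV j)) (s j (hW j)) z'
      (Or.inr (Or.inl rfl)) (fun _ => Or.inl rfl)]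
    simp [pairing_single_same, Hl 0 z, Hl _ hT, Hr _ hX]
    ring
  · rw [R0 hX hY z z z' z' (s j (hW j)) (s k (hQ k))
      (Or.inr (Or.inr (Or.inl rfl))) (fun _ => Or.inl rfl)]
    simp [Hr _ hX, Hr _ hY]
  · rw [R0 hX z z hT z' (s j (hV j)) (s k (hW k)) z'
      (Or.inr (Or.inl rfl)) (fun _ => Or.inl rfl)]
    simp [pairing_single_of_ne hjk, Hl 0 z, Hl _ hT, Hr _ hX]
  · rw [R0 hX z z z z' (s j (hV j)) (s k (hW k)) (s j (hQ j))
      (Or.inr (Or.inl rfl)) (fun _ => Or.inl rfl)]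
    simp [pairing_single_same, pairing_single_of_ne hjk, Hl 0 z, Hr _ hX]
  · rw [R0 hX z z z z' (s k (hW k)) (s j (hV j)) (s j (hQ j))
      (Or.inr (Or.inl rfl)) (fun _ => Or.inl rfl)]
    simp [pairing_single_of_ne hjk.symm, Hl 0 z, Hr _ hX]
  · rw [R0 z z hZ z (s j (hU j)) (s j (hV j)) z' (s j (hQ j))
      (Or.inl rfl) (fun _ => Or.inr (Or.inr (Or.inl rfl)))]
    simp [pairing_single_same, Hl 0 z, Hl _ hZ]
  · rw [R0 hX z z z z' (s k (hW k)) (s j (hV j)) (s a (hQ a))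
      (Or.inr (Or.inl rfl)) (fun _ => Or.inl rfl)]
    simp [pairing_single_of_ne hjk.symm, pairing_single_of_ne hka, Hl 0 z, Hr _ hX]
  -- All four arguments come from the j-th fiber, so both the sum over factors and the inner sum
  -- reduce to the index j.
  · rw [curvature_warpedMetric hgB hndB hgF hf z z z z (s j (hU j)) (s j (hV j)) (s j (hW j))
      (s j (hQ j)), (hndB.isSemiRegular hgB).curvature_zero_first z z z, zero_add,
      Finset.sum_eq_single j, Finset.sum_eq_single j]
    · simp only [Pi.single_eq_same, Hl 0 z]
      ring
    · intro k _ hk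
      simp [hk]
    · simp
    · intro i _ hi
      rw [(hgF i).curvature_eq_zero (s j (hU j) i) (s j (hV j) i) (s j (hW j) i) (s j (hQ j) i)
        (Or.inl (Pi.single_eq_of_ne hi _))]
      simp [pairing_single_same, hi, Hl 0 z]
    · simp
  · rw [R0 z z z z (s k (hU k)) (s j (hV j)) (s j (hW j)) (s j (hQ j))
      (Or.inl rfl) (fun i => (single_eq_zero_or hjk.symm _ _ i).elim
      (fun e => Or.inl e) fun e => Or.inr (Or.inl e))]
    simp [pairing_single_same, pairing_single_of_ne hjk.symm, Hl 0 z]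
  · rw [R0 z z z z (s k (hU k)) (s k (hV k)) (s j (hW j)) (s j (hQ j))
      (Or.inl rfl) (fun i => (single_eq_zero_or hjk.symm _ _ i).elim
      (fun e => Or.inl e) fun e => Or.inr (Or.inr (Or.inl e)))]
    simp [pairing_single_of_ne hjk.symm, Hl 0 z]
  · rw [R0 z z z z (s k (hU k)) (s j (hV j)) (s k (hW k)) (s j (hQ j))
      (Or.inl rfl) (fun i => (single_eq_zero_or hjk.symm _ _ i).elim
      (fun e => Or.inl e) fun e => Or.inr (Or.inl e))]
    -- Of the double sum only the product of ⟨U_k, W_k⟩ and ⟨V_j, Q_j⟩ remains; the other product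
    -- pairs fields from different fibers.
    simp [pairing_single_same, pairing_single_of_ne hjk, pairing_single_of_ne hjk.symm, Hl 0 z]
  · rw [R0 z z z z (s j (hU j)) (s j (hV j)) (s k (hW k)) (s a (hQ a))
      (Or.inl rfl) (fun i => (single_eq_zero_or hjk _ _ i).elim
      (fun e => Or.inl e) fun e => Or.inr (Or.inr (Or.inl e)))]
    simp [pairing_single_of_ne hjk, pairing_single_of_ne hja, Hl 0 z]
  · rw [R0 z z z z (s j (hU j)) (s k (hV k)) (s j (hW j)) (s a (hQ a))
      (Or.inl rfl) (fun i => (single_eq_zero_or hjk _ _ i).elim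
      (fun e => Or.inl e) fun e => Or.inr (Or.inl e))]
    simp [pairing_single_same, pairing_single_of_ne hja, pairing_single_of_ne hjk.symm,
      pairing_single_of_ne hka, Hl 0 z]
  · rw [R0 z z z z (s j (hU j)) (s k (hV k)) (s a (hW a)) (s c (hQ c))
      (Or.inl rfl) (fun i => (single_eq_zero_or hjk _ _ i).elim
      (fun e => Or.inl e) fun e => Or.inr (Or.inl e))]
    simp [pairing_single_of_ne hja, pairing_single_of_ne hjc, pairing_single_of_ne hka,
      pairing_single_of_ne hkc, Hl 0 z]
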